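/- \textbf{Proposition.} For all integers $m>1$ and $n\ge 1$ there is a constant $C=C(m,n)$ such that the following holds for every number field $K$ of degree $n$ over $\mathbb{Q}$ and every elliptic curve $E$ over $K$. Write $G_F=\mathrm{Gal}(\overline F/F)$ and let $H^1(F,A)$ be the (continuous) first cohomology of $G_F$ with values in a discrete $G_F$-module $A$. For a place $v$ of $K$ let $K_v$ be the completion, and for $v$ finite let $I_v\le G_{K_v}$ be the inertia group. Let $E[m]$ be the $G_K$-module of $m$-torsion points of $E(\overline K)$, and define $$\mathrm{Sel}_m(E):=\ker\Bigl(H^1(K,E[m])\to\prod_v H^1(K_v,E)\Bigr),$$ the product being over all places $v$ of $K$, finite and infinite. For a finite $G_K$-module $A$, let $$\mathrm{Cl}(A):=\ker\Bigl(H^1(K,A)\to\prod_v{}^{'}\, H^1(K_v,A)/H^1_{\mathrm{ur}}(K_v,A)\Bigr),\qquad H^1_{\mathrm{ur}}(K_v,A):=\ker\bigl(H^1(K_v,A)\to H^1(I_v,A)\bigr),$$ where the product is over all finite places $v$ at which $A$ is unramified, that is, at which $I_v$ acts trivially on $A$. Let $s$ be the number of finite places of $K$ dividing $m\Delta(E)$,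 where $\Delta(E)$ is the minimal discriminant ideal of $E/K$ (a finite place $v$ divides $\Delta(E)$ if and only if the discriminant of a minimal Weierstrass equation of $E$ over $K_v$ is not a $v$-adic unit). Then $\mathrm{Sel}_m(E)$ and $\mathrm{Cl}(E[m])$ are finite, and $$\left|\log\left(\frac{\#\mathrm{Sel}_m(E)}{\#\mathrm{Cl}(E[m])}\right)\right|\le C\,s .$$ -/

import Mathlib

open IsDedekindDomain NumberField CategoryTheory

universe u

noncomputable section

namespace EllSel

/-! ### Absolute Galois groups and their restriction maps -/

/-- The absolute Galois group `G_F = Gal(F̄/F)` with the Krull topology (it is only used for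
fields of characteristic zero, where `F̄` is a separable closure). -/
abbrev AbsGal (F : Type u) [Field F] : Type u :=
  AlgebraicClosure F ≃ₐ[F] AlgebraicClosure F

section Restriction

variable (K L : Type u) [Field K] [Field L] [Algebra K L]

/-- A `K`-embedding `K̄ → L̄`, fixed once and for all, for an extension `L / K`. -/
def closureEmb : AlgebraicClosure K →ₐ[K] AlgebraicClosure L :=
  IsAlgClosed.lift

/-- The restriction homomorphism `G_L → G_K` along `closureEmb`, without its continuity. -/
def galResHom : AbsGal L →* AbsGal K :=
  letI := (closureEmb K L).toRingHom.toAlgebra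
  haveI : IsScalarTower K (AlgebraicClosure K) (AlgebraicClosure L) :=
    IsScalarTower.of_algebraMap_eq fun x => ((closureEmb K L).commutes x).symm
  (AlgEquiv.restrictNormalHom (F := K) (K₁ := AlgebraicClosure L) (AlgebraicClosure K)).comp
    { toFun := fun σ => σ.restrictScalars K
      map_one' := rfl
      map_mul' := fun _ _ => rfl }

lemma closureEmb_galResHom (σ : AbsGal L) (x : AlgebraicClosure K) :
    closureEmb K L (galResHom K L σ x) = σ (closureEmb K L x) := by
  let := (closureEmb K L).toRingHom.toAlgebra
  have : IsScalarTower K (AlgebraicClosure K) (AlgebraicClosure L) :=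
    IsScalarTower.of_algebraMap_eq fun x => ((closureEmb K L).commutes x).symm
  exact AlgEquiv.restrictNormal_commutes (σ.restrictScalars K) (AlgebraicClosure K) x

lemma continuous_galResHom : Continuous (galResHom K L) := by
  refine continuous_of_continuousAt_one _ ?_
  rw [ContinuousAt, map_one]
  intro U hU
  obtain ⟨E, hE, hEU⟩ := (krullTopology_mem_nhds_one_iff K (AlgebraicClosure K) U).mp hU
  obtain ⟨S, hS⟩ := IntermediateField.fg_of_fg_toSubalgebra E
    (Subalgebra.fg_of_fg_toSubmodule (Module.Finite.iff_fg.mp hE))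
  let F : IntermediateField L (AlgebraicClosure L) :=
    IntermediateField.adjoin L (closureEmb K L '' (S : Set (AlgebraicClosure K)))
  have : FiniteDimensional L F :=
    IntermediateField.finiteDimensional_adjoin fun x _ => Algebra.IsIntegral.isIntegral x
  refine (krullTopology_mem_nhds_one_iff L (AlgebraicClosure L) _).mpr ⟨F, this, ?_⟩
  intro σ hσ
  refine hEU ?_
  have key : E ≤ IntermediateField.fixedField (Subgroup.zpowers (galResHom K L σ)) := by
    rw [← hS, IntermediateField.adjoin_le_iff]
    intro x hx
    have hfix : galResHom K L σ x = x := by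
      refine (closureEmb K L).injective (?_ : closureEmb K L _ = closureEmb K L x)
      rw [closureEmb_galResHom]
      exact hσ ⟨_, IntermediateField.subset_adjoin L _ ⟨x, hx, rfl⟩⟩
    rintro ⟨τ, hτ⟩
    have : Subgroup.zpowers (galResHom K L σ) ≤ MulAction.stabilizer (AbsGal K) x := by
      rw [Subgroup.zpowers_le]; exact hfix
    exact this hτ
  rintro ⟨x, hx⟩
  exact key hx ⟨_, Subgroup.mem_zpowers _⟩

/-- The continuous restriction homomorphism `G_L → G_K`. -/
def galRes : AbsGal L →ₜ* AbsGal K :=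
  ⟨galResHom K L, continuous_galResHom K L⟩

end Restriction

/-! ### Discrete modules and their first cohomology -/

/-- An abelian group with an additive action of `G`, given the discrete topology, as an object of
the category of topological `G`-modules. -/
def discreteRep {G A : Type u} [Group G] [AddCommGroup A] (ρ : G →* AddMonoid.End A) :
    TopRep.{u} ℤ G :=
  letI : TopologicalSpace A := ⊥
  haveI : DiscreteTopology A := ⟨rfl⟩
  TopRep.of (X := A) (ContRepresentation.ofMonoidHom
    { toFun := fun g => ⟨(ρ g).toIntLinearMap, continuous_of_discreteTopology⟩
      map_one' := by ext; simp only [map_one]; rfl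
      map_mul' := fun g h => by ext; simp only [map_mul]; rfl })

/-- For `φ : H → G`, an additive map `f` with `f (φ h • a) = h • f a` as a morphism of
topological `H`-modules. -/
def discreteHom {G H A B : Type u} [Group G] [Group H] [AddCommGroup A] [AddCommGroup B]
    {ρ : G →* AddMonoid.End A} {τ : H →* AddMonoid.End B} (φ : H →* G) (f : A →+ B)
    (hf : ∀ h a, f (ρ (φ h) a) = τ h (f a)) :
    TopRep.res φ (discreteRep ρ) ⟶ discreteRep τ :=
  letI : TopologicalSpace A := ⊥
  letI : TopologicalSpace B := ⊥
  haveI : DiscreteTopology A := ⟨rfl⟩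
  haveI : DiscreteTopology B := ⟨rfl⟩
  TopRep.ofHom ⟨⟨f.toIntLinearMap, continuous_bot⟩, fun h => by
    ext a; exact hf h a⟩

/-- Continuous cohomology `H¹(G, X)`. -/
abbrev H1 {G : Type u} [Group G] [TopologicalSpace G] [IsTopologicalGroup G]
    (X : TopRep.{u} ℤ G) : TopModuleCat.{u} ℤ :=
  continuousCohomology 1 X

/-- The restriction map `H¹(G, X) → H¹(H, X)` along `φ : H → G`. -/
def H1res {G H : Type u} [Group G] [TopologicalSpace G] [IsTopologicalGroup G]
    [Group H] [TopologicalSpace H] [IsTopologicalGroup H] (φ : H →ₜ* G) (X : TopRep.{u} ℤ G) :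
    H1 X →L[ℤ] H1 (TopRep.res (φ : H →* G) X) :=
  (ContinuousCohomology.map φ (𝟙 (TopRep.res (φ : H →* G) X)) 1).hom

/-! ### Unramified classes and the class group of a Galois module -/

section ClassGroup

variable {K : Type u} [Field K] [NumberField K]

/-- The inertia subgroup `I_v ≤ G_{K_v}`: the automorphisms that act trivially modulo the maximal
ideal of the integral closure of `𝓞_v` in `K̄_v`. That integral closure is a local ring, so its
maximal ideal is its Jacobson radical. -/
def inertia (v : HeightOneSpectrum (𝓞 K)) : Subgroup (AbsGal (v.adicCompletion K)) :=
  (Ideal.jacobson (⊥ : Ideal (integralClosure (v.adicCompletionIntegers K)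
    (AlgebraicClosure (v.adicCompletion K))))).inertia (AbsGal (v.adicCompletion K))

/-- The inclusion `I_v → G_{K_v}`. -/
def inertiaIncl (v : HeightOneSpectrum (𝓞 K)) :
    inertia v →ₜ* AbsGal (v.adicCompletion K) :=
  ⟨(inertia v).subtype, continuous_subtype_val⟩

/-- `A` is unramified at `v`: the inertia group `I_v` acts trivially on `A`. -/
def IsUnramifiedAt (A : TopRep.{u} ℤ (AbsGal K)) (v : HeightOneSpectrum (𝓞 K)) : Prop :=
  ∀ σ ∈ inertia v, ∀ a : A, A.ρ (galRes K (v.adicCompletion K) σ) a = a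

/-- `H¹_ur(K_v, A) = ker (H¹(K_v, A) → H¹(I_v, A))`. -/
def H1ur (v : HeightOneSpectrum (𝓞 K)) (A : TopRep.{u} ℤ (AbsGal (v.adicCompletion K))) :
    Submodule ℤ (H1 A) :=
  LinearMap.ker (H1res (inertiaIncl v) A).toLinearMap

/-- The class group `Cl(A) ≤ H¹(K, A)`: the classes whose restriction to `H¹(K_v, A)` is
unramified for every finite place `v` at which `A` is unramified. -/
def Cl (A : TopRep.{u} ℤ (AbsGal K)) : Submodule ℤ (H1 A) :=
  ⨅ (v : HeightOneSpectrum (𝓞 K)) (_ : IsUnramifiedAt A v),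
    (H1ur v (TopRep.res (galRes K (v.adicCompletion K) :
      AbsGal (v.adicCompletion K) →* AbsGal K) A)).comap
      (H1res (galRes K (v.adicCompletion K)) A).toLinearMap

end ClassGroup

/-! ### Galois modules and Selmer groups of elliptic curves -/

section Elliptic

open scoped Classical WeierstrassCurve

open WeierstrassCurve

variable {K : Type u} [Field K] (E : WeierstrassCurve K)

/-- The action of `G_L` on `E(L̄)` by its action on coordinates, for an extension `L / K`. -/
def pointsAction (L : Type u) [Field L] [Algebra K L] :
    AbsGal L →* AddMonoid.End (E⁄(AlgebraicClosure L)).toAffine.Point where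
  toFun σ := Affine.Point.map (W' := E) (σ : AlgebraicClosure L →ₐ[L] AlgebraicClosure L)
  map_one' := by
    ext P
    rcases P with _ | ⟨_, _, _⟩ <;> rfl
  map_mul' σ τ := by
    ext P
    rcases P with _ | ⟨_, _, _⟩ <;> rfl

/-- The `G_L`-module `E(L̄)`, for an extension `L / K`. -/
def pointsRep (L : Type u) [Field L] [Algebra K L] : TopRep.{u} ℤ (AbsGal L) :=
  discreteRep (pointsAction E L)

/-- The action of `G_K` on `E[m] = {P ∈ E(K̄) | m P = 0}`. -/
def torsionAction (m : ℕ) :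
    AbsGal K →* AddMonoid.End
      (Submodule.torsionBy ℤ (E⁄(AlgebraicClosure K)).toAffine.Point (m : ℤ)) where
  toFun σ := ((pointsAction E K σ).toIntLinearMap.restrict fun P hP => by
    rw [Submodule.mem_torsionBy_iff] at hP ⊢
    rw [← map_smul, hP, map_zero]).toAddMonoidHom
  map_one' := by
    ext P : 2
    exact congrArg (fun f => f P.1) (map_one (pointsAction E K))
  map_mul' σ τ := by
    ext P : 2
    exact congrArg (fun f => f P.1) (map_mul (pointsAction E K) σ τ)

/-- The finite Galois module `E[m]` over `K`. -/
def torsionRep (m : ℕ) : TopRep.{u} ℤ (AbsGal K) :=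
  discreteRep (torsionAction E m)

/-- The `G_L`-equivariant map `E[m] → E(L̄)` induced by `K̄ → L̄`. -/
def torsionToPoints (m : ℕ) (L : Type u) [Field L] [Algebra K L] :
    TopRep.res (galRes K L : AbsGal L →* AbsGal K) (torsionRep E m) ⟶ pointsRep E L :=
  discreteHom (galRes K L : AbsGal L →* AbsGal K)
    ((Affine.Point.map (W' := E) (closureEmb K L)).comp
      (Submodule.subtype (Submodule.torsionBy ℤ _ (m : ℤ))).toAddMonoidHom) <| by
    rintro σ ⟨P, hP⟩
    change Affine.Point.map (W' := E) (closureEmb K L)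
        (Affine.Point.map (W' := E) ((galResHom K L σ : AbsGal K) : _ →ₐ[K] _) P) =
      Affine.Point.map (W' := E) (σ : _ →ₐ[L] _) (Affine.Point.map (W' := E) (closureEmb K L) P)
    rcases P with _ | ⟨x, y, h⟩
    · rfl
    · simp only [Affine.Point.map_some, AlgEquiv.coe_toAlgHom,
        closureEmb_galResHom]

/-- The localization map `H¹(K, E[m]) → H¹(L, E[m]) → H¹(L, E)`, for an extension `L / K`. -/
def H1loc (m : ℕ) (L : Type u) [Field L] [Algebra K L] :
    H1 (torsionRep E m) →L[ℤ] H1 (pointsRep E L) :=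
  (ContinuousCohomology.map (galRes K L) (torsionToPoints E m L) 1).hom

variable [NumberField K]

/-- The `m`-Selmer group `Sel_m(E) = ker (H¹(K, E[m]) → ∏_v H¹(K_v, E))`, over all places `v`,
finite and infinite. -/
def Sel (m : ℕ) : Submodule ℤ (H1 (torsionRep E m)) :=
  (⨅ v : HeightOneSpectrum (𝓞 K), LinearMap.ker (H1loc E m (v.adicCompletion K)).toLinearMap) ⊓
    ⨅ w : InfinitePlace K, LinearMap.ker (H1loc E m w.Completion).toLinearMap

/-- The (finite) places of `K` dividing `m Δ(E)`, where `Δ(E)` is the minimal discriminant ideal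
of `E`: its `v`-part is generated by the discriminant of a minimal Weierstrass equation of `E`
over `K_v`. -/
def badPlaces (m : ℕ) : Set (HeightOneSpectrum (𝓞 K)) :=
  {v | (m : 𝓞 K) ∈ v.asIdeal ∨
    Valued.v ((E⁄(v.adicCompletion K)).minimal (v.adicCompletionIntegers K)).Δ < 1}

end Elliptic

end EllSel

end

noncomputable section

namespace EllSel

open scoped NNReal

/-! ### Continuous cohomology classes of degree one and cocycles -/

section Cocycles

open TopRep ContRepresentation Limits

/-! Call a finite place bad if it divides `m Δ(E)` and good otherwise; let `s` be the number of bad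
places. Let `G` be the group of classes in `H¹(K, E[m])` unramified at every good place
(`goodClasses`), and `T ≤ G` the subgroup of those that also vanish in `H¹(K_v, E[m])` at the bad
and the infinite places (`trivialClasses`). Both `Sel_m(E)` and `Cl(E[m])` lie between `T` and `G`.
Hence each is at most `#T` times the order of the product of the `H¹(K_v, E[m])` over bad and
infinite `v` (`card_le_card_mul`, `card_between_le`). If each factor has order at most `B = B(m,
n)`, the quotient of the two orders has logarithm at most `(s + n) log B` in absolute value, there
being at most `n` infinite places. Since `m > 1`, some prime divides `m`, so `s ≥ 1`
(`nonempty_badPlaces`) and `C = (1 + n) log B` works.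

Good places. Here the Selmer condition is equivalent to being unramified. Inertia moves a point by
an element of the kernel of reduction, which has no `m`-torsion, so a class coming from a point is
unramified. Conversely there are at most `#E[m]` unramified cocycles, because a cocycle is
determined by its value at a generator modulo inertia (`ncard_unramified_le`), while division of
points of `E(K_v)` by `m` produces at least `#E[m]` of them by an index computation
(`relIndex_ge_card_torsion`). The reduction theory is elementary: it rests on the formulas for the
`x`-coordinates of `P + Q` and `P - Q` and on polynomials for multiplication by `m` on
`x`-coordinates, with leading coefficients `1` and `m²`.

The local bound. On the subgroup fixing `E[m]` and the `m`-th roots of unity a cocycle is a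
homomorphism, and composed with characters of `E[m]` it becomes a family of Kummer characters
(`card_cocycles_le`). These are counted by `m`-th power classes of an extension of `K_v` of degree
bounded in terms of `m`; their number is bounded in terms of `m` and `n`, by a pigeonhole on
valuations and because units sufficiently close to `1` are `m`-th powers (`card_powerClasses_le`).

Finiteness of `T`. The same Kummer argument over `K` produces elements of a finite Galois extension
`L` whose valuations are all divisible by `m` (`finite_isLocallySmall`). They fall into finitely
many `m`-th power classes, by finiteness of the class group and finite generation of the unit group
of `L` (`exists_bound_powerClasses`). -/

lemma homologyπ_hom_surjective (C : CochainComplex (TopModuleCat.{u} ℤ) ℕ) (i : ℕ) :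
    Function.Surjective (C.homologyπ i).hom := by
  let e := (C.homologyIsCokernel _ i rfl).coconePointUniqueUpToIso
    (TopModuleCat.isColimitCoker (C.toCycles ((ComplexShape.up ℕ).prev i) i))
  have he : C.homologyπ i ≫ e.hom = TopModuleCat.cokerπ _ :=
    (C.homologyIsCokernel _ i rfl).comp_coconePointUniqueUpToIso_hom
      (TopModuleCat.isColimitCoker _) WalkingParallelPair.one
  intro z
  obtain ⟨x, hx⟩ := TopModuleCat.cokerπ_surjective _ (e.hom.hom z)
  refine ⟨x, ?_⟩
  have h1 : e.hom.hom ((C.homologyπ i).hom x) = e.hom.hom z :=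
    (congr(TopModuleCat.Hom.hom $he x)).trans hx
  have h2 := congrArg e.inv.hom h1
  have h3 : ∀ y, e.inv.hom (e.hom.hom y) = y := fun y =>
    congr(TopModuleCat.Hom.hom $(e.hom_inv_id) y)
  rwa [h3, h3] at h2

/-- The abstract homology is identified with the explicit cokernel, a quotient by the range of the
incoming map, where vanishing can be read off on elements. -/
lemma exists_toCycles_of_homologyπ_eq_zero (C : CochainComplex (TopModuleCat.{u} ℤ) ℕ) (i j : ℕ)
    (hi : (ComplexShape.up ℕ).prev j = i) (x : C.cycles j) (hx : (C.homologyπ j).hom x = 0) :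
    ∃ y, (C.toCycles i j).hom y = x := by
  let e := (C.homologyIsCokernel i j hi).coconePointUniqueUpToIso
    (TopModuleCat.isColimitCoker (C.toCycles i j))
  have he : C.homologyπ j ≫ e.hom = TopModuleCat.cokerπ _ :=
    (C.homologyIsCokernel i j hi).comp_coconePointUniqueUpToIso_hom
      (TopModuleCat.isColimitCoker _) WalkingParallelPair.one
  have h1 : (TopModuleCat.cokerπ (C.toCycles i j)).hom x = 0 := by
    rw [← he]
    change e.hom.hom ((C.homologyπ j).hom x) = 0
    rw [hx, map_zero]
  rw [TopModuleCat.hom_cokerπ] at h1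
  exact (Submodule.Quotient.mk_eq_zero _).mp h1

lemma iCycles_hom_injective (C : CochainComplex (TopModuleCat.{u} ℤ) ℕ) (i : ℕ) :
    Function.Injective (C.iCycles i).hom := by
  let e := (C.cyclesIsKernel i _ rfl).conePointUniqueUpToIso
    (TopModuleCat.isLimitKer (C.d i ((ComplexShape.up ℕ).next i)))
  have he : e.hom ≫ TopModuleCat.kerι _ = C.iCycles i :=
    (C.cyclesIsKernel i _ rfl).conePointUniqueUpToIso_hom_comp
      (TopModuleCat.isLimitKer _) WalkingParallelPair.zero
  intro x y hxy
  rw [← he] at hxy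
  have h2 : e.hom.hom x = e.hom.hom y := Subtype.ext hxy
  have h3 : ∀ y, e.inv.hom (e.hom.hom y) = y := fun y =>
    congr(TopModuleCat.Hom.hom $(e.hom_inv_id) y)
  rw [← h3 x, ← h3 y, h2]

lemma rho_mul_apply {G : Type u} [Group G] (X : TopRep.{u} ℤ G) (g k : G) (x : X) :
    X.ρ (g * k) x = X.ρ g (X.ρ k x) := by
  rw [_root_.map_mul]
  rfl

variable {G : Type u} [Group G] [TopologicalSpace G] [IsTopologicalGroup G] {X : TopRep.{u} ℤ G}

/-- The inhomogeneous cochain `g ↦ σ(1)(g)` of a homogeneous `1`-cocycle. -/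
def cocycleFun (σ : ContinuousCohomology.cocycles X 1) : C(G, X) :=
  (((homogeneousCochains X).iCycles 1).hom σ).1 (1 : G)

/-- The class `z` is represented by the inhomogeneous cocycle `c`. -/
def Represents (z : H1 X) (c : G → X) : Prop :=
  ∃ σ : ContinuousCohomology.cocycles X 1,
    (ContinuousCohomology.π X 1).hom σ = z ∧ ∀ g, cocycleFun σ g = c g

lemma exists_represents (z : H1 X) : ∃ c : G → X, Represents z c := by
  obtain ⟨σ, hσ⟩ := homologyπ_hom_surjective (homogeneousCochains X) 1 z
  exact ⟨_, σ, hσ, fun _ => rfl⟩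

lemma homogeneous_smul (σ : (homogeneousCochains X).X 1) (g a b : G) :
    σ.1 (g * a) (g * b) = X.ρ g (σ.1 a b) := by
  have := DFunLike.ext_iff.1 (DFunLike.ext_iff.1 (σ.2 g) (g * a)) (g * b)
  rw [← this]
  simp

lemma d_one_apply (σ : (homogeneousCochains X).X 1) (a b c : G) :
    (((homogeneousCochains X).d 1 2).hom σ).1 a b c = σ.1 b c - (σ.1 a c - σ.1 a b) := by
  rw [homogeneousCochains.d_apply]
  simp [d_succ, hom_sub, ContIntertwiningMap.sub_apply, d_zero]

lemma d_zero_apply (σ : (homogeneousCochains X).X 0) (a b : G) :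
    (((homogeneousCochains X).d 0 1).hom σ).1 a b = σ.1 b - σ.1 a := by
  rw [homogeneousCochains.d_apply]
  simp [d_succ, hom_sub, ContIntertwiningMap.sub_apply, d_zero]

lemma cocycle_relation (σ : ContinuousCohomology.cocycles X 1) (a b c : G) :
    (((homogeneousCochains X).iCycles 1).hom σ).1 a c =
      (((homogeneousCochains X).iCycles 1).hom σ).1 a b +
      (((homogeneousCochains X).iCycles 1).hom σ).1 b c := by
  have h : ((homogeneousCochains X).d 1 2).hom (((homogeneousCochains X).iCycles 1).hom σ) = 0 :=
    congr(TopModuleCat.Hom.hom $((homogeneousCochains X).iCycles_d 1 2) σ)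
  have h2 := d_one_apply (((homogeneousCochains X).iCycles 1).hom σ) a b c
  rw [h] at h2
  have h3 : (0 : X) = _ := h2
  rw [eq_comm, sub_sub_eq_add_sub, sub_eq_zero] at h3
  rw [← h3, add_comm]

namespace Represents

variable {z z' : H1 X} {c c' : G → X}

lemma continuous (h : Represents z c) : Continuous c := by
  obtain ⟨σ, -, h⟩ := h
  rw [show c = cocycleFun σ from funext fun g => (h g).symm]
  exact (cocycleFun σ).continuous

lemma map_mul (h : Represents z c) (g k : G) : c (g * k) = c g + X.ρ g (c k) := by
  obtain ⟨σ, -, h⟩ := h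
  rw [← h, ← h, ← h]
  change (((homogeneousCochains X).iCycles 1).hom σ).1 (1 : G) (g * k) = _
  rw [cocycle_relation σ 1 g (g * k)]
  congr 1
  have := homogeneous_smul (((homogeneousCochains X).iCycles 1).hom σ) g 1 k
  rwa [mul_one] at this

lemma sub (h : Represents z c) (h' : Represents z' c') :
    Represents (z - z') (fun g => c g - c' g) := by
  obtain ⟨σ, hσ, h⟩ := h
  obtain ⟨σ', hσ', h'⟩ := h'
  refine ⟨σ - σ', by rw [map_sub, hσ, hσ'], fun g => ?_⟩
  dsimp only
  rw [← h, ← h', cocycleFun, map_sub]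
  rfl

lemma exists_of_eq_zero (h : Represents (0 : H1 X) c) : ∃ x : X, ∀ g, c g = X.ρ g x - x := by
  obtain ⟨σ, hσ, h⟩ := h
  obtain ⟨y, rfl⟩ := exists_toCycles_of_homologyπ_eq_zero _ 0 1 (by simp) σ hσ
  refine ⟨y.1 (1 : G), fun g => ?_⟩
  have h1 : ((homogeneousCochains X).iCycles 1).hom (((homogeneousCochains X).toCycles 0 1).hom y)
      = ((homogeneousCochains X).d 0 1).hom y :=
    congr(TopModuleCat.Hom.hom $((homogeneousCochains X).toCycles_i 0 1) y)
  rw [← h, cocycleFun, h1, d_zero_apply]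
  congr 1
  have := DFunLike.ext_iff.1 (y.2 g) g
  rw [← this]
  simp

lemma eq_zero_of_coboundary (h : Represents z c) (x : X) (hx : ∀ g, c g = X.ρ g x - x) :
    z = 0 := by
  -- The orbit map of `x` equals `c + x`, so its continuity comes from that of the cocycle.
  have hcont : Continuous fun g : G => X.ρ g x := by
    have : (fun g : G => X.ρ g x) = fun g => c g + x := by ext g; rw [hx, sub_add_cancel]
    rw [this]
    exact h.continuous.add continuous_const
  obtain ⟨σ, hσ, h⟩ := h
  let f : C(G, X) := ⟨fun g => X.ρ g x, hcont⟩
  let y : (homogeneousCochains X).X 0 := ⟨f, by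
    intro g
    refine ContinuousMap.ext fun k => ?_
    change X.ρ g (X.ρ (g⁻¹ * k) x) = X.ρ k x
    rw [← rho_mul_apply, mul_inv_cancel_left]⟩
  have hy : ((homogeneousCochains X).toCycles 0 1).hom y = σ := by
    apply iCycles_hom_injective
    have h1 : ((homogeneousCochains X).iCycles 1).hom
        (((homogeneousCochains X).toCycles 0 1).hom y)
        = ((homogeneousCochains X).d 0 1).hom y :=
      congr(TopModuleCat.Hom.hom $((homogeneousCochains X).toCycles_i 0 1) y)
    rw [h1]
    refine Subtype.ext (ContinuousMap.ext fun a => ContinuousMap.ext fun b => ?_)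
    refine (d_zero_apply y a b).trans ?_
    -- Equivariance moves the pair `(a, b)` to `(1, a⁻¹ b)`, where the homogeneous cochain is given
    -- by `c`.
    have h2 := homogeneous_smul (((homogeneousCochains X).iCycles 1).hom σ) a 1 (a⁻¹ * b)
    rw [mul_one, mul_inv_cancel_left] at h2
    rw [h2]
    change X.ρ b x - X.ρ a x = X.ρ a (cocycleFun σ (a⁻¹ * b))
    rw [h, hx, map_sub, ← rho_mul_apply, mul_inv_cancel_left]
  rw [← hσ, ← hy]
  exact congr(TopModuleCat.Hom.hom $((homogeneousCochains X).toCycles_comp_homologyπ 0 1) y)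

lemma eq_zero_iff (h : Represents z c) : z = 0 ↔ ∃ x : X, ∀ g, c g = X.ρ g x - x :=
  ⟨fun hz => (hz ▸ h).exists_of_eq_zero, fun ⟨x, hx⟩ => h.eq_zero_of_coboundary x hx⟩

lemma eq (h : Represents z c) (h' : Represents z' c) : z = z' :=
  sub_eq_zero.mp <| (h.sub h').eq_zero_of_coboundary 0 fun g => by simp

lemma map {H : Type u} [Group H] [TopologicalSpace H] [IsTopologicalGroup H] {Y : TopRep.{u} ℤ H}
    (h : Represents z c) (φ : H →ₜ* G) (f : TopRep.res (φ : H →* G) X ⟶ Y) :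
    Represents ((ContinuousCohomology.map φ f 1).hom z) (fun k => f.hom (c (φ k))) := by
  obtain ⟨σ, rfl, h⟩ := h
  refine ⟨(ContinuousCohomology.cocyclesMap φ f 1).hom σ,
    congr(TopModuleCat.Hom.hom $(ContinuousCohomology.π_map φ f 1) σ).symm, fun k => ?_⟩
  have h1 : ((homogeneousCochains Y).iCycles 1).hom
      ((ContinuousCohomology.cocyclesMap φ f 1).hom σ) =
      ((ContinuousCohomology.cochainsMap φ f).f 1).hom
        (((homogeneousCochains X).iCycles 1).hom σ) :=
    congr(TopModuleCat.Hom.hom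
      $(HomologicalComplex.cyclesMap_i (ContinuousCohomology.cochainsMap φ f) 1) σ)
  dsimp only
  rw [← h, cocycleFun, h1]
  change f.hom ((((homogeneousCochains X).iCycles 1).hom σ).1 (φ 1) (φ k)) = _
  rw [_root_.map_one]
  rfl

lemma res {H : Type u} [Group H] [TopologicalSpace H] [IsTopologicalGroup H]
    (h : Represents z c) (φ : H →ₜ* G) :
    Represents (H1res φ X z) (fun k => c (φ k)) :=
  h.map φ (𝟙 _)

end Represents
end Cocycles

/-! ### The `x`-coordinates of the sum and the difference of two points -/

section AddSub

open WeierstrassCurve WeierstrassCurve.Affine MvPolynomial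

variable {F : Type*} [Field F] [DecidableEq F] {W : WeierstrassCurve F}

omit [DecidableEq F] in
lemma eval_addSubMap (s t u : F) : (fun i => (addSubMap W i).eval ![s, t, u]) =
    ![s ^ 2 - W.b₄ * s * u - W.b₆ * t * u - W.b₈ * u ^ 2,
      2 * t * s + W.b₂ * s * u + W.b₄ * t * u + W.b₆ * u ^ 2, t ^ 2 - 4 * s * u] := by
  ext i
  fin_cases i <;> simp [addSubMap]

omit [DecidableEq F] in
lemma equation_sq {x y : F} (h : W.toAffine.Equation x y) :
    (y - W.toAffine.negY x y) ^ 2 = 4 * x ^ 3 + W.b₂ * x ^ 2 + 2 * W.b₄ * x + W.b₆ := by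
  rw [Affine.equation_iff] at h
  simp only [negY, WeierstrassCurve.b₂, WeierstrassCurve.b₄, WeierstrassCurve.b₆]
  linear_combination 4 * h

omit [DecidableEq F] in
-- The left side is the square of the numerator of the tangent slope. Modulo `y - negY` the right
-- side is the numerator of `x(2P)`, which therefore does not vanish at a nonsingular point of order
-- two.
lemma polynomialX_sq {x y : F} (h : W.toAffine.Equation x y) :
    (3 * x ^ 2 + 2 * W.a₂ * x + W.a₄ - W.a₁ * y) ^ 2 =
      x ^ 4 - W.b₄ * x ^ 2 - 2 * W.b₆ * x - W.b₈ + (2 * x + W.a₂ ) * (y - W.toAffine.negY x y) ^ 2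
      - W.a₁ * (3 * x ^ 2 + 2 * W.a₂ * x + W.a₄ - W.a₁ * y) * (y - W.toAffine.negY x y) := by
  rw [Affine.equation_iff] at h
  simp only [negY, WeierstrassCurve.b₄, WeierstrassCurve.b₆, WeierstrassCurve.b₈]
  linear_combination (-W.a₁ ^ 2 - 4 * W.a₂ - 8 * x) * h

/-- At an affine point the scalar is the square of a nonvanishing partial derivative: the one in `X`
if `P` has order two, the one in `Y` otherwise. -/
lemma addSubMap_sym2x_self (P : W.toAffine.Point) :
    ∃ c : F, c ≠ 0 ∧
      (fun i => (addSubMap W i).eval (P.sym2x P)) = c • (P + P).sym2x (P - P) := by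
  rw [sub_self]
  rcases P with _ | ⟨x, y, h⟩
  · refine ⟨1, one_ne_zero, ?_⟩
    rw [← Point.zero_def, add_zero, Point.sym2x_zero_zero, eval_addSubMap]
    simp
  rw [Point.sym2x_some_some, eval_addSubMap]
  have h1 := equation_sq h.1
  have h2 := polynomialX_sq h.1
  by_cases hy : y = W.toAffine.negY x y
  · rw [Point.add_self_of_Y_eq hy, Point.sym2x_zero_zero]
    rw [← sub_eq_zero] at hy
    rw [hy] at h1 h2
    have hne : 3 * x ^ 2 + 2 * W.a₂ * x + W.a₄ - W.a₁ * y ≠ 0 := by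
      have := (Affine.nonsingular_iff _ _).mp h
      rcases this.2 with h' | h'
      · contrapose! h'
        linear_combination -h'
      · exact absurd (sub_eq_zero.mp hy) h'
    refine ⟨_, pow_ne_zero 2 hne, ?_⟩
    rw [h2]
    ext i
    fin_cases i <;> simp
    · ring
    · linear_combination -h1
    · ring
  · rw [Point.add_self_of_Y_ne hy, Point.sym2x_some_zero, slope_of_Y_ne rfl hy]
    refine ⟨_, pow_ne_zero 2 (sub_ne_zero.mpr hy), ?_⟩
    have hne := sub_ne_zero.mpr hy
    set d := y - W.toAffine.negY x y
    ext i
    fin_cases i <;> simp only [Fin.zero_eta, Fin.mk_one, Fin.reduceFinMk, Matrix.cons_val,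
      Matrix.cons_val_zero, Matrix.cons_val_one, Pi.smul_apply, smul_eq_mul, addX]
    · field_simp
      linear_combination -h2
    · linear_combination -h1
    · ring

/-- On points, `addSubMap` describes the passage from `{P, Q}` to `{P + Q, P - Q}`. -/
lemma addSubMap_sym2x (P Q : W.toAffine.Point) :
    ∃ c : F, c ≠ 0 ∧
      (fun i => (addSubMap W i).eval (P.sym2x Q)) = c • (P + Q).sym2x (P - Q) := by
  by_cases hPQ : P = Q
  · subst hPQ
    exact addSubMap_sym2x_self P
  by_cases hPQ' : P = -Q
  · subst hPQ'
    obtain ⟨c, hc, h⟩ := addSubMap_sym2x_self Q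
    refine ⟨c, hc, ?_⟩
    rw [Point.sym2x_neg_left, h, neg_add_cancel, sub_self, ← Point.sym2x_neg_left, Point.sym2x_comm]
    congr 2
    abel
  rcases P with _ | ⟨x₁, y₁, h₁⟩
  · refine ⟨1, one_ne_zero, ?_⟩
    rw [← Point.zero_def, zero_add, zero_sub, Point.sym2x_neg_right]
    rcases Q with _ | ⟨x₂, y₂, h₂⟩
    · rw [← Point.zero_def, Point.sym2x_zero_zero, eval_addSubMap]
      simp
    · rw [Point.sym2x_zero_some, Point.sym2x_some_some, eval_addSubMap]
      simp [pow_two, two_mul]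
  rcases Q with _ | ⟨x₂, y₂, h₂⟩
  · refine ⟨1, one_ne_zero, ?_⟩
    rw [← Point.zero_def, add_zero, sub_zero, Point.sym2x_some_zero, Point.sym2x_some_some,
      eval_addSubMap]
    simp [pow_two, two_mul]
  have hx : x₁ ≠ x₂ := by
    intro hx
    rcases Point.X_eq_iff.mp hx with h | h
    exacts [hPQ h, hPQ' h]
  have hx' := sub_ne_zero.mpr hx
  rw [sub_eq_add_neg, Point.neg_some, Point.add_of_X_ne hx, Point.add_of_X_ne hx,
    Point.sym2x_some_some, Point.sym2x_some_some, eval_addSubMap, slope_of_X_ne hx,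
    slope_of_X_ne hx]
  refine ⟨(x₁ - x₂) ^ 2, pow_ne_zero 2 hx', ?_⟩
  have e₁ := (Affine.equation_iff _ _).mp h₁.1
  have e₂ := (Affine.equation_iff _ _).mp h₂.1
  ext i
  fin_cases i <;> simp only [Fin.zero_eta, Fin.mk_one, Fin.reduceFinMk, Matrix.cons_val,
      Matrix.cons_val_zero, Matrix.cons_val_one, Pi.smul_apply, smul_eq_mul, addX, negY]
  -- The slopes `l` and `m` belong to `P + Q` and `P - Q`. The product of the two `x`-coordinates is
  -- symmetric in them, and `l m` and `l + m` become polynomials after multiplication by `x₁ - x₂`.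
  · set l := (y₁ - y₂) / (x₁ - x₂) with hl
    set m := (y₁ - (-y₂ - W.a₁ * x₂ - W.a₃)) / (x₁ - x₂) with hm
    have hlm : l * m * (x₁ - x₂) = x₁ ^ 2 + x₁ * x₂ + x₂ ^ 2 + W.a₂ * (x₁ + x₂) + W.a₄
        - W.a₁ * y₁ := by
      rw [hl, hm]
      field_simp
      linear_combination e₁ - e₂
    have hs : (l + m) * (x₁ - x₂) = 2 * y₁ + W.a₁ * x₂ + W.a₃ := by
      rw [hl, hm]
      field_simp
      ring
    have key : (x₁ - x₂) ^ 2 * ((l ^ 2 + W.a₁ * l - W.a₂ - x₁ - x₂) *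
        (m ^ 2 + W.a₁ * m - W.a₂ - x₁ - x₂)) = (l * m * (x₁ - x₂)) ^ 2
        + W.a₁ * (l * m * (x₁ - x₂)) * ((l + m) * (x₁ - x₂))
        - (W.a₂ + x₁ + x₂) * (((l + m) * (x₁ - x₂)) ^ 2 - 2 * (l * m * (x₁ - x₂)) * (x₁ - x₂))
        + W.a₁ ^ 2 * (l * m * (x₁ - x₂)) * (x₁ - x₂)
        - W.a₁ * (W.a₂ + x₁ + x₂) * ((l + m) * (x₁ - x₂)) * (x₁ - x₂)
        + (W.a₂ + x₁ + x₂) ^ 2 * (x₁ - x₂) ^ 2 := by ring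
    rw [key, hlm, hs]
    simp only [WeierstrassCurve.b₄, WeierstrassCurve.b₆, WeierstrassCurve.b₈]
    linear_combination (W.a₁ ^ 2 + 4 * (W.a₂ + x₁ + x₂)) * e₁
  · field_simp
    simp only [WeierstrassCurve.b₂, WeierstrassCurve.b₄, WeierstrassCurve.b₆]
    linear_combination -2 * e₁ - 2 * e₂
  · ring

end AddSub

/-! ### Multiplication by `m` on `x`-coordinates -/

section MulPoly

open WeierstrassCurve WeierstrassCurve.Affine Polynomial

section Ring

variable {R S : Type*} [CommRing R] [CommRing S]

/-- The duplication formula on projective `x`-coordinates. -/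
def xDouble (W : WeierstrassCurve R) (p : R[X] × R[X]) : R[X] × R[X] :=
  (p.1 ^ 4 - C W.b₄ * (p.1 ^ 2 * p.2 ^ 2) - C (2 * W.b₆) * (p.1 * p.2 ^ 3) - C W.b₈ * p.2 ^ 4,
    C 4 * (p.1 ^ 3 * p.2) + C W.b₂ * (p.1 ^ 2 * p.2 ^ 2) + C (2 * W.b₄) * (p.1 * p.2 ^ 3) +
      C W.b₆ * p.2 ^ 4)

/-- The square of the cross product of two projective `x`-coordinates. -/
def xCross (p q : R[X] × R[X]) : R[X] :=
  (p.1 * q.2 + q.1 * p.2) ^ 2 - C 4 * (p.1 * q.1 * (p.2 * q.2))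

/-- The projective `x`-coordinate of `P + Q` in terms of those of `P` and `Q`, if `P - Q` has
`x`-coordinate `X`. -/
def xDiffAdd (W : WeierstrassCurve R) (p q : R[X] × R[X]) : R[X] × R[X] :=
  (C 2 * ((p.1 * q.2 + q.1 * p.2) * (p.1 * q.1)) + C W.b₂ * (p.1 * q.1 * (p.2 * q.2)) +
    C W.b₄ * ((p.1 * q.2 + q.1 * p.2) * (p.2 * q.2)) + C W.b₆ * (p.2 * q.2) ^ 2 -
      X * xCross p q, xCross p q)

/-- Polynomials `(A, B)` such that `(A(x) : B(x))` is the `x`-coordinate of `m P` if `x` is that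
of `P`. -/
def mulPoly (W : WeierstrassCurve R) (m : ℕ) : R[X] × R[X] :=
  if m = 0 then (1, 0)
  else if m = 1 then (X, 1)
  else if m % 2 = 0 then xDouble W (mulPoly W (m / 2))
  else xDiffAdd W (mulPoly W (m / 2 + 1)) (mulPoly W (m / 2))
termination_by m

variable (W : WeierstrassCurve R)

lemma mulPoly_zero : mulPoly W 0 = (1, 0) := by rw [mulPoly]; simp

lemma mulPoly_one : mulPoly W 1 = (X, 1) := by rw [mulPoly]; simp

lemma mulPoly_two_mul {m : ℕ} (hm : m ≠ 0) : mulPoly W (2 * m) = xDouble W (mulPoly W m) := by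
  rw [mulPoly, if_neg (by omega), if_neg (by omega), if_pos (by omega)]
  congr 2
  omega

lemma mulPoly_two_mul_add_one {m : ℕ} (hm : m ≠ 0) :
    mulPoly W (2 * m + 1) = xDiffAdd W (mulPoly W (m + 1)) (mulPoly W m) := by
  rw [mulPoly, if_neg (by omega), if_neg (by omega), if_neg (by omega)]
  congr 2 <;> congr 1 <;> omega

/-- Induction along the recursive definition of `mulPoly`. -/
lemma mulPoly_induction {P : ℕ → Prop} (h0 : P 0) (h1 : P 1)
    (heven : ∀ m, m ≠ 0 → P m → P (2 * m))
    (hodd : ∀ m, m ≠ 0 → P (m + 1) → P m → P (2 * m + 1)) (m : ℕ) : P m := by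
  induction m using Nat.strong_induction_on with
  | _ m ih =>
    rcases Nat.lt_or_ge m 2 with h | h
    · interval_cases m <;> assumption
    · rcases Nat.even_or_odd' m with ⟨k, rfl | rfl⟩
      · exact heven k (by omega) (ih k (by omega))
      · exact hodd k (by omega) (ih _ (by omega)) (ih _ (by omega))

lemma mulPoly_map (f : R →+* S) (m : ℕ) :
    mulPoly (W.map f) m = ((mulPoly W m).1.map f, (mulPoly W m).2.map f) := by
  induction m using mulPoly_induction with
  | h0 => simp [mulPoly_zero]
  | h1 => simp [mulPoly_one]
  | heven m hm ih =>
    rw [mulPoly_two_mul _ hm, mulPoly_two_mul _ hm, ih]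
    simp [xDouble, map_ofNat f]
  | hodd m hm ih ih' =>
    rw [mulPoly_two_mul_add_one _ hm, mulPoly_two_mul_add_one _ hm, ih, ih']
    simp [xDiffAdd, xCross, map_ofNat f]

/-- `p` has degree at most `d`, and its coefficient there is `c`. -/
def HasLead (p : R[X]) (d : ℕ) (c : R) : Prop := p.natDegree ≤ d ∧ p.coeff d = c

namespace HasLead

variable {p q : R[X]} {d e : ℕ} {a b : R}

lemma mul (hp : HasLead p d a) (hq : HasLead q e b) : HasLead (p * q) (d + e) (a * b) :=
  ⟨natDegree_mul_le.trans (add_le_add hp.1 hq.1), by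
    rw [coeff_mul_add_eq_of_natDegree_le hp.1 hq.1, hp.2, hq.2]⟩

lemma pow (hp : HasLead p d a) (n : ℕ) : HasLead (p ^ n) (n * d) (a ^ n) := by
  induction n with
  | zero => simp [HasLead]
  | succ n ih =>
    rw [pow_succ, pow_succ, add_mul, one_mul]
    exact ih.mul hp

lemma add (hp : HasLead p d a) (hq : HasLead q d b) : HasLead (p + q) d (a + b) :=
  ⟨natDegree_add_le_of_degree_le hp.1 hq.1, by rw [coeff_add, hp.2, hq.2]⟩

lemma sub (hp : HasLead p d a) (hq : HasLead q d b) : HasLead (p - q) d (a - b) :=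
  ⟨(natDegree_sub_le_of_le hp.1 hq.1).trans (max_self d).le, by rw [coeff_sub, hp.2, hq.2]⟩

lemma C_mul (r : R) (hp : HasLead p d a) : HasLead (C r * p) d (r * a) :=
  ⟨(natDegree_C_mul_le _ _).trans hp.1, by rw [coeff_C_mul, hp.2]⟩

/-- The prescribed coefficient may be `0`, so terms of smaller degree can enter a sum in degree `e`.
-/
lemma lower (hp : HasLead p d a) (h : d < e) : HasLead p e 0 :=
  ⟨hp.1.trans h.le, coeff_eq_zero_of_natDegree_lt (hp.1.trans_lt h)⟩

lemma cast (hp : HasLead p d a) (h : d = e) (h' : a = b) : HasLead p e b := h ▸ h' ▸ hp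

end HasLead

/-- The variable `l` is `m² - 1` without truncated subtraction. In the even case the second leading
coefficient is `4 m²`. In the odd case it is `(m² + (m + 1)²)² - 4 m² (m + 1)² = (2m + 1)²`, and the
first one is `2 (m² + (m + 1)²) - (2m + 1)² = 1`. -/
lemma hasLead_mulPoly (m : ℕ) : ∀ l, m ^ 2 = l + 1 →
    HasLead (mulPoly W m).1 (l + 1) 1 ∧ HasLead (mulPoly W m).2 l ((m : R) ^ 2) := by
  induction m using mulPoly_induction with
  | h0 => intro l hl; simp at hl
  | h1 =>
    rintro (_ | l) hl
    · rw [mulPoly_one]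
      exact ⟨⟨natDegree_X_le, by simp⟩, ⟨by simp, by simp⟩⟩
    · omega
  | heven m hm ih =>
    intro n hn
    obtain ⟨l, hl⟩ : ∃ l, m ^ 2 = l + 1 := Nat.exists_eq_add_of_lt (by positivity : 0 < m ^ 2)
      |>.imp fun _ h => by omega
    obtain ⟨ha, hb⟩ := ih l hl
    have hn' : n = 4 * l + 3 := by rw [mul_pow, hl] at hn; omega
    subst hn'
    rw [mulPoly_two_mul _ hm]
    refine ⟨?_, ?_⟩
    · refine (((((ha.pow 4).cast (by ring) rfl).sub ((((ha.pow 2).mul (hb.pow 2)).C_mul _).lower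
        (by omega))).sub ((((ha.mul (hb.pow 3)).C_mul _).lower (by omega)))).sub
        (((hb.pow 4).C_mul _).lower (by omega))).cast rfl (by simp)
    · refine (((((((ha.pow 3).mul hb).C_mul _).cast (by ring) rfl).add
        ((((ha.pow 2).mul (hb.pow 2)).C_mul _).lower
        (by omega))).add ((((ha.mul (hb.pow 3)).C_mul _).lower (by omega)))).add
        (((hb.pow 4).C_mul _).lower (by omega))).cast rfl (by push_cast; ring)
  | hodd m hm ih' ih =>
    intro n hn
    obtain ⟨l, hl⟩ : ∃ l, m ^ 2 = l + 1 := Nat.exists_eq_add_of_lt (by positivity : 0 < m ^ 2)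
      |>.imp fun _ h => by omega
    obtain ⟨l', hl'⟩ : ∃ l, (m + 1) ^ 2 = l + 1 :=
      Nat.exists_eq_add_of_lt (by positivity : 0 < (m + 1) ^ 2) |>.imp fun _ h => by omega
    obtain ⟨ha, hb⟩ := ih l hl
    obtain ⟨ha', hb'⟩ := ih' l' hl'
    have hn' : n = 2 * l + 2 * l' + 2 := by
      have : (2 * m + 1) ^ 2 + 1 = 2 * m ^ 2 + 2 * (m + 1) ^ 2 := by ring
      rw [hl, hl'] at this
      omega
    subst hn'
    rw [mulPoly_two_mul_add_one _ hm]
    have hs := ha'.mul ha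
    have ht := ((ha'.mul hb).cast (by ring : _ = l + l' + 1) rfl).add
      ((ha.mul hb').cast (by ring) rfl)
    have hu := hb'.mul hb
    have hD : HasLead (xCross (mulPoly W (m + 1)) (mulPoly W m)) (2 * l + 2 * l' + 2)
        (((2 * m + 1 : ℕ) : R) ^ 2) :=
      (((ht.pow 2).cast (by ring) rfl).sub (((hs.mul hu).C_mul 4).cast (by ring) rfl)).cast rfl
        (by push_cast; ring)
    refine ⟨?_, hD⟩
    have hX : HasLead (X : R[X]) 1 1 := ⟨natDegree_X_le, by simp⟩
    exact ((((((ht.mul hs).C_mul 2).cast (by ring : _ = 2 * l + 2 * l' + 3) rfl).add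
      (((hs.mul hu).C_mul _).lower (by omega))).add (((ht.mul hu).C_mul _).lower (by omega))).add
      (((hu.pow 2).C_mul _).lower (by omega))).sub ((hX.mul hD).cast (by ring) rfl)
      |>.cast rfl (by push_cast; ring)

lemma hasLead_mulPoly_fst {m : ℕ} (hm : m ≠ 0) : HasLead (mulPoly W m).1 (m ^ 2) 1 := by
  obtain ⟨l, hl⟩ := Nat.exists_eq_succ_of_ne_zero (pow_ne_zero 2 hm)
  rw [hl]
  exact (hasLead_mulPoly W m l hl).1

lemma hasLead_mulPoly_snd {m : ℕ} (hm : m ≠ 0) :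
    HasLead (mulPoly W m).2 (m ^ 2 - 1) ((m : R) ^ 2) := by
  obtain ⟨l, hl⟩ := Nat.exists_eq_succ_of_ne_zero (pow_ne_zero 2 hm)
  rw [hl]
  exact (hasLead_mulPoly W m l hl).2

end Ring

section Field

variable {F : Type*} [Field F] [DecidableEq F] {W : WeierstrassCurve F}

/-- That the scalar is nonzero says that the two polynomials have no common zero at the
`x`-coordinate of a point, which is all the coprimality that is needed. -/
lemma eval_mulPoly {x y : F} (h : W.toAffine.Nonsingular x y) (m : ℕ) :
    ∃ c : F, c ≠ 0 ∧ ![(mulPoly W m).1.eval x, (mulPoly W m).2.eval x] =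
      c • (m • Point.some x y h).xRep := by
  induction m using mulPoly_induction with
  | h0 => exact ⟨1, one_ne_zero, by simp [mulPoly_zero]⟩
  | h1 => exact ⟨1, one_ne_zero, by simp [mulPoly_one]⟩
  | heven m hm ih =>
    obtain ⟨c, hc, h1⟩ := ih
    obtain ⟨d, hd, h2⟩ := addSubMap_sym2x_self (m • Point.some x y h)
    -- Duplication is homogeneous of degree four in the projective `x`-coordinate.
    refine ⟨c ^ 4 * d, by positivity, ?_⟩
    have e0 := congrFun h1 0
    have e1 := congrFun h1 1
    simp only [Matrix.cons_val_zero, Matrix.cons_val_one, Pi.smul_apply, smul_eq_mul] at e0 e1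
    rw [sub_self, Point.sym2x, eval_addSubMap] at h2
    have f0 := congrFun h2 0
    have f1 := congrFun h2 1
    simp only [Point.sym2x, Point.xRep_zero, Matrix.cons_val_zero, Matrix.cons_val_one,
      Pi.smul_apply, smul_eq_mul, mul_one, mul_zero, zero_add] at f0 f1
    rw [mulPoly_two_mul _ hm, two_mul, add_smul]
    ext i
    fin_cases i <;> simp only [Fin.zero_eta, Fin.mk_one, Matrix.cons_val_zero,
      Matrix.cons_val_one, Pi.smul_apply, smul_eq_mul, xDouble, eval_sub, eval_add, eval_mul,
      eval_pow, eval_C, e0, e1]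
    · linear_combination c ^ 4 * f0
    · linear_combination c ^ 4 * f1
  | hodd m hm ih' ih =>
    obtain ⟨c, hc, h1⟩ := ih
    obtain ⟨c', hc', h1'⟩ := ih'
    obtain ⟨d, hd, h2⟩ := addSubMap_sym2x ((m + 1) • Point.some x y h) (m • Point.some x y h)
    refine ⟨c ^ 2 * c' ^ 2 * d, by positivity, ?_⟩
    have e0 := congrFun h1 0
    have e1 := congrFun h1 1
    have e0' := congrFun h1' 0
    have e1' := congrFun h1' 1
    simp only [Matrix.cons_val_zero, Matrix.cons_val_one, Pi.smul_apply, smul_eq_mul]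
      at e0 e1 e0' e1'
    -- The difference of the two points is the base point, with `x`-coordinate `(x : 1)`, so the
    -- last two coordinates of `sym2x` already determine the `x`-coordinate of the sum.
    rw [show (m + 1) • Point.some x y h - m • Point.some x y h = Point.some x y h by
      rw [add_smul, one_smul]; abel, Point.sym2x, eval_addSubMap] at h2
    have f1 := congrFun h2 1
    have f2 := congrFun h2 2
    simp only [Point.sym2x, Point.xRep_some, Matrix.cons_val_zero, Matrix.cons_val_one,
      Matrix.cons_val, Pi.smul_apply, smul_eq_mul, mul_one] at f1 f2
    rw [mulPoly_two_mul_add_one _ hm, show 2 * m + 1 = (m + 1) + m by ring, add_smul]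
    ext i
    fin_cases i <;> simp only [Fin.zero_eta, Fin.mk_one, Matrix.cons_val_zero,
      Matrix.cons_val_one, Pi.smul_apply, smul_eq_mul, xDiffAdd, xCross, eval_sub, eval_add,
      eval_mul, eval_pow, eval_C, eval_X, e0, e1, e0', e1']
    · linear_combination c ^ 2 * c' ^ 2 * (f1 - x * f2)
    · linear_combination c ^ 2 * c' ^ 2 * f2

end Field
end MulPoly

/-! ### Divisibility and torsion -/

section Torsion

open WeierstrassCurve WeierstrassCurve.Affine Polynomial

variable {F : Type*} [Field F] [DecidableEq F] {W : WeierstrassCurve F}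

lemma smul_some_eq_zero_iff {x y : F} (h : W.toAffine.Nonsingular x y) (m : ℕ) :
    m • Point.some x y h = 0 ↔ (mulPoly W m).2.eval x = 0 := by
  obtain ⟨c, hc, e⟩ := eval_mulPoly h m
  have e1 := congrFun e 1
  simp only [Matrix.cons_val_one, Pi.smul_apply, smul_eq_mul] at e1
  rw [show (mulPoly W m).2.eval x = _ from e1]
  rcases m • Point.some x y h with _ | ⟨x', y', h'⟩
  · simp [← Point.zero_def]
  · simp [hc]

omit [DecidableEq F] in
lemma mulPoly_snd_ne_zero {m : ℕ} (hm : (m : F) ≠ 0) : (mulPoly W m).2 ≠ 0 := by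
  intro h
  have h0 : m ≠ 0 := by rintro rfl; simp at hm
  have := (hasLead_mulPoly_snd W h0).2
  rw [h, coeff_zero] at this
  exact pow_ne_zero 2 hm this.symm

/-- If `P` has `x`-coordinate `x₀` and multiplication by `m` is `A / B` on `x`-coordinates, then `A
- x₀ B` is monic of degree `m² > 0` and has a root `x`. A point above `x` is mapped to `P` or `-P`.
-/
lemma exists_smul_eq [IsAlgClosed F] [W.IsElliptic] {m : ℕ} (hm : m ≠ 0) (P : W.toAffine.Point) :
    ∃ Q : W.toAffine.Point, m • Q = P := by
  rcases P with _ | ⟨x₀, y₀, h₀⟩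
  · exact ⟨0, smul_zero _⟩
  have hm2 : m ^ 2 - 1 < m ^ 2 := Nat.sub_lt (by positivity) one_pos
  have hlead : HasLead ((mulPoly W m).1 - C x₀ * (mulPoly W m).2) (m ^ 2) 1 :=
    ((hasLead_mulPoly_fst W hm).sub (((hasLead_mulPoly_snd W hm).C_mul x₀).lower hm2)).cast rfl
      (sub_zero _)
  obtain ⟨x, hx⟩ := IsAlgClosed.exists_root ((mulPoly W m).1 - C x₀ * (mulPoly W m).2) (by
    intro hdeg
    have h1 := le_degree_of_ne_zero (n := m ^ 2) (by rw [hlead.2]; exact one_ne_zero)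
    rw [hdeg] at h1
    have : m ^ 2 ≤ 0 := by exact_mod_cast h1
    simp [hm] at this)
  rw [IsRoot.def, eval_sub, eval_mul, eval_C, sub_eq_zero] at hx
  obtain ⟨y, hy⟩ := IsAlgClosed.exists_root (X ^ 2 + C (W.a₁ * x + W.a₃) * X -
    C (x ^ 3 + W.a₂ * x ^ 2 + W.a₄ * x + W.a₆)) (by
      rw [show (X ^ 2 + C (W.a₁ * x + W.a₃) * X -
        C (x ^ 3 + W.a₂ * x ^ 2 + W.a₄ * x + W.a₆) : F[X]).degree = 2 by compute_degree!]
      norm_num)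
  have h : W.toAffine.Nonsingular x y := by
    rw [← Affine.equation_iff_nonsingular, Affine.equation_iff]
    simp only [IsRoot.def, eval_sub, eval_add, eval_pow, eval_X, eval_mul, eval_C] at hy
    linear_combination hy
  obtain ⟨c, hc, e⟩ := eval_mulPoly h m
  have e0 := congrFun e 0
  have e1 := congrFun e 1
  simp only [Matrix.cons_val_zero, Matrix.cons_val_one, Pi.smul_apply, smul_eq_mul] at e0 e1
  rw [e0, e1] at hx
  have key : (m • Point.some x y h).xRep = (Point.some x₀ y₀ h₀).xRep := by
    rcases hQ : m • Point.some x y h with _ | ⟨x', y', h'⟩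
    · rw [hQ, ← Point.zero_def] at hx
      simp [hc] at hx
    · rw [hQ] at hx
      simp only [Point.xRep_some, Matrix.cons_val_zero, Matrix.cons_val_one, mul_one] at hx ⊢
      rw [mul_left_cancel₀ hc (hx.trans (mul_comm _ _))]
  rcases Point.eq_or_eq_neg_of_xRep_eq_xRep key with h1 | h1
  · exact ⟨_, h1⟩
  · exact ⟨-Point.some x y h, by rw [smul_neg, h1, neg_neg]⟩

/-- The points whose `x`-coordinate is infinite or lies in a finite set form a finite set. -/
lemma finite_points_of_x_mem (S : Finset F) :
    ({P : W.toAffine.Point | ∀ x y h, P = Point.some x y h → x ∈ S}).Finite ∧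
    ({P : W.toAffine.Point | ∀ x y h, P = Point.some x y h → x ∈ S}).ncard ≤ 2 * S.card + 1 := by
  classical
  let f : F → W.toAffine.Point := fun x =>
    if h : ∃ y, W.toAffine.Nonsingular x y then Point.some x h.choose h.choose_spec else 0
  have hsub : {P : W.toAffine.Point | ∀ x y h, P = Point.some x y h → x ∈ S} ⊆
      ((S.image f ∪ S.image (fun x => -f x) ∪ {0} : Finset W.toAffine.Point) : Set _) := by
    intro P hP
    rcases P with _ | ⟨x, y, h⟩
    · simp [← Point.zero_def]
    · have hx : x ∈ S := hP x y h rfl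
      have hex : ∃ y, W.toAffine.Nonsingular x y := ⟨y, h⟩
      have hf : f x = Point.some x hex.choose hex.choose_spec := dif_pos hex
      have := (Point.X_eq_iff (h₁ := h) (h₂ := hex.choose_spec)).mp rfl
      rw [← hf] at this
      simp only [Finset.coe_union, Finset.coe_image, Set.mem_union, Set.mem_image]
      rcases this with h' | h'
      · exact Or.inl (Or.inl ⟨x, hx, h'.symm⟩)
      · exact Or.inl (Or.inr ⟨x, hx, h'.symm⟩)
  refine ⟨(Finset.finite_toSet _).subset hsub, ?_⟩
  refine (Set.ncard_le_ncard hsub (Finset.finite_toSet _)).trans ?_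
  rw [Set.ncard_coe_finset]
  refine (Finset.card_union_le _ _).trans (add_le_add ((Finset.card_union_le _ _).trans ?_) ?_)
  · have := Finset.card_image_le (s := S) (f := f)
    have := Finset.card_image_le (s := S) (f := fun x => -f x)
    omega
  · simp

/-- The nonzero torsion points lie above at most `m² - 1` roots, two points above each.
Multiplicities of the roots do not matter for this upper bound. -/
lemma finite_torsion {m : ℕ} (hm : (m : F) ≠ 0) :
    ({P : W.toAffine.Point | m • P = 0}).Finite ∧
      ({P : W.toAffine.Point | m • P = 0}).ncard ≤ 2 * m ^ 2 := by
  classical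
  have h0 : m ≠ 0 := by rintro rfl; simp at hm
  have hsub : {P : W.toAffine.Point | m • P = 0} ⊆
      {P | ∀ x y h, P = Point.some x y h → x ∈ (mulPoly W m).2.roots.toFinset} := by
    rintro P hP x y h rfl
    rw [Multiset.mem_toFinset, mem_roots (mulPoly_snd_ne_zero hm), IsRoot.def,
      ← smul_some_eq_zero_iff h]
    exact hP
  obtain ⟨h1, h2⟩ := finite_points_of_x_mem (W := W) (mulPoly W m).2.roots.toFinset
  refine ⟨h1.subset hsub, (Set.ncard_le_ncard hsub h1).trans (h2.trans ?_)⟩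
  have h3 := (Multiset.toFinset_card_le _).trans (card_roots' (mulPoly W m).2)
  have h4 := (hasLead_mulPoly_snd W h0).1
  have h5 : 0 < m ^ 2 := by positivity
  omega

end Torsion

/-! ### Good reduction -/

section Reduction

open WeierstrassCurve WeierstrassCurve.Affine Polynomial

variable {F Γ : Type*} [Field F] [DecidableEq F] [LinearOrderedCommGroupWithZero Γ]
  {v : Valuation F Γ} {W : WeierstrassCurve v.valuationSubring}

/-- The predicate that a point reduces to the point at infinity. -/
def ReducesToZero (v : Valuation F Γ) {W : WeierstrassCurve F} (P : W.toAffine.Point) : Prop :=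
  ∀ x y h, P = Point.some x y h → 1 < v x

omit [DecidableEq F] in
lemma reducesToZero_some {W : WeierstrassCurve F} {x y : F} {h : W.toAffine.Nonsingular x y} :
    ReducesToZero v (Point.some x y h) ↔ 1 < v x := by
  refine ⟨fun H => H x y h rfl, ?_⟩
  rintro H x' y' h' e
  rw [Point.some.injEq] at e
  rwa [← e.1]

omit [DecidableEq F] in
lemma reducesToZero_zero {W : WeierstrassCurve F} :
    ReducesToZero v (0 : W.toAffine.Point) := by
  rintro x y h e
  exact absurd e.symm (Point.some_ne_zero h)

omit [DecidableEq F] in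
lemma ReducesToZero.neg {W : WeierstrassCurve F} {P : W.toAffine.Point} (h : ReducesToZero v P) :
    ReducesToZero v (-P) := by
  rcases P with _ | ⟨x, y, hP⟩
  · exact h
  · rw [Point.neg_some, reducesToZero_some]
    exact reducesToZero_some.mp h

omit [DecidableEq F] in
lemma valuation_b_le_one (W : WeierstrassCurve v.valuationSubring) :
    v (W⁄F).b₂ ≤ 1 ∧ v (W⁄F).b₄ ≤ 1 ∧ v (W⁄F).b₆ ≤ 1 ∧ v (W⁄F).b₈ ≤ 1 := by
  simp only [WeierstrassCurve.baseChange, map_b₂, map_b₄, map_b₆, map_b₈]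
  exact ⟨W.b₂.2, W.b₄.2, W.b₆.2, W.b₈.2⟩

omit [DecidableEq F] in
-- If `a` had value greater than `1`, integrality of the sum would force `b` to have the same value,
-- and the product could not be integral.
lemma valuation_le_one_of_sum_prod {a b : F} (hs : v (a + b) ≤ 1) (hp : v (a * b) ≤ 1) :
    v a ≤ 1 := by
  by_contra! h
  have hb : v b = v a := by
    have h1 : b = (a + b) + -a := by ring
    rw [h1, Valuation.map_add_eq_of_lt_right _ (by rw [Valuation.map_neg]; exact hs.trans_lt h),
      Valuation.map_neg]
  rw [map_mul, hb] at hp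
  exact (one_lt_mul'' h h).not_ge hp

/-- Adding a point that reduces to zero preserves integrality. -/
lemma not_reducesToZero_add {P R : (W⁄F).toAffine.Point} (hP : ReducesToZero v P)
    (hR : ¬ ReducesToZero v R) : ¬ ReducesToZero v (R + P) := by
  rcases P with _ | ⟨X, Y, hXY⟩
  · rw [← Point.zero_def, add_zero]
    exact hR
  rcases R with _ | ⟨x, y, hxy⟩
  · exact absurd reducesToZero_zero hR
  rw [reducesToZero_some] at hP
  rw [reducesToZero_some, not_lt] at hR
  have hne : x ≠ X := by
    rintro rfl
    exact hP.not_ge hR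
  obtain ⟨c, hc, e⟩ := addSubMap_sym2x (Point.some x y hxy) (Point.some X Y hXY)
  obtain ⟨x₁, y₁, h₁, e₁⟩ : ∃ x₁ y₁ h₁, Point.some x y hxy + Point.some X Y hXY =
      Point.some x₁ y₁ h₁ := ⟨_, _, _, Point.add_of_X_ne hne⟩
  obtain ⟨x₂, y₂, h₂, e₂⟩ : ∃ x₂ y₂ h₂, Point.some x y hxy - Point.some X Y hXY =
      Point.some x₂ y₂ h₂ := by
    rw [sub_eq_add_neg, Point.neg_some]
    exact ⟨_, _, _, Point.add_of_X_ne hne⟩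
  rw [e₁, e₂, Point.sym2x_some_some, Point.sym2x_some_some, eval_addSubMap] at e
  have f0 := congrFun e 0
  have f1 := congrFun e 1
  have f2 := congrFun e 2
  simp only [Matrix.cons_val_zero, Matrix.cons_val_one, Matrix.cons_val, Pi.smul_apply,
    smul_eq_mul, mul_one, one_pow] at f0 f1 f2
  obtain ⟨hb2, hb4, hb6, hb8⟩ := valuation_b_le_one W
  have hX1 : v X ≤ v X ^ 2 := le_self_pow₀ hP.le two_ne_zero
  have hX2 : 1 ≤ v X ^ 2 := one_le_pow₀ hP.le
  -- The third coordinate gives `c = (x - X)²`. Dividing the other two by it shows that the sum and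
  -- the product of the `x`-coordinates of `R + P` and `R - P` are integral, hence so is each of
  -- them.
  have hcv : v c = v X ^ 2 := by
    rw [← f2, show (x + X) ^ 2 - 4 * (x * X) = (x - X) ^ 2 by ring, map_pow,
      Valuation.map_sub_eq_of_lt_right _ (hR.trans_lt hP)]
  have hs : v (x * X) ≤ v X := by
    rw [map_mul]
    exact mul_le_of_le_one_left' hR
  have ht : v (x + X) ≤ v X := (v.map_add _ _).trans (max_le (hR.trans hP.le) le_rfl)
  have key1 : v (c * (x₁ * x₂)) ≤ v X ^ 2 := by
    rw [← f0]
    refine v.map_sub_le (v.map_sub_le (v.map_sub_le ?_ ?_) ?_) (hb8.trans hX2)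
    · rw [map_pow]
      exact pow_le_pow_left' hs 2
    · rw [map_mul]
      exact (mul_le_of_le_one_left' hb4).trans (hs.trans hX1)
    · rw [map_mul]
      exact (mul_le_of_le_one_left' hb6).trans (ht.trans hX1)
  have h2 : v 2 ≤ 1 := by exact_mod_cast natCast_mem v.valuationSubring 2
  have key2 : v (c * (x₁ + x₂)) ≤ v X ^ 2 := by
    rw [← f1]
    refine v.map_add_le (v.map_add_le (v.map_add_le ?_ ?_) ?_) (hb6.trans hX2)
    · rw [map_mul, map_mul, sq]
      exact mul_le_mul' ((mul_le_of_le_one_left' h2).trans ht) hs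
    · rw [map_mul]
      exact (mul_le_of_le_one_left' hb2).trans (hs.trans hX1)
    · rw [map_mul]
      exact (mul_le_of_le_one_left' hb4).trans (ht.trans hX1)
  have hpos : 0 < v X ^ 2 := zero_lt_one.trans_le hX2
  rw [map_mul, hcv] at key1 key2
  rw [e₁, reducesToZero_some, not_lt]
  exact valuation_le_one_of_sum_prod (v := v) (b := x₂)
    (le_of_mul_le_mul_left (key2.trans_eq (mul_one _).symm) hpos)
    (le_of_mul_le_mul_left (key1.trans_eq (mul_one _).symm) hpos)

/-- If `P + Q` did not reduce to zero, adding `-P`, which does, would by `not_reducesToZero_add`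
give a point `Q` that does not. -/
lemma ReducesToZero.add {P Q : (W⁄F).toAffine.Point} (hP : ReducesToZero v P)
    (hQ : ReducesToZero v Q) : ReducesToZero v (P + Q) := by
  by_contra h
  refine not_reducesToZero_add hP.neg h ?_
  rwa [add_neg_cancel_comm]

variable (v W) in
/-- The kernel of reduction. -/
def reductionKer : AddSubgroup (W⁄F).toAffine.Point where
  carrier := {P | ReducesToZero v P}
  zero_mem' := reducesToZero_zero
  add_mem' := ReducesToZero.add
  neg_mem' := ReducesToZero.neg

omit [DecidableEq F] in
-- At an argument of value greater than `1` the leading term strictly dominates all others.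
lemma valuation_le_one_of_isRoot {p : v.valuationSubring[X]} {d : ℕ} {a : v.valuationSubring}
    (hp : HasLead p d a) (ha : v a = 1) {x : F}
    (hx : (p.map (algebraMap v.valuationSubring F)).eval x = 0) : v x ≤ 1 := by
  by_contra! h
  rw [Polynomial.eval_map, eval₂_eq_sum_range' _ (Nat.lt_succ_of_le hp.1),
    Finset.sum_range_succ, hp.2] at hx
  have h1 : v (∑ i ∈ Finset.range d, algebraMap v.valuationSubring F (p.coeff i) * x ^ i) <
      v x ^ d := by
    refine Valuation.map_sum_lt _ (pow_ne_zero _ (zero_lt_one.trans h).ne') fun i hi => ?_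
    rw [map_mul, map_pow]
    exact (mul_le_of_le_one_left' (p.coeff i).2).trans_lt
      (pow_lt_pow_right₀ h (Finset.mem_range.mp hi))
  have h2 : v (algebraMap v.valuationSubring F a * x ^ d) = v x ^ d := by
    rw [map_mul, map_pow]
    exact (congrArg (· * v x ^ d) ha).trans (one_mul _)
  rw [add_eq_zero_iff_eq_neg] at hx
  rw [hx, Valuation.map_neg, h2] at h1
  exact lt_irrefl _ h1

/-- The `x`-coordinate of a nonzero `m`-torsion point is a root of an integral polynomial with
leading coefficient `m²`, a unit; so it is integral and the point does not reduce to zero. -/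
lemma eq_zero_of_reducesToZero_of_smul {m : ℕ} (hm : v (m : F) = 1) {P : (W⁄F).toAffine.Point}
    (hP : ReducesToZero v P) (h : m • P = 0) : P = 0 := by
  rcases P with _ | ⟨x, y, hxy⟩
  · rfl
  exfalso
  rw [smul_some_eq_zero_iff, show W⁄F = W.map (algebraMap v.valuationSubring F) from rfl,
    mulPoly_map] at h
  have hm0 : m ≠ 0 := by rintro rfl; simp at hm
  refine (reducesToZero_some.mp hP).not_ge
    (valuation_le_one_of_isRoot (hasLead_mulPoly_snd W hm0) ?_ h)
  push_cast
  rw [map_pow, hm, one_pow]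

omit [DecidableEq F] in
lemma valuation_y_le_one {x y : F} (h : (W⁄F).toAffine.Nonsingular x y) (hx : v x ≤ 1) :
    v y ≤ 1 := by
  have e := (Affine.equation_iff _ _).mp h.1
  let q : v.valuationSubring[X] := X ^ 2 + C (W.a₁ * ⟨x, hx⟩ + W.a₃) * X -
      C (⟨x, hx⟩ ^ 3 + W.a₂ * ⟨x, hx⟩ ^ 2 + W.a₄ * ⟨x, hx⟩ + W.a₆)
  have hq : HasLead q 2 1 := ⟨by simp only [q]; compute_degree, by simp only [q]; compute_degree!⟩
  refine valuation_le_one_of_isRoot hq (by simp) ?_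
  simp only [WeierstrassCurve.baseChange, map_a₁, map_a₂, map_a₃, map_a₄, map_a₆] at e
  have hx' : algebraMap v.valuationSubring F ⟨x, hx⟩ = x := rfl
  simp only [q, Polynomial.map_sub, Polynomial.map_add, Polynomial.map_mul, Polynomial.map_pow,
    Polynomial.map_X, Polynomial.map_C, eval_sub, eval_add, eval_mul, eval_pow, eval_X, eval_C,
    map_add, map_mul, map_pow, hx']
  linear_combination e

omit [DecidableEq F] in
/-- At an integral point of a curve of good reduction one of the partial derivatives is a unit. -/
lemma valuation_partial_eq_one (hΔ : IsUnit W.Δ) {x y : F} (h : (W⁄F).toAffine.Nonsingular x y)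
    (hx : v x ≤ 1) (hy : v (y - (W⁄F).toAffine.negY x y) < 1) :
    v (3 * x ^ 2 + 2 * (W⁄F).a₂ * x + (W⁄F).a₄ - (W⁄F).a₁ * y) = 1 := by
  have hy1 := valuation_y_le_one h hx
  lift x to v.valuationSubring using hx
  lift y to v.valuationSubring using hy1
  have e := (Affine.equation_iff _ _).mp h.1
  set k := IsLocalRing.ResidueField v.valuationSubring
  let r : v.valuationSubring →+* k := IsLocalRing.residue _
  have hΔ' : (W.map r).Δ ≠ 0 := by
    rw [map_Δ]
    exact (hΔ.map r).ne_zero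
  have hW : W.toAffine.Equation x y := by
    rw [Affine.equation_iff]
    apply Subtype.val_injective
    simpa [WeierstrassCurve.baseChange] using e
  -- The reduced point is nonsingular and its `Y`-derivative vanishes by `hy`, so its `X`-derivative
  -- does not.
  have hns := (Affine.equation_iff_nonsingular_of_Δ_ne_zero (W := (W.map r).toAffine) hΔ').mp
    (hW.map r)
  have hu : ((3 * x ^ 2 + 2 * W.a₂ * x + W.a₄ - W.a₁ * y : v.valuationSubring) : F) =
      3 * (x : F) ^ 2 + 2 * (W⁄F).a₂ * x + (W⁄F).a₄ - (W⁄F).a₁ * y := by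
    simp [WeierstrassCurve.baseChange]
    rfl
  rw [← hu]
  by_contra hne
  have hlt := lt_of_le_of_ne (3 * x ^ 2 + 2 * W.a₂ * x + W.a₄ - W.a₁ * y : v.valuationSubring).2 hne
  have hmem := (IsLocalRing.residue_eq_zero_iff _).mpr (v.mem_maximalIdeal_iff.mpr hlt)
  have hu' : ((y - W.toAffine.negY x y : v.valuationSubring) : F) =
      (y : F) - (W⁄F).toAffine.negY x y := by
    simp [WeierstrassCurve.baseChange, Affine.negY]
  rw [← hu'] at hy
  have hmem' := (IsLocalRing.residue_eq_zero_iff _).mpr (v.mem_maximalIdeal_iff.mpr hy)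
  rw [Affine.nonsingular_iff] at hns
  rcases hns.2 with h' | h'
  · apply h'
    simp only [map_a₁, map_a₂, map_a₄]
    have : r (3 * x ^ 2 + 2 * W.a₂ * x + W.a₄ - W.a₁ * y) = 0 := hmem
    simp only [map_sub, map_add, map_mul, map_pow, map_ofNat] at this
    linear_combination -this
  · apply h'
    simp only [map_a₁, map_a₃]
    have : r (y - W.toAffine.negY x y) = 0 := hmem'
    simp only [Affine.negY, map_sub, map_mul, map_neg] at this
    linear_combination this

lemma one_lt_one_div' {a : Γ} (ha : a ≠ 0) (h : a < 1) : 1 < 1 / a := by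
  rw [one_div]
  exact (one_lt_inv₀ (zero_lt_iff.mpr ha)).mpr h

omit [DecidableEq F] in
-- The `x`-coordinate of a sum is `l² + a₁ l` plus integral terms, and `l²` dominates when the slope
-- `l` is not integral.
lemma one_lt_valuation_addX {x₁ x₂ l : F} (hx₁ : v x₁ ≤ 1) (hx₂ : v x₂ ≤ 1) (hl : 1 < v l) :
    1 < v ((W⁄F).toAffine.addX x₁ x₂ l) := by
  have ha : v (W⁄F).a₁ ≤ 1 ∧ v (W⁄F).a₂ ≤ 1 := by
    simp only [WeierstrassCurve.baseChange, map_a₁, map_a₂]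
    exact ⟨W.a₁.2, W.a₂.2⟩
  have hl2 : v l < v l ^ 2 := by
    exact lt_self_pow₀ hl one_lt_two
  have h1 : v ((W⁄F).a₁ * l - ((W⁄F).a₂ + x₁ + x₂)) < v (l ^ 2) := by
    rw [map_pow]
    refine v.map_sub_lt ?_ ?_
    · rw [map_mul]
      exact (mul_le_of_le_one_left' ha.1).trans_lt hl2
    · exact (v.map_add_le (v.map_add_le ha.2 hx₁) hx₂).trans_lt (hl.trans hl2)
  rw [Affine.addX, show l ^ 2 + (W⁄F).a₁ * l - (W⁄F).a₂ - x₁ - x₂ =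
    l ^ 2 + ((W⁄F).a₁ * l - ((W⁄F).a₂ + x₁ + x₂)) by ring,
    Valuation.map_add_eq_of_lt_left _ h1, map_pow]
  exact hl.trans hl2

/-- Two integral points with the same reduction differ by a point that reduces to zero. -/
lemma reducesToZero_sub (hΔ : IsUnit W.Δ) {x₁ y₁ x₂ y₂ : F}
    (h₁ : (W⁄F).toAffine.Nonsingular x₁ y₁) (h₂ : (W⁄F).toAffine.Nonsingular x₂ y₂)
    (hx₁ : v x₁ ≤ 1) (hx₂ : v x₂ ≤ 1) (hx : v (x₁ - x₂) < 1) (hy : v (y₁ - y₂) < 1) :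
    ReducesToZero v (Point.some x₁ y₁ h₁ - Point.some x₂ y₂ h₂) := by
  by_cases hxx : x₁ = x₂
  · subst hxx
    rcases Point.X_eq_iff (h₁ := h₁) (h₂ := h₂).mp rfl with h | h
    · rw [h, sub_self]
      exact reducesToZero_zero
    rw [sub_eq_add_neg, ← h]
    -- The second point is the negative of the first, so the difference is a double. Its tangent
    -- slope has a unit numerator and a denominator of value less than `1`.
    by_cases hyy : y₁ = (W⁄F).toAffine.negY x₁ y₁
    · rw [Point.add_self_of_Y_eq hyy]
      exact reducesToZero_zero
    rw [Point.add_self_of_Y_ne hyy, reducesToZero_some]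
    refine one_lt_valuation_addX hx₁ hx₁ ?_
    have hy2 : y₂ = (W⁄F).toAffine.negY x₁ y₁ := by
      rw [Point.neg_some, Point.some.injEq] at h
      rw [h.2, Affine.negY_negY]
    rw [hy2] at hy
    rw [slope_of_Y_ne rfl hyy, map_div₀, valuation_partial_eq_one hΔ h₁ hx₁ hy]
    exact one_lt_one_div' (v.ne_zero_iff.mpr (sub_ne_zero.mpr hyy)) hy
  rw [sub_eq_add_neg, Point.neg_some, Point.add_of_X_ne hxx, reducesToZero_some]
  refine one_lt_valuation_addX hx₁ hx₂ ?_
  rw [slope_of_X_ne hxx]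
  have hxx' := sub_ne_zero.mpr hxx
  have hW : v (W⁄F).a₁ ≤ 1 ∧ v (W⁄F).a₂ ≤ 1 ∧ v (W⁄F).a₃ ≤ 1 := by
    simp only [WeierstrassCurve.baseChange, map_a₁, map_a₂, map_a₃]
    exact ⟨W.a₁.2, W.a₂.2, W.a₃.2⟩
  obtain ⟨ha1, ha2, ha3⟩ := hW
  have hy₁ := valuation_y_le_one h₁ hx₁
  have hy₂ := valuation_y_le_one h₂ hx₂
  have hle : v (y₁ - (W⁄F).toAffine.negY x₂ y₂) ≤ 1 := by
    refine v.map_sub_le hy₁ (v.map_sub_le (v.map_sub_le ?_ ?_) ha3)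
    · rwa [Valuation.map_neg]
    · rw [map_mul]
      exact mul_le_one' ha1 hx₂
  -- If `y₁ - negY x₂ y₂` is a unit, the chord slope is visibly not integral. Otherwise the
  -- equations rewrite the slope as `g / (y₁ - y₂)`, where `g` is congruent to the `X`-derivative
  -- and hence a unit.
  rcases hle.lt_or_eq with hlt | heq
  · have hy' : v (y₁ - (W⁄F).toAffine.negY x₁ y₁) < 1 := by
      have : y₁ - (W⁄F).toAffine.negY x₁ y₁ = (y₁ - (W⁄F).toAffine.negY x₂ y₂) +
          ((y₁ - y₂) + (W⁄F).a₁ * (x₁ - x₂)) := by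
        simp only [Affine.negY]
        ring
      rw [this]
      refine v.map_add_lt hlt (v.map_add_lt hy ?_)
      rw [map_mul]
      exact (mul_le_of_le_one_left' ha1).trans_lt hx
    have hN := valuation_partial_eq_one hΔ h₁ hx₁ hy'
    set g := x₁ ^ 2 + x₁ * x₂ + x₂ ^ 2 + (W⁄F).a₂ * (x₁ + x₂) + (W⁄F).a₄ - (W⁄F).a₁ * y₁ with hg
    have hgv : v g = 1 := by
      have : g = (3 * x₁ ^ 2 + 2 * (W⁄F).a₂ * x₁ + (W⁄F).a₄ - (W⁄F).a₁ * y₁) +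
          -((x₁ - x₂) * (x₂ + (x₁ + x₁) + (W⁄F).a₂)) := by
        rw [hg]
        ring
      rw [this, Valuation.map_add_eq_of_lt_left, hN]
      rw [hN, Valuation.map_neg, map_mul]
      refine (mul_le_of_le_one_right' ?_).trans_lt hx
      exact v.map_add_le (v.map_add_le hx₂ (v.map_add_le hx₁ hx₁)) ha2
    have hmul : (y₁ - (W⁄F).toAffine.negY x₂ y₂) * (y₁ - y₂) = (x₁ - x₂) * g := by
      have e₁ := (Affine.equation_iff _ _).mp h₁.1
      have e₂ := (Affine.equation_iff _ _).mp h₂.1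
      rw [hg, Affine.negY]
      linear_combination e₁ - e₂
    have hg0 : g ≠ 0 := by
      rintro h
      rw [h, map_zero] at hgv
      exact zero_ne_one hgv
    have hyy : y₁ - y₂ ≠ 0 := by
      intro h
      rw [h, mul_zero] at hmul
      exact mul_ne_zero hxx' hg0 hmul.symm
    rw [show (y₁ - (W⁄F).toAffine.negY x₂ y₂) / (x₁ - x₂) = g / (y₁ - y₂) by
      field_simp
      linear_combination hmul, map_div₀, hgv]
    exact one_lt_one_div' (v.ne_zero_iff.mpr hyy) hy
  · rw [map_div₀, heq]
    exact one_lt_one_div' (v.ne_zero_iff.mpr hxx') hx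

end Reduction

/-! ### The extension of the valuation of `K_v` to its algebraic closure -/

section ExtVal

/-- The valuation is the spectral norm. It is multiplicative because `k` is complete, Galois
invariant because it depends only on the minimal polynomial, and at most `1` exactly when that
polynomial has integral coefficients. -/
lemma exists_valuation_algebraicClosure (k : Type*) [NontriviallyNormedField k]
    [IsUltrametricDist k] [CompleteSpace k] :
    ∃ w : Valuation (AlgebraicClosure k) ℝ≥0,
      (∀ x : k, w (algebraMap k _ x) = ‖x‖₊) ∧
      (∀ (σ : AlgebraicClosure k ≃ₐ[k] AlgebraicClosure k) x, w (σ x) = w x) ∧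
      ∀ x, w x ≤ 1 ↔ ∀ n, ‖(minpoly k x).coeff n‖ ≤ 1 := by
  let w : Valuation (AlgebraicClosure k) ℝ≥0 :=
    { toFun := fun x => ⟨spectralNorm k (AlgebraicClosure k) x, spectralNorm_nonneg x⟩
      map_zero' := Subtype.ext spectralNorm_zero
      map_one' := Subtype.ext spectralNorm_one
      map_mul' := fun x y => Subtype.ext (spectralAlgNorm_mul x y)
      map_add_le_max' := fun x y => isNonarchimedean_spectralNorm x y }
  refine ⟨w, fun x => Subtype.ext (spectralNorm_extends x),
    fun σ x => Subtype.ext (spectralNorm_eq_of_equiv σ x).symm, fun x => ?_⟩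
  exact spectralValue_le_one_iff (minpoly.monic (Algebra.IsIntegral.isIntegral x))

variable {K : Type u} [Field K] [NumberField K] (v : HeightOneSpectrum (𝓞 K))

lemma valued_algebraMap (x : K) :
    Valued.v (algebraMap K (v.adicCompletion K) x) = v.valuation K x :=
  HeightOneSpectrum.adicCompletion.valued_coe K v x

/-- The two valuations have different value groups, so the extension property is expressed through
the order of values. -/
lemma exists_extVal : ∃ w : Valuation (AlgebraicClosure (v.adicCompletion K)) ℝ≥0,
      (∀ x y : v.adicCompletion K,
        w (algebraMap _ _ x) ≤ w (algebraMap _ _ y) ↔ Valued.v x ≤ Valued.v y) ∧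
      (∀ (σ : AbsGal (v.adicCompletion K)) x, w (σ x) = w x) ∧
      ∀ x, w x ≤ 1 ↔ IsIntegral (v.adicCompletionIntegers K) x := by
  let _ : NontriviallyNormedField (v.adicCompletion K) :=
    { NumberField.HeightOneSpectrum.instNormedFieldValuedAdicCompletion K v with
      non_trivial := by
        obtain ⟨π, hπ⟩ := v.valuation_exists_uniformizer K
        refine ⟨(algebraMap K _ π)⁻¹, Valued.toNormedField.one_lt_norm_iff.mpr ?_⟩
        rw [map_inv₀, valued_algebraMap, hπ, ← WithZero.exp_neg, ← WithZero.exp_zero,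
          WithZero.exp_lt_exp]
        simp }
  obtain ⟨w, h1, h2, h3⟩ := exists_valuation_algebraicClosure (v.adicCompletion K)
  have hv : ∀ x y : v.adicCompletion K, ‖x‖₊ ≤ ‖y‖₊ ↔ Valued.v x ≤ Valued.v y :=
    fun x y => Valued.toNormedField.norm_le_iff
  have hv1 : ∀ x : v.adicCompletion K, ‖x‖ ≤ 1 ↔ Valued.v x ≤ 1 :=
    fun x => Valued.toNormedField.norm_le_one_iff
  refine ⟨w, fun x y => by rw [h1, h1]; exact hv x y, h2, fun x => Iff.intro (fun hx => ?_) ?_⟩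
  · rw [h3] at hx
    have hl : minpoly (v.adicCompletion K) x ∈
        Polynomial.lifts (algebraMap (v.adicCompletionIntegers K) (v.adicCompletion K)) := by
      rw [Polynomial.lifts_iff_coeff_lifts]
      exact fun n => ⟨⟨_, (hv1 _).mp (hx n)⟩, rfl⟩
    obtain ⟨q, hq, -, hqm⟩ := Polynomial.lifts_and_degree_eq_and_monic hl
      (minpoly.monic (Algebra.IsIntegral.isIntegral x))
    refine ⟨q, hqm, ?_⟩
    rw [IsScalarTower.algebraMap_eq (v.adicCompletionIntegers K) (v.adicCompletion K),
      ← Polynomial.eval₂_map, hq]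
    exact minpoly.aeval _ x
  · intro hx
    obtain ⟨q, hqm, hq⟩ := hx
    have : (w.integer.subtype).IsIntegralElem x := by
      let f : v.adicCompletionIntegers K →+* w.integer :=
        ((algebraMap (v.adicCompletion K) (AlgebraicClosure (v.adicCompletion K))).comp
          (algebraMap (v.adicCompletionIntegers K) (v.adicCompletion K))).codRestrict _ fun y => by
            rw [Valuation.mem_integer_iff]
            have := (h1 (y : v.adicCompletion K)).le.trans (show ‖(y : v.adicCompletion K)‖₊ ≤ 1 from (hv1 _).mpr y.2)
            exact this
      refine ⟨q.map f, hqm.map f, ?_⟩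
      rw [Polynomial.eval₂_map]
      exact hq
    exact (Valuation.mem_integer_iff _ _).mp ((Valuation.integer.integers w).mem_of_integral this)

/-- The extension of the valuation of `K_v` to its algebraic closure. -/
def extVal : Valuation (AlgebraicClosure (v.adicCompletion K)) ℝ≥0 :=
  (exists_extVal v).choose

lemma extVal_le_iff (x y : v.adicCompletion K) :
    extVal v (algebraMap _ _ x) ≤ extVal v (algebraMap _ _ y) ↔ Valued.v x ≤ Valued.v y :=
  (exists_extVal v).choose_spec.1 x y

lemma extVal_lt_iff (x y : v.adicCompletion K) :
    extVal v (algebraMap _ _ x) < extVal v (algebraMap _ _ y) ↔ Valued.v x < Valued.v y := by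
  rw [← not_le, extVal_le_iff, not_le]

lemma extVal_le_one_iff (x : v.adicCompletion K) :
    extVal v (algebraMap _ _ x) ≤ 1 ↔ Valued.v x ≤ 1 := by
  simpa using extVal_le_iff v x 1

lemma extVal_lt_one_iff (x : v.adicCompletion K) :
    extVal v (algebraMap _ _ x) < 1 ↔ Valued.v x < 1 := by
  simpa using extVal_lt_iff v x 1

lemma extVal_eq_iff (x y : v.adicCompletion K) :
    extVal v (algebraMap _ _ x) = extVal v (algebraMap _ _ y) ↔ Valued.v x = Valued.v y := by
  rw [le_antisymm_iff, extVal_le_iff, extVal_le_iff, ← le_antisymm_iff]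

lemma extVal_map (σ : AbsGal (v.adicCompletion K)) (x) : extVal v (σ x) = extVal v x :=
  (exists_extVal v).choose_spec.2.1 σ x

lemma extVal_le_one_iff_isIntegral (x) :
    extVal v x ≤ 1 ↔ IsIntegral (v.adicCompletionIntegers K) x :=
  (exists_extVal v).choose_spec.2.2 x

/-- The integral closure is the valuation ring of `extVal v`. Its units are the elements of value
`1`, so its Jacobson radical consists of the elements of value less than `1`. -/
lemma mem_inertia_iff (σ : AbsGal (v.adicCompletion K)) :
    σ ∈ inertia v ↔ ∀ x, extVal v x ≤ 1 → extVal v (σ x - x) < 1 := by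
  set B := integralClosure (v.adicCompletionIntegers K) (AlgebraicClosure (v.adicCompletion K))
  have hmem : ∀ x, x ∈ B ↔ extVal v x ≤ 1 := fun x => (extVal_le_one_iff_isIntegral v x).symm
  have hunit : ∀ x : B, IsUnit x ↔ extVal v x = 1 := by
    refine fun x => ⟨fun h => ?_, fun h => ?_⟩
    · obtain ⟨y, hy⟩ := h.exists_right_inv
      have hy' : (x : AlgebraicClosure (v.adicCompletion K)) * y = 1 := congrArg Subtype.val hy
      refine le_antisymm ((hmem _).mp x.2) (not_lt.mp fun h => ?_)
      have := congrArg (extVal v) hy'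
      rw [map_mul, map_one] at this
      exact absurd this (mul_lt_one_of_lt_of_le h ((hmem _).mp y.2)).ne
    · have h0 : (x : AlgebraicClosure (v.adicCompletion K)) ≠ 0 := by
        intro h0
        rw [h0, map_zero] at h
        exact zero_ne_one h
      refine IsUnit.of_mul_eq_one ⟨(x : AlgebraicClosure (v.adicCompletion K))⁻¹, ?_⟩ ?_
      · rw [hmem, map_inv₀, h, inv_one]
      · exact Subtype.ext (mul_inv_cancel₀ h0)
  have hjac : ∀ x : B, x ∈ Ideal.jacobson (⊥ : Ideal B) ↔ extVal v x < 1 := by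
    intro x
    rw [Ideal.mem_jacobson_bot]
    refine ⟨fun h => lt_of_le_of_ne ((hmem _).mp x.2) fun h1 => ?_, fun h y => ?_⟩
    · obtain ⟨y, hy⟩ := ((hunit x).mpr h1).exists_right_inv
      have := h (-y)
      rw [mul_neg, hy, neg_add_cancel] at this
      exact not_isUnit_zero this
    · rw [hunit]
      have : extVal v (x * y : AlgebraicClosure (v.adicCompletion K)) < 1 := by
        rw [map_mul]
        exact mul_lt_one_of_lt_of_le h ((hmem _).mp y.2)
      rw [← map_one (extVal v)] at this
      exact ((extVal v).map_add_eq_of_lt_right this).trans (map_one _)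
  refine ⟨fun h x hx => ?_, fun h x => ?_⟩
  · exact (hjac _).mp (h ⟨x, (hmem x).mpr hx⟩)
  · exact (hjac _).mpr (h _ ((hmem _).mp x.2))

lemma exists_valued_sub_lt (x c : v.adicCompletion K) (hc : c ≠ 0) :
    ∃ a : K, Valued.v (x - algebraMap K _ a) < Valued.v c := by
  have hγ : Valued.v.restrict c ≠ 0 := by simpa using hc
  have hmem : {y | Valued.v.restrict (y - x) < Units.mk0 _ hγ} ∈ nhds x :=
    Valued.mem_nhds.mpr ⟨Units.mk0 _ hγ, subset_rfl⟩
  obtain ⟨a, ha⟩ := (HeightOneSpectrum.denseRange_algebraMap K v).exists_mem_open isOpen_interior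
    ⟨x, mem_interior_iff_mem_nhds.mpr hmem⟩
  refine ⟨a, ?_⟩
  have := interior_subset ha
  rw [Valuation.map_sub_swap]
  exact Valued.v.restrict_lt_iff.mp this

/-- Every integer of `K_v` is congruent to an integer of `K` modulo any nonzero element. -/
lemma exists_int_valued_sub_lt (x : v.adicCompletion K) (hx : Valued.v x ≤ 1)
    (c : v.adicCompletion K) (hc : c ≠ 0) :
    ∃ a : 𝓞 K, Valued.v (x - algebraMap K _ a) < Valued.v c := by
  have hc' : Valued.v c ≠ 0 := by simpa using hc
  wlog h1 : Valued.v c ≤ 1 generalizing c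
  · obtain ⟨a, ha⟩ := this 1 one_ne_zero (by simp) (by simp)
    exact ⟨a, ha.trans (by simpa using h1)⟩
  obtain ⟨b, hb⟩ := exists_valued_sub_lt v x c hc
  have hb1 : v.valuation K b ≤ 1 := by
    rw [← valued_algebraMap]
    have := Valued.v.map_sub x (x - algebraMap K _ b)
    rw [sub_sub_cancel] at this
    exact this.trans (max_le hx (hb.le.trans h1))
  obtain ⟨a, ha⟩ := v.exists_valuation_sub_lt_of_integer hb1 (Units.mk0 _ hc')
  refine ⟨a, ?_⟩
  rw [← valued_algebraMap, Units.val_mk0, map_sub, Valuation.map_sub_swap] at ha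
  rw [← sub_add_sub_cancel x (algebraMap K _ b)]
  exact Valued.v.map_add_lt hb ha

end ExtVal

/-! ### Reduction of elements of a valued field -/

section Reduction

variable {F : Type*} [Field F] {Γ : Type*} [LinearOrderedCommGroupWithZero Γ] (w : Valuation F Γ)

open Classical in
/-- The residue class of an element of the valuation ring, and `0` for other elements. -/
def red (x : F) : IsLocalRing.ResidueField w.valuationSubring :=
  if h : w x ≤ 1 then IsLocalRing.residue w.valuationSubring ⟨x, h⟩ else 0

variable {w} {x y : F}

lemma red_coe (x : w.valuationSubring) : red w x = IsLocalRing.residue _ x :=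
  dif_pos x.2

lemma red_surjective (z : IsLocalRing.ResidueField w.valuationSubring) :
    ∃ x, w x ≤ 1 ∧ red w x = z := by
  obtain ⟨x, rfl⟩ := IsLocalRing.residue_surjective z
  exact ⟨x, x.2, red_coe x⟩

lemma red_mul (hx : w x ≤ 1) (hy : w y ≤ 1) : red w (x * y) = red w x * red w y := by
  lift x to w.valuationSubring using hx
  lift y to w.valuationSubring using hy
  rw [← MulMemClass.coe_mul, red_coe, red_coe, red_coe, map_mul]

lemma red_add (hx : w x ≤ 1) (hy : w y ≤ 1) : red w (x + y) = red w x + red w y := by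
  lift x to w.valuationSubring using hx
  lift y to w.valuationSubring using hy
  rw [← AddMemClass.coe_add, red_coe, red_coe, red_coe, map_add]

variable (w) in
lemma red_one : red w 1 = 1 := by
  rw [← OneMemClass.coe_one w.valuationSubring, red_coe, map_one]

variable (w) in
lemma red_zero : red w 0 = 0 := by
  rw [← ZeroMemClass.coe_zero w.valuationSubring, red_coe, map_zero]

lemma red_neg (hx : w x ≤ 1) : red w (-x) = -red w x := by
  lift x to w.valuationSubring using hx
  rw [← NegMemClass.coe_neg, red_coe, red_coe, map_neg]

lemma red_pow (hx : w x ≤ 1) (n : ℕ) : red w (x ^ n) = red w x ^ n := by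
  lift x to w.valuationSubring using hx
  rw [← SubmonoidClass.coe_pow, red_coe, red_coe, map_pow]

variable (w) in
lemma red_natCast (n : ℕ) : red w n = n := by
  rw [← SubringClass.coe_natCast w.valuationSubring, red_coe, map_natCast]

lemma red_sum {ι : Type*} (s : Finset ι) (f : ι → F) (hf : ∀ i ∈ s, w (f i) ≤ 1) :
    red w (∑ i ∈ s, f i) = ∑ i ∈ s, red w (f i) := by
  classical
  induction s using Finset.induction_on with
  | empty => simpa using red_zero w
  | insert a s ha ih =>
    rw [Finset.sum_insert ha, Finset.sum_insert ha, red_add, ih]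
    · exact fun i hi => hf i (Finset.mem_insert_of_mem hi)
    · exact hf a (Finset.mem_insert_self _ _)
    · exact w.map_sum_le fun i hi => hf i (Finset.mem_insert_of_mem hi)

lemma red_eq_zero_iff (hx : w x ≤ 1) : red w x = 0 ↔ w x < 1 := by
  lift x to w.valuationSubring using hx
  rw [red_coe, IsLocalRing.residue_eq_zero_iff, Valuation.mem_maximalIdeal_iff]

lemma red_eq_iff (hx : w x ≤ 1) (hy : w y ≤ 1) : red w x = red w y ↔ w (x - y) < 1 := by
  rw [← sub_eq_zero, sub_eq_add_neg, ← red_neg hy, ← red_add hx (by rwa [Valuation.map_neg]),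
    ← sub_eq_add_neg, red_eq_zero_iff (w.map_sub_le hx hy)]

lemma val_natCast_le_one (w : Valuation F Γ) (n : ℕ) : w (n : F) ≤ 1 := by
  induction n with
  | zero => simp
  | succ n ih => push_cast; exact w.map_add_le ih (by simp)

lemma val_eq_one_of_pow_eq_one {ζ : F} {N : ℕ} (hN : N ≠ 0) (h : ζ ^ N = 1) :
    w ζ = 1 := by
  have := congrArg w h
  rw [map_pow, map_one] at this
  refine le_antisymm (not_lt.mp fun h => ?_) (not_lt.mp fun h => ?_)
  · exact (one_lt_pow₀ h hN).ne' this
  · exact (pow_lt_one₀ zero_le h hN).ne this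

/-- If `ζ ≠ ζ'`, then `∑ ζ^i ζ'^(N-1-i) = 0`. For congruent `ζ`, `ζ'` this sum reduces to `N
ζ'^(N-1)`, which is nonzero in the residue field. -/
lemma eq_of_pow_eq_one {ζ ζ' : F} {N : ℕ} (hN : w (N : F) = 1)
    (h : ζ ^ N = 1) (h' : ζ' ^ N = 1) (hlt : w (ζ - ζ') < 1) : ζ = ζ' := by
  have hN0 : N ≠ 0 := by rintro rfl; simp at hN
  have h1 : w ζ' = 1 := val_eq_one_of_pow_eq_one hN0 h'
  have h1' : w ζ = 1 := val_eq_one_of_pow_eq_one hN0 h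
  have hsum := Commute.geom_sum₂_mul (Commute.all ζ ζ') N
  rw [h, h', sub_self, mul_eq_zero, sub_eq_zero] at hsum
  refine hsum.resolve_left fun h0 => ?_
  have hO := congrArg (red w) h0
  rw [red_zero, red_sum _ _ (fun i _ => by simp [h1, h1'])] at hO
  have hz : red w ζ' ≠ 0 := fun h => ((red_eq_zero_iff h1.le).mp h).ne h1
  have : ∀ i ∈ Finset.range N, red w (ζ ^ i * ζ' ^ (N - 1 - i)) = red w ζ' ^ (N - 1) := by
    intro i hi
    rw [red_mul (by simp [h1']) (by simp [h1]), red_pow h1'.le, red_pow h1.le,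
      (red_eq_iff h1'.le h1.le).mpr hlt, ← pow_add,
      Nat.add_sub_cancel' (by have := Finset.mem_range.mp hi; omega)]
  rw [Finset.sum_congr rfl this, Finset.sum_const, Finset.card_range, nsmul_eq_mul,
    mul_eq_zero, ← red_natCast w, red_eq_zero_iff hN.le] at hO
  exact hO.elim (fun h => h.ne hN) (pow_ne_zero _ hz)

end Reduction

/-! ### Unramified extensions -/

section Unramified

variable {k : Type u} [Field k] (w : Valuation (AlgebraicClosure k) ℝ≥0)

/-- The subfield of the residue field of `k̄` of the classes of elements of `k`. -/
def baseResidue : Subfield (IsLocalRing.ResidueField w.valuationSubring) where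
  carrier := {z | ∃ y : k, w (algebraMap k _ y) ≤ 1 ∧ red w (algebraMap k _ y) = z}
  mul_mem' := by
    rintro _ _ ⟨a, ha, rfl⟩ ⟨b, hb, rfl⟩
    refine ⟨a * b, ?_, ?_⟩
    · rw [map_mul, map_mul]; exact mul_le_one' ha hb
    · rw [map_mul, red_mul ha hb]
  one_mem' := ⟨1, by simp, by rw [map_one, red_one]⟩
  add_mem' := by
    rintro _ _ ⟨a, ha, rfl⟩ ⟨b, hb, rfl⟩
    refine ⟨a + b, ?_, ?_⟩
    · rw [map_add]; exact w.map_add_le ha hb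
    · rw [map_add, red_add ha hb]
  zero_mem' := ⟨0, by simp, by rw [map_zero, red_zero]⟩
  neg_mem' := by
    rintro _ ⟨a, ha, rfl⟩
    exact ⟨-a, by rwa [map_neg, Valuation.map_neg], by rw [map_neg, red_neg ha]⟩
  inv_mem' := by
    rintro _ ⟨a, ha, rfl⟩
    by_cases h : w (algebraMap k _ a) = 1
    · have h' : w (algebraMap k _ a⁻¹) ≤ 1 := by rw [map_inv₀, map_inv₀, h, inv_one]
      refine ⟨a⁻¹, h', eq_inv_of_mul_eq_one_left ?_⟩
      rw [← red_mul h' ha, ← map_mul, inv_mul_cancel₀, map_one, red_one]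
      rintro rfl
      simp at h
    · refine ⟨0, by simp, ?_⟩
      rw [(red_eq_zero_iff ha).mpr (lt_of_le_of_ne ha h), inv_zero, map_zero, red_zero]

/-- The valuation `w` of `k̄` is Galois invariant, and discrete with finite residue field on `k`. -/
structure IsLocalVal : Prop where
  map_gal : ∀ (σ : AbsGal k) x, w (σ x) = w x
  exists_uniformizer : ∃ ϖ : k, ϖ ≠ 0 ∧ w (algebraMap k _ ϖ) < 1 ∧
    ∀ x : k, x ≠ 0 → ∃ n : ℤ, w (algebraMap k _ x) = w (algebraMap k _ ϖ) ^ n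
  finite_residue : Finite (baseResidue w)

/-- The inertia group of `w`. -/
def inertiaSet : Set (AbsGal k) := {σ | ∀ x, w x ≤ 1 → w (σ x - x) < 1}

variable {w}

/-- The automorphism of the residue field induced by a Galois automorphism. -/
lemma exists_residueMap (hw : ∀ (σ : AbsGal k) x, w (σ x) = w x) (σ : AbsGal k) :
    ∃ f : IsLocalRing.ResidueField w.valuationSubring →ₐ[baseResidue w]
      IsLocalRing.ResidueField w.valuationSubring, ∀ x, w x ≤ 1 →
      f (red w x) = red w (σ x) := by
  choose r hr1 hr2 using red_surjective (w := w)
  have hr1' : ∀ z, w (σ (r z)) ≤ 1 := fun z => (hw σ _).trans_le (hr1 z)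
  have key : ∀ x, w x ≤ 1 → red w (σ (r (red w x))) = red w (σ x) := by
    intro x hx
    rw [red_eq_iff (hr1' _) ((hw σ _).trans_le hx), ← map_sub, hw, ← red_eq_iff (hr1 _) hx, hr2]
  refine ⟨
    { toFun := fun z => red w (σ (r z))
      map_one' := by
        have := key 1 (by simp)
        rwa [red_one, map_one, red_one] at this
      map_zero' := by
        have := key 0 (by simp)
        rwa [red_zero, map_zero, red_zero] at this
      map_mul' := fun a b => by
        have h := key (r a * r b) (by rw [map_mul]; exact mul_le_one' (hr1 _) (hr1 _))
        rwa [red_mul (hr1 _) (hr1 _), hr2, hr2, map_mul, red_mul (hr1' _) (hr1' _)] at h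
      map_add' := fun a b => by
        have h := key (r a + r b) (w.map_add_le (hr1 _) (hr1 _))
        rwa [red_add (hr1 _) (hr1 _), hr2, hr2, map_add, red_add (hr1' _) (hr1' _)] at h
      commutes' := ?_ }, key⟩
  rintro ⟨_, y, hy, rfl⟩
  exact (key _ hy).trans (by rw [σ.commutes]; rfl)

/-- The conjugates of `x` have the same value as `x`, so the minimal polynomial is a product of
linear factors with integral coefficients. -/
lemma val_coeff_minpoly_le_one (hw : ∀ (σ : AbsGal k) x, w (σ x) = w x)
    {x : AlgebraicClosure k} (hx : w x ≤ 1) (n : ℕ) :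
    w (algebraMap k _ ((minpoly k x).coeff n)) ≤ 1 := by
  have hl : (minpoly k x).map (algebraMap k (AlgebraicClosure k)) ∈
      Polynomial.lifts w.valuationSubring.subtype := by
    rw [(IsAlgClosed.splits ((minpoly k x).map (algebraMap k (AlgebraicClosure k)))).eq_prod_roots_of_monic
      ((minpoly.monic (Algebra.IsIntegral.isIntegral x)).map _)]
    refine multiset_prod_mem _ fun p hp => ?_
    obtain ⟨r, hr, rfl⟩ := Multiset.mem_map.mp hp
    have hr0 : (Polynomial.aeval r) (minpoly k x) = 0 :=
      (Polynomial.mem_aroots.mp hr).2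
    obtain ⟨σ, rfl⟩ := minpoly.exists_algEquiv_of_root' (Algebra.IsAlgebraic.isAlgebraic x) hr0
    rw [sub_eq_add_neg, ← Polynomial.C_neg]
    refine add_mem (Polynomial.X_mem_lifts _) (Polynomial.C'_mem_lifts ?_)
    exact ⟨⟨-σ x, by rw [Valuation.mem_valuationSubring_iff, Valuation.map_neg]; exact (hw σ x).trans_le hx⟩, rfl⟩
  rw [Polynomial.lifts_iff_coeff_lifts] at hl
  obtain ⟨y, hy⟩ := hl n
  rw [Polynomial.coeff_map] at hy
  exact hy ▸ y.2

/-- The coefficientwise reduction of the minimal polynomial of `x` annihilates `red w x`, and it is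
nonzero because its top coefficient remains `1`. -/
lemma isIntegral_red (hw : ∀ (σ : AbsGal k) x, w (σ x) = w x)
    {x : AlgebraicClosure k} (hx : w x ≤ 1) : IsIntegral (baseResidue w) (red w x) := by
  have hc := val_coeff_minpoly_le_one hw hx
  set d := (minpoly k x).natDegree
  let c : ℕ → baseResidue w := fun i => ⟨red w (algebraMap k _ ((minpoly k x).coeff i)), _, hc i, rfl⟩
  refine (IsAlgebraic.isIntegral ⟨∑ i ∈ Finset.range (d + 1), Polynomial.monomial i (c i), ?_, ?_⟩)
  · intro h0
    have := congrArg (fun p => Polynomial.coeff p d) h0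
    simp only [Polynomial.finsetSum_coeff, Polynomial.coeff_monomial, Finset.sum_ite_eq',
      Finset.mem_range, Nat.lt_succ_self, if_true, Polynomial.coeff_zero] at this
    have h1 := congrArg Subtype.val this
    change red w (algebraMap k _ (minpoly k x).leadingCoeff) = 0 at h1
    rw [minpoly.monic (Algebra.IsIntegral.isIntegral x), map_one, red_one] at h1
    exact one_ne_zero h1
  · have h0 := minpoly.aeval k x
    rw [Polynomial.aeval_eq_sum_range] at h0
    have h1 := congrArg (red w) h0
    rw [red_sum, red_zero] at h1
    · rw [map_sum, ← h1]
      refine Finset.sum_congr rfl fun i _ => ?_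
      rw [Polynomial.aeval_monomial, Algebra.smul_def, red_mul (hc i) (by simpa using pow_le_one' hx i),
        red_pow hx]
      rfl
    · intro i _
      rw [Algebra.smul_def, map_mul, map_pow]
      exact mul_le_one' (hc i) (pow_le_one' hx i)

/-- Every unit of the valuation ring is congruent to a root of unity of order prime to the
residue characteristic. -/
lemma exists_rootOfUnity (hw : IsLocalVal w) {x : AlgebraicClosure k} (hx : w x = 1) :
    ∃ (N : ℕ) (ζ : AlgebraicClosure k), w (N : AlgebraicClosure k) = 1 ∧ ζ ^ N = 1 ∧
      w (x - ζ) < 1 := by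
  have := hw.finite_residue
  set z := red w x
  have hz : IsIntegral (baseResidue w) z := isIntegral_red hw.map_gal hx.le
  let L := IntermediateField.adjoin (baseResidue w) {z}
  have : FiniteDimensional (baseResidue w) L := IntermediateField.adjoin.finiteDimensional hz
  have : Finite L := Module.finite_of_finite (baseResidue w)
  have := Fintype.ofFinite L
  -- The order of the root of unity will be `q - 1`, where `q` is the order of the finite field
  -- generated by the residue class of `x`. It is prime to the residue characteristic since `q = 0`
  -- there.
  set q := Fintype.card L
  have hq : 1 < q := Fintype.one_lt_card
  have hz0 : z ≠ 0 := fun h => ((red_eq_zero_iff hx.le).mp h).ne hx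
  have hpow : z ^ (q - 1) = 1 := by
    have hzL : (⟨z, IntermediateField.mem_adjoin_simple_self _ z⟩ : L) ≠ 0 :=
      fun h => hz0 (congrArg Subtype.val h)
    exact congrArg Subtype.val (FiniteField.pow_card_sub_one_eq_one _ hzL)
  have hN : w ((q - 1 : ℕ) : AlgebraicClosure k) = 1 := by
    refine le_antisymm (val_natCast_le_one w _) (not_lt.mp fun h => ?_)
    rw [← red_eq_zero_iff (val_natCast_le_one w _), red_natCast, Nat.cast_sub hq.le] at h
    have h2 : (q : IsLocalRing.ResidueField w.valuationSubring) = 0 := by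
      have := congrArg (algebraMap L (IsLocalRing.ResidueField w.valuationSubring))
        (Nat.cast_card_eq_zero L)
      rwa [map_natCast, map_zero] at this
    rw [h2] at h
    simp at h
  have hlt : w (x ^ (q - 1) - 1) < 1 := by
    rw [← red_eq_iff (by simp [hx]) (by simp), red_pow hx.le, hpow, red_one]
  have hN0 : q - 1 ≠ 0 := by omega
  have hsp := (IsAlgClosed.splits (Polynomial.X ^ (q - 1) - 1 : Polynomial (AlgebraicClosure k)))
  have hprod := congrArg (Polynomial.eval x) (hsp.eq_prod_roots_of_monic
    (Polynomial.monic_X_pow_sub_C 1 hN0))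
  rw [Polynomial.eval_multiset_prod, Multiset.map_map] at hprod
  simp only [Polynomial.eval_sub, Polynomial.eval_pow, Polynomial.eval_X, Polynomial.eval_one,
    Function.comp_def, Polynomial.eval_C] at hprod
  rw [hprod, map_multiset_prod, Multiset.map_map] at hlt
  -- The product of all `x - ζ` over the roots of unity is `x^(q-1) - 1`, of value less than `1`, so
  -- some factor has value less than `1`.
  by_contra! hcon
  refine hlt.not_ge ?_
  refine Multiset.one_le_prod_of_one_le (s := Multiset.map _ _) ?_
  intro y hy
  obtain ⟨ζ, hζ, rfl⟩ := Multiset.mem_map.mp hy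
  refine hcon (q - 1) ζ hN ?_
  have := (Polynomial.mem_roots'.mp hζ).2
  simpa [sub_eq_zero] using this

/-- The conjugates of `ζ` are `N`-th roots of unity, so they have distinct reductions, and these are
roots of the minimal polynomial of `red w ζ`. This is the inequality that makes `k(ζ)` unramified.
-/
lemma natDegree_minpoly_le (hw : IsLocalVal w) {ζ : AlgebraicClosure k} {N : ℕ}
    (hN : w (N : AlgebraicClosure k) = 1) (hζ : ζ ^ N = 1) [CharZero k] :
    (minpoly k ζ).natDegree ≤ (minpoly (baseResidue w) (red w ζ)).natDegree := by
  have hN0 : N ≠ 0 := by rintro rfl; simp at hN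
  have h1 : ∀ ξ : AlgebraicClosure k, ξ ^ N = 1 → w ξ = 1 := fun ξ h => val_eq_one_of_pow_eq_one hN0 h
  have hint : IsIntegral k ζ := Algebra.IsIntegral.isIntegral ζ
  classical
  have hcard : (minpoly k ζ).natDegree = ((minpoly k ζ).aroots (AlgebraicClosure k)).toFinset.card := by
    rw [Multiset.toFinset_card_of_nodup]
    · exact ((IsAlgClosed.splits ((minpoly k ζ).map _)).natDegree_eq_card_roots.symm.trans
        (Polynomial.natDegree_map _)).symm
    · exact Polynomial.nodup_roots (minpoly.irreducible hint).separable.map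
  have hz : IsIntegral (baseResidue w) (red w ζ) := isIntegral_red hw.map_gal (h1 ζ hζ).le
  have hconj : ∀ r ∈ ((minpoly k ζ).aroots (AlgebraicClosure k)).toFinset, ∃ σ : AbsGal k, σ ζ = r := by
    intro r hr
    exact minpoly.exists_algEquiv_of_root' (Algebra.IsAlgebraic.isAlgebraic ζ)
      (Polynomial.mem_aroots.mp (Multiset.mem_toFinset.mp hr)).2
  rw [hcard]
  refine (Finset.card_le_card_of_injOn (t := ((minpoly (baseResidue w) (red w ζ)).aroots
    (IsLocalRing.ResidueField w.valuationSubring)).toFinset) (red w) ?_ ?_).trans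
    ((Multiset.toFinset_card_le _).trans ((Polynomial.card_roots' _).trans Polynomial.natDegree_map_le))
  · intro r hr
    obtain ⟨σ, rfl⟩ := hconj r hr
    obtain ⟨f, hf⟩ := exists_residueMap hw.map_gal σ
    rw [Finset.mem_coe, Multiset.mem_toFinset, Polynomial.mem_aroots]
    refine ⟨minpoly.ne_zero hz, ?_⟩
    rw [← hf ζ (h1 ζ hζ).le, Polynomial.aeval_algHom_apply, minpoly.aeval, map_zero]
  · intro r hr r' hr' heq
    obtain ⟨σ, rfl⟩ := hconj r hr
    obtain ⟨τ, rfl⟩ := hconj r' hr'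
    have e1 : (σ ζ) ^ N = 1 := by rw [← map_pow, hζ, map_one]
    have e2 : (τ ζ) ^ N = 1 := by rw [← map_pow, hζ, map_one]
    exact eq_of_pow_eq_one hN e1 e2 ((red_eq_iff (h1 _ e1).le (h1 _ e2).le).mp heq)

/-- An element of `k(ζ)` has the value of an element of `k`. -/
lemma exists_val_eq_of_mem_adjoin (hw : IsLocalVal w) [CharZero k] {ζ : AlgebraicClosure k} {N : ℕ}
    (hN : w (N : AlgebraicClosure k) = 1) (hζ : ζ ^ N = 1) {x : AlgebraicClosure k}
    (hx : x ∈ IntermediateField.adjoin k {ζ}) : ∃ a : k, w x = w (algebraMap k _ a) := by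
  have hN0 : N ≠ 0 := by rintro rfl; simp at hN
  have h1 : w ζ = 1 := val_eq_one_of_pow_eq_one hN0 hζ
  have hint : IsIntegral k ζ := Algebra.IsIntegral.isIntegral ζ
  have hz : IsIntegral (baseResidue w) (red w ζ) := isIntegral_red hw.map_gal h1.le
  rcases eq_or_ne x 0 with rfl | hx0
  · exact ⟨0, by rw [map_zero, map_zero, map_zero]⟩
  rw [← IntermediateField.mem_toSubalgebra,
    IntermediateField.adjoin_simple_toSubalgebra_of_isAlgebraic hint.isAlgebraic, Algebra.adjoin_singleton_eq_range_aeval] at hx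
  obtain ⟨p, rfl⟩ := hx
  set r := p %ₘ minpoly k ζ
  have hr : Polynomial.aeval ζ p = Polynomial.aeval ζ r :=
    (Polynomial.aeval_modByMonic_eq_self_of_root (minpoly.aeval k ζ)).symm
  have hr0 : r ≠ 0 := by
    rintro h
    rw [h, map_zero] at hr
    exact hx0 hr
  have hdeg : r.natDegree < (minpoly k ζ).natDegree :=
    Polynomial.natDegree_modByMonic_lt _ (minpoly.monic hint) (minpoly.ne_one k ζ)
  -- A coefficient `b` of maximal value is factored out. The cofactor `y` has integral coefficients,
  -- the `j`-th being `1`, and it remains to see that `y` has value `1`.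
  obtain ⟨j, hj, hmax⟩ := Finset.exists_max_image r.support (fun i => w (algebraMap k _ (r.coeff i)))
    (Polynomial.support_nonempty.mpr hr0)
  set b := r.coeff j
  have hb : b ≠ 0 := Polynomial.mem_support_iff.mp hj
  have hbw : 0 < w (algebraMap k _ b) := by
    rw [w.pos_iff]; simpa using hb
  have hmax' : ∀ i, w (algebraMap k _ (r.coeff i / b)) ≤ 1 := by
    intro i
    rw [map_div₀, map_div₀, div_le_one₀ hbw]
    by_cases hi : i ∈ r.support
    · exact hmax i hi
    · rw [Polynomial.notMem_support_iff.mp hi]; simp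
  refine ⟨b, ?_⟩
  set d := (minpoly k ζ).natDegree
  set y := ∑ i ∈ Finset.range d, algebraMap k _ (r.coeff i / b) * ζ ^ i
  have hy1 : w y ≤ 1 := w.map_sum_le fun i _ => by
    rw [map_mul, map_pow, h1, one_pow, mul_one]
    exact hmax' i
  have hxy : Polynomial.aeval ζ p = algebraMap k _ b * y := by
    rw [hr, Polynomial.aeval_eq_sum_range' hdeg, Finset.mul_sum]
    refine Finset.sum_congr rfl fun i _ => ?_
    rw [← mul_assoc, ← map_mul, mul_div_cancel₀ _ hb, Algebra.smul_def]
  change w (Polynomial.aeval ζ p) = _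
  rw [hxy, map_mul]
  -- If `y` had value less than `1`, reduction would give a nonzero polynomial annihilating `red w
  -- ζ` of degree smaller than `natDegree_minpoly_le` permits.
  refine (mul_eq_left₀ hbw.ne').mpr (le_antisymm hy1 (not_lt.mp fun hlt => ?_))
  rw [← red_eq_zero_iff hy1, red_sum _ _ (fun i _ => by
    rw [map_mul, map_pow, h1, one_pow, mul_one]; exact hmax' i)] at hlt
  let c : ℕ → baseResidue w := fun i => ⟨red w (algebraMap k _ (r.coeff i / b)), _, hmax' i, rfl⟩
  let Q : Polynomial (baseResidue w) := ∑ i ∈ Finset.range d, Polynomial.monomial i (c i)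
  have hQ : Polynomial.aeval (red w ζ) Q = 0 := by
    rw [map_sum, ← hlt]
    refine Finset.sum_congr rfl fun i _ => ?_
    rw [Polynomial.aeval_monomial, red_mul (hmax' i) (by simp [h1]), red_pow h1.le]
    rfl
  have hQj : Q.coeff j = 1 := by
    have hjd : j < d := (Polynomial.le_natDegree_of_mem_supp _ hj).trans_lt hdeg
    simp only [Q, Polynomial.finsetSum_coeff, Polynomial.coeff_monomial, Finset.sum_ite_eq',
      Finset.mem_range, hjd, if_true]
    refine Subtype.ext ?_
    change red w (algebraMap k _ (b / b)) = 1
    rw [div_self hb, map_one, red_one]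
  have hQ0 : Q ≠ 0 := fun h => by simp [h] at hQj
  have hQdeg : Q.natDegree < d := by
    have : Q.degree < d := by
      refine (Polynomial.degree_lt_iff_coeff_zero _ _).mpr fun i hi => ?_
      simp only [Q, Polynomial.finsetSum_coeff, Polynomial.coeff_monomial, Finset.sum_ite_eq',
        Finset.mem_range, not_lt.mpr hi, if_false]
    exact (Polynomial.natDegree_lt_iff_degree_lt hQ0).mpr this
  exact (hQdeg.trans_le (natDegree_minpoly_le hw hN hζ)).not_ge
    (Polynomial.natDegree_le_of_dvd (minpoly.dvd _ _ hQ) hQ0)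

end Unramified

/-! ### The Galois group modulo inertia -/

section Frobenius

lemma mem_fixingSubgroup_adjoin_simple {k L : Type*} [Field k] [Field L] [Algebra k L]
    (x : L) (σ : L ≃ₐ[k] L) :
    σ ∈ (IntermediateField.adjoin k {x}).fixingSubgroup ↔ σ x = x := by
  refine ⟨fun h => h ⟨x, IntermediateField.mem_adjoin_simple_self k x⟩, fun h => ?_⟩
  have : IntermediateField.adjoin k {x} ≤ IntermediateField.fixedField (Subgroup.zpowers σ) := by
    rw [IntermediateField.adjoin_le_iff]
    rintro y rfl ⟨τ, hτ⟩
    have : Subgroup.zpowers σ ≤ MulAction.stabilizer _ y := by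
      rw [Subgroup.zpowers_le]; exact h
    exact this hτ
  rintro ⟨y, hy⟩
  exact this hy ⟨σ, Subgroup.mem_zpowers σ⟩

variable {k : Type u} [Field k] {w : Valuation (AlgebraicClosure k) ℝ≥0}

lemma isClopen_fix (x : AlgebraicClosure k) : IsClopen {σ : AbsGal k | σ x = x} := by
  have : {σ : AbsGal k | σ x = x} = (IntermediateField.adjoin k {x}).fixingSubgroup := by
    ext σ; exact (mem_fixingSubgroup_adjoin_simple x σ).symm
  have hf : FiniteDimensional k (IntermediateField.adjoin k {x}) :=
    IntermediateField.adjoin.finiteDimensional (Algebra.IsIntegral.isIntegral x)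
  rw [this]
  exact ⟨IntermediateField.fixingSubgroup_isClosed _, IntermediateField.fixingSubgroup_isOpen _⟩

/-- A witness `x` that is not a unit is replaced by the unit `1 + x`, for which `σ x - x` is
unchanged. -/
lemma exists_unit_of_notMem_inertiaSet {σ : AbsGal k} (h : σ ∉ inertiaSet w) :
    ∃ x, w x = 1 ∧ 1 ≤ w (σ x - x) := by
  simp only [inertiaSet, Set.mem_ofPred_eq, not_forall, not_lt] at h
  obtain ⟨x, hx, h1⟩ := h
  rcases eq_or_lt_of_le hx with hx | hx
  · exact ⟨x, hx, h1⟩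
  · refine ⟨1 + x, ?_, by simpa using h1⟩
    rw [w.map_add_eq_of_lt_left (by simpa using hx), map_one]

/-- An open subgroup containing inertia contains the Galois group of an extension generated by a
root of unity of order prime to the residue characteristic. -/
lemma exists_primitiveRoot_of_inertiaSet_subset [CharZero k] (hw : IsLocalVal w) (H : Subgroup (AbsGal k))
    (hH : IsOpen (H : Set (AbsGal k))) (hI : inertiaSet w ⊆ H) :
    ∃ (N : ℕ) (ζ : AlgebraicClosure k), w (N : AlgebraicClosure k) = 1 ∧ IsPrimitiveRoot ζ N ∧
      ∀ σ : AbsGal k, σ ζ = ζ → σ ∈ H := by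
  -- `U N` is the open set of automorphisms moving some `N`-th root of unity. These sets are
  -- directed under divisibility. They cover the complement of `H`: an automorphism outside inertia
  -- moves the residue class of some unit, hence a root of unity congruent to it. By compactness a
  -- single `N` suffices.
  let U : {N : ℕ // w (N : AlgebraicClosure k) = 1} → Set (AbsGal k) := fun N =>
    ⋃ ζ ∈ {ζ : AlgebraicClosure k | ζ ^ (N : ℕ) = 1}, {σ | σ ζ = ζ}ᶜ
  have hne : Nonempty {N : ℕ // w (N : AlgebraicClosure k) = 1} := ⟨⟨1, by simp⟩⟩
  obtain ⟨⟨N, hN⟩, hsub⟩ := (isClosed_compl_iff.mpr hH).isCompact.elim_directed_cover U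
    (fun N => isOpen_biUnion fun ζ _ => (isClopen_fix ζ).1.isOpen_compl) (by
      intro σ hσ
      obtain ⟨x, hx, h1⟩ := exists_unit_of_notMem_inertiaSet (w := w) (fun h => hσ (hI h))
      obtain ⟨N, ζ, hN, hζ, hlt⟩ := exists_rootOfUnity hw hx
      refine Set.mem_iUnion.mpr ⟨⟨N, hN⟩, Set.mem_biUnion hζ fun hfix => h1.not_gt ?_⟩
      have hfix : σ ζ = ζ := hfix
      have : σ x - x = σ (x - ζ) - (x - ζ) := by rw [map_sub, hfix]; ring
      rw [this]
      exact w.map_sub_lt ((hw.map_gal _ _).trans_lt hlt) hlt) (by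
      rintro ⟨N, hN⟩ ⟨M, hM⟩
      refine ⟨⟨N * M, by push_cast; rw [map_mul, hN, hM, one_mul]⟩, ?_, ?_⟩ <;>
      refine Set.biUnion_subset_biUnion_left fun ζ hζ => ?_
      · exact (pow_mul ζ N M).trans (by rw [show ζ ^ N = 1 from hζ, one_pow])
      · exact (pow_mul' ζ N M).trans (by rw [show ζ ^ M = 1 from hζ, one_pow]))
  have hN0 : N ≠ 0 := by rintro rfl; simp at hN
  have : NeZero (N : k) := ⟨by exact_mod_cast hN0⟩
  have : NeZero N := ⟨hN0⟩
  obtain ⟨ζ, hζ⟩ := HasEnoughRootsOfUnity.exists_primitiveRoot (AlgebraicClosure k) N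
  refine ⟨N, ζ, hN, hζ, fun σ hσ => ?_⟩
  by_contra hcon
  obtain ⟨ξ, hξ, hne⟩ := Set.mem_iUnion₂.mp (hsub hcon)
  obtain ⟨i, -, rfl⟩ := hζ.eq_pow_of_pow_eq_one hξ
  exact hne (show σ _ = _ by rw [map_pow, hσ])

/-- An element fixed by inertia has the value of an element of `k`. -/
lemma exists_val_eq_of_fixed [CharZero k] (hw : IsLocalVal w) {x : AlgebraicClosure k}
    (hx : ∀ σ ∈ inertiaSet w, σ x = x) : ∃ a : k, w x = w (algebraMap k _ a) := by
  have hf : FiniteDimensional k (IntermediateField.adjoin k {x}) :=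
    IntermediateField.adjoin.finiteDimensional (Algebra.IsIntegral.isIntegral x)
  obtain ⟨N, ζ, hN, hζ, h⟩ := exists_primitiveRoot_of_inertiaSet_subset hw
    (IntermediateField.adjoin k {x}).fixingSubgroup (IntermediateField.fixingSubgroup_isOpen _)
    (fun σ hσ => (mem_fixingSubgroup_adjoin_simple x σ).mpr (hx σ hσ))
  refine exists_val_eq_of_mem_adjoin hw hN hζ.pow_eq_one ?_
  rw [← InfiniteGalois.fixedField_fixingSubgroup (IntermediateField.adjoin k {ζ})]
  rintro ⟨σ, hσ⟩
  exact (mem_fixingSubgroup_adjoin_simple x σ).mp (h σ ((mem_fixingSubgroup_adjoin_simple ζ σ).mp hσ))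

lemma coprime_card_baseResidue (hw : IsLocalVal w) {N : ℕ} (hN : w (N : AlgebraicClosure k) = 1) :
    (Nat.card (baseResidue w)).Coprime N := by
  have := hw.finite_residue
  have := Fintype.ofFinite (baseResidue w)
  rw [Nat.card_eq_fintype_card]
  have h0 : (Fintype.card (baseResidue w) : IsLocalRing.ResidueField w.valuationSubring) = 0 := by
    have := congrArg (algebraMap (baseResidue w) (IsLocalRing.ResidueField w.valuationSubring))
      (Nat.cast_card_eq_zero (baseResidue w))
    rwa [map_natCast, map_zero] at this
  rw [← red_natCast w, red_eq_zero_iff (val_natCast_le_one w _)] at h0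
  set q := Fintype.card (baseResidue w)
  obtain ⟨p, hp⟩ := CharP.exists (baseResidue w)
  obtain ⟨n, hpp, hn⟩ := FiniteField.card (baseResidue w) p
  rw [show q = p ^ (n : ℕ) from hn] at h0 ⊢
  refine Nat.Coprime.pow_left _ ((Nat.Prime.coprime_iff_not_dvd hpp).mpr fun ⟨c, hc⟩ => ?_)
  rw [hc] at hN
  push_cast at hN h0
  rw [map_mul] at hN
  have h1 : w (p : AlgebraicClosure k) = 1 := le_antisymm (val_natCast_le_one w _)
    (not_lt.mp fun h => (mul_lt_one_of_lt_of_le h (val_natCast_le_one w c)).ne hN)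
  rw [map_pow, h1, one_pow] at h0
  exact h0.false

/-- On the finite residue extension generated by `ζ`, `σ` acts as a power of Frobenius, and `N`-th
roots of unity are determined by their residues. -/
lemma exists_gal_root_eq_pow (hw : IsLocalVal w) {N : ℕ} {ζ : AlgebraicClosure k}
    (hN : w (N : AlgebraicClosure k) = 1) (hζ : ζ ^ N = 1) (σ : AbsGal k) :
    ∃ i : ℕ, σ ζ = ζ ^ Nat.card (baseResidue w) ^ i := by
  have := hw.finite_residue
  have := Fintype.ofFinite (baseResidue w)
  have hN0 : N ≠ 0 := by rintro rfl; simp at hN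
  have h1 : w ζ = 1 := val_eq_one_of_pow_eq_one hN0 hζ
  have hz : IsIntegral (baseResidue w) (red w ζ) := isIntegral_red hw.map_gal h1.le
  let L := IntermediateField.adjoin (baseResidue w) {red w ζ}
  have : FiniteDimensional (baseResidue w) L := IntermediateField.adjoin.finiteDimensional hz
  have : Finite L := Module.finite_of_finite (baseResidue w)
  obtain ⟨f, hf⟩ := exists_residueMap hw.map_gal σ
  let g := f.restrictNormal' L
  obtain ⟨⟨i, hlt⟩, hi⟩ := (FiniteField.bijective_frobeniusAlgEquivOfAlgebraic_pow (baseResidue w) L).2 g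
  refine ⟨i, ?_⟩
  have hσ : (σ ζ) ^ N = 1 := by rw [← map_pow, hζ, map_one]
  refine eq_of_pow_eq_one hN hσ (by rw [← pow_mul, mul_comm, pow_mul, hζ, one_pow]) ?_
  have hle : w (σ ζ) ≤ 1 := (val_eq_one_of_pow_eq_one hN0 hσ).le
  rw [← red_eq_iff hle (by simp [h1]), red_pow h1.le, ← hf ζ h1.le]
  have hg := f.restrictNormal_commutes L ⟨red w ζ, IntermediateField.mem_adjoin_simple_self _ _⟩
  have hg2 := congrArg (fun e : L ≃ₐ[baseResidue w] L =>
    e ⟨red w ζ, IntermediateField.mem_adjoin_simple_self _ _⟩) hi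
  simp only [AlgEquiv.coe_pow, FiniteField.coe_frobeniusAlgEquivOfAlgebraic_iterate] at hg2
  have hg3 := congrArg (algebraMap L (IsLocalRing.ResidueField w.valuationSubring)) hg2
  rw [Nat.card_eq_fintype_card]
  exact (hg3.trans hg).symm

/-- Modulo an open subgroup containing inertia, the Galois group is cyclic. -/
lemma exists_generator_mod [CharZero k] (hw : IsLocalVal w) (H : Subgroup (AbsGal k))
    (hH : IsOpen (H : Set (AbsGal k))) (hI : inertiaSet w ⊆ H) :
    ∃ φ : AbsGal k, ∀ σ, ∃ n : ℤ, (φ ^ n)⁻¹ * σ ∈ H := by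
  obtain ⟨N, ζ, hN, hζ, h⟩ := exists_primitiveRoot_of_inertiaSet_subset hw H hH hI
  have hN0 : N ≠ 0 := by rintro rfl; simp at hN
  have : NeZero N := ⟨hN0⟩
  set q := Nat.card (baseResidue w)
  -- The cyclotomic character takes values in the cyclic group generated by `q`, so its image is
  -- cyclic; `φ` is chosen to generate the image. An element in the kernel of `χ` fixes `ζ` and thus
  -- lies in `H`.
  let χ : AbsGal k →* (ZMod N)ˣ := hζ.autToPow k
  let u : (ZMod N)ˣ := ZMod.unitOfCoprime q (coprime_card_baseResidue hw hN)
  have hχ : ∀ σ, χ σ ∈ Subgroup.zpowers u := by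
    intro σ
    obtain ⟨i, hi⟩ := exists_gal_root_eq_pow hw hN hζ.pow_eq_one σ
    refine ⟨i, Units.ext ?_⟩
    have h2 := hζ.autToPow_spec k σ
    rw [hi] at h2
    rw [(isOfFinOrder_iff_pow_eq_one.mpr ⟨N, Nat.pos_of_ne_zero hN0, hζ.pow_eq_one⟩).pow_eq_pow_iff_modEq,
      ← hζ.eq_orderOf, ← ZMod.natCast_eq_natCast_iff, ZMod.natCast_zmod_val] at h2
    rw [h2]
    simp [u, q]
  have hcyc : IsCyclic χ.range :=
    isCyclic_of_injective (Subgroup.inclusion (show χ.range ≤ Subgroup.zpowers u from by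
      rintro _ ⟨σ, rfl⟩; exact hχ σ)) (Subgroup.inclusion_injective _)
  obtain ⟨⟨_, φ, rfl⟩, hφ⟩ := hcyc.exists_generator
  refine ⟨φ, fun σ => ?_⟩
  obtain ⟨n, hn⟩ := hφ ⟨χ σ, σ, rfl⟩
  have hn : χ φ ^ n = χ σ := congrArg Subtype.val hn
  refine ⟨n, h _ ?_⟩
  have : χ ((φ ^ n)⁻¹ * σ) = 1 := by rw [map_mul, map_inv, map_zpow, hn, inv_mul_cancel]
  have h3 := hζ.autToPow_spec k ((φ ^ n)⁻¹ * σ)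
  rw [show hζ.autToPow k ((φ ^ n)⁻¹ * σ) = 1 from this, Units.val_one,
    ← pow_mod_orderOf, ← hζ.eq_orderOf] at h3
  rw [← h3]
  -- For `N = 1` the representative of `1` in `ZMod N` is `0`, not `1`.
  rcases eq_or_ne N 1 with rfl | hN1
  · rw [(IsPrimitiveRoot.one_right_iff).mp hζ, one_pow]
  · have : Fact (1 < N) := ⟨by omega⟩
    rw [ZMod.val_one, Nat.mod_eq_of_lt this.out, pow_one]

/-! ### Counting unramified cocycles -/

/-- Continuous crossed homomorphisms into a discrete module. -/
structure IsCocycle {G A : Type*} [Group G] [TopologicalSpace G] [AddCommGroup A]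
    (act : G →* AddMonoid.End A) (c : G → A) : Prop where
  map_mul : ∀ g h, c (g * h) = c g + act g (c h)
  isOpen_fiber : ∀ a, IsOpen {g | c g = a}

namespace IsCocycle

variable {G A : Type*} [Group G] [TopologicalSpace G] [AddCommGroup A]
    {act : G →* AddMonoid.End A} {c c' : G → A}

lemma map_one (hc : IsCocycle act c) : c 1 = 0 := by
  have := hc.map_mul 1 1
  rwa [mul_one, _root_.map_one, AddMonoid.End.coe_one, id, left_eq_add] at this

lemma map_inv (hc : IsCocycle act c) (g : G) : c g⁻¹ = -act g⁻¹ (c g) := by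
  have := hc.map_mul g⁻¹ g
  rw [inv_mul_cancel, hc.map_one] at this
  exact (neg_eq_of_add_eq_zero_left this.symm).symm

lemma map_zpow_eq (hc : IsCocycle act c) (hc' : IsCocycle act c') {g : G} (h : c g = c' g)
    (n : ℤ) : c (g ^ n) = c' (g ^ n) := by
  have hnat : ∀ n : ℕ, c (g ^ n) = c' (g ^ n) := by
    intro n
    induction n with
    | zero => rw [pow_zero, hc.map_one, hc'.map_one]
    | succ n ih => rw [pow_succ, hc.map_mul, hc'.map_mul, ih, h]
  obtain ⟨n, rfl | rfl⟩ := n.eq_nat_or_neg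
  · rw [zpow_natCast, hnat]
  · rw [zpow_neg, zpow_natCast, hc.map_inv, hc'.map_inv, hnat]

/-- The elements acting trivially at which a cocycle vanishes. -/
def ker (hc : IsCocycle act c) : Subgroup G where
  carrier := {g | c g = 0 ∧ act g = 1}
  mul_mem' := by
    rintro a b ⟨ha, ha'⟩ ⟨hb, hb'⟩
    exact ⟨by rw [hc.map_mul, ha, hb, map_zero, add_zero], by rw [_root_.map_mul, ha', hb', one_mul]⟩
  one_mem' := ⟨hc.map_one, _root_.map_one _⟩
  inv_mem' := by
    rintro a ⟨ha, ha'⟩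
    refine ⟨by rw [hc.map_inv, ha, map_zero, neg_zero], ?_⟩
    have := _root_.map_mul act a⁻¹ a
    rwa [inv_mul_cancel, _root_.map_one, ha', mul_one, eq_comm] at this

lemma map_mul_of_mem_ker (hc : IsCocycle act c) {h : G} (hh : h ∈ hc.ker) (g : G) :
    c (g * h) = c g := by
  rw [hc.map_mul, hh.1, map_zero, add_zero]

lemma isOpen_ker (hc : IsCocycle act c) (hact : IsOpen {g | act g = 1}) :
    IsOpen (hc.ker : Set G) :=
  (hc.isOpen_fiber 0).inter hact

end IsCocycle

/-- This allows counting arguments to treat finitely many cocycles or characters at a time, so that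
intersections of their open kernels stay open. -/
lemma finite_and_ncard_le_of_finset {α : Type*} {S : Set α} {n : ℕ}
    (h : ∀ T : Finset α, (T : Set α) ⊆ S → T.card ≤ n) : S.Finite ∧ S.ncard ≤ n := by
  have hf : S.Finite := by
    by_contra hinf
    obtain ⟨T, hT, hc⟩ := Set.Infinite.exists_subset_card_eq hinf (n + 1)
    have := h T hT
    omega
  refine ⟨hf, ?_⟩
  have := h hf.toFinset (by simp)
  rwa [← Set.ncard_eq_toFinset_card S hf] at this

/-- There are at most `#A` unramified cocycles with values in an unramified finite module `A`. -/
lemma ncard_unramified_le [CharZero k] (hw : IsLocalVal w) {A : Type*} [AddCommGroup A] [Finite A]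
    (act : AbsGal k →* AddMonoid.End A) (hopen : IsOpen {g | act g = 1})
    (hI : ∀ σ ∈ inertiaSet w, act σ = 1) :
    {c : AbsGal k → A | IsCocycle act c ∧ ∀ σ ∈ inertiaSet w, c σ = 0}.Finite ∧
    {c : AbsGal k → A | IsCocycle act c ∧ ∀ σ ∈ inertiaSet w, c σ = 0}.ncard ≤ Nat.card A := by
  refine finite_and_ncard_le_of_finset fun T hT => ?_
  -- `H` is open and contains inertia. Modulo `H` the group is generated by some `φ`, so each
  -- cocycle in `T` is determined by its value at `φ`.
  let H : Subgroup (AbsGal k) := ⨅ c : T, (hT c.2).1.ker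
  have hH : IsOpen (H : Set (AbsGal k)) := by
    rw [Subgroup.coe_iInf]
    exact isOpen_iInter_of_finite fun c => (hT c.2).1.isOpen_ker hopen
  obtain ⟨φ, hφ⟩ := exists_generator_mod hw H hH (by
    rw [Subgroup.coe_iInf]
    exact Set.subset_iInter fun c σ hσ => ⟨(hT c.2).2 σ hσ, hI σ hσ⟩)
  have := Fintype.ofFinite A
  rw [Nat.card_eq_fintype_card]
  refine Finset.card_le_card_of_injOn (t := Finset.univ) (fun c => c φ) (by simp) ?_
  intro c hc c' hc' heq
  funext σ
  obtain ⟨n, hn⟩ := hφ σ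
  have hmem := Subgroup.mem_iInf.mp hn
  have e1 := (hT hc).1.map_mul_of_mem_ker (hmem ⟨c, hc⟩) (φ ^ n)
  have e2 := (hT hc').1.map_mul_of_mem_ker (hmem ⟨c', hc'⟩) (φ ^ n)
  rw [mul_inv_cancel_left] at e1 e2
  rw [e1, e2]
  exact (hT hc).1.map_zpow_eq (hT hc').1 heq n

end Frobenius

/-! ### The completions of a number field as local fields -/

section LocalField

variable {K : Type u} [Field K] [NumberField K] (v : HeightOneSpectrum (𝓞 K))

lemma charZero_adicCompletion : CharZero (v.adicCompletion K) :=
  charZero_of_injective_algebraMap (algebraMap K (v.adicCompletion K)).injective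

attribute [local instance] charZero_adicCompletion

/-- Integers of `K` represent all the classes of `𝓞_v` modulo a nonzero integer of `K`. -/
lemma finite_quotient_adicCompletionIntegers (c : 𝓞 K) (hc : c ≠ 0) :
    Finite (v.adicCompletionIntegers K ⧸
      Ideal.span {algebraMap (𝓞 K) (v.adicCompletionIntegers K) c}) ∧
    Nat.card (v.adicCompletionIntegers K ⧸
      Ideal.span {algebraMap (𝓞 K) (v.adicCompletionIntegers K) c}) ≤
    Nat.card (𝓞 K ⧸ Ideal.span {c}) := by
  have hfin : Finite (𝓞 K ⧸ Ideal.span {c}) := Ideal.finiteQuotientOfFreeOfNeBot _ (by simpa using hc)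
  let f : (𝓞 K ⧸ Ideal.span {c}) →+* (v.adicCompletionIntegers K ⧸
      Ideal.span {algebraMap (𝓞 K) (v.adicCompletionIntegers K) c}) :=
    Ideal.quotientMap _ (algebraMap (𝓞 K) (v.adicCompletionIntegers K)) (by
      rw [Ideal.span_le, Set.singleton_subset_iff]
      exact Ideal.mem_span_singleton_self _)
  have hc0 : algebraMap K (v.adicCompletion K) (algebraMap (𝓞 K) K c) ≠ 0 := by
    simpa using hc
  have hsurj : Function.Surjective f := by
    intro y
    obtain ⟨y, rfl⟩ := Ideal.Quotient.mk_surjective y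
    obtain ⟨a, ha⟩ := exists_int_valued_sub_lt v y y.2 _ hc0
    refine ⟨Ideal.Quotient.mk _ a, ?_⟩
    rw [Ideal.quotientMap_mk, eq_comm, Ideal.Quotient.eq, Ideal.mem_span_singleton]
    have hle : Valued.v ((y - algebraMap K _ (algebraMap (𝓞 K) K a)) /
        algebraMap K (v.adicCompletion K) (algebraMap (𝓞 K) K c)) ≤ 1 := by
      rw [map_div₀]
      exact div_le_one_of_le₀ ha.le zero_le
    refine ⟨⟨_, hle⟩, Subtype.ext ?_⟩
    exact (mul_div_cancel₀ _ hc0).symm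
  exact ⟨Finite.of_surjective f hsurj, Nat.card_le_card_of_surjective f hsurj⟩

lemma card_quotient_natCast (m : ℕ) :
    Nat.card (𝓞 K ⧸ Ideal.span {(m : 𝓞 K)}) = m ^ Module.finrank ℚ K := by
  have h := Ideal.absNorm_span_singleton (m : 𝓞 K)
  rw [show ((m : ℕ) : 𝓞 K) = algebraMap ℤ (𝓞 K) m by simp, Algebra.norm_algebraMap,
    RingOfIntegers.rank, Int.natAbs_pow, Int.natAbs_natCast] at h
  rw [← h, Ideal.absNorm_apply, Submodule.cardQuot_apply]
  simp

lemma isLocalVal_extVal : IsLocalVal (extVal v) where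
  map_gal := extVal_map v
  exists_uniformizer := by
    obtain ⟨π, hπ⟩ := v.valuation_exists_uniformizer K
    have h0 : π ≠ 0 := by
      rintro rfl
      rw [map_zero] at hπ
      exact WithZero.exp_ne_zero hπ.symm
    refine ⟨algebraMap K _ π, by simpa using h0, ?_, fun x hx => ?_⟩
    · rw [extVal_lt_one_iff, valued_algebraMap, hπ, ← WithZero.exp_zero, WithZero.exp_lt_exp]
      simp
    · have hx' : Valued.v x ≠ 0 := by simpa using hx
      refine ⟨-(WithZero.log (Valued.v x)), ?_⟩
      rw [← map_zpow₀, ← map_zpow₀, extVal_eq_iff, map_zpow₀, valued_algebraMap, hπ,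
        ← WithZero.exp_zsmul]
      simp [WithZero.exp_log hx']
  finite_residue := by
    -- For a nonzero `c` in the prime `v`, the finite ring `𝓞_v / c` maps onto the residue field.
    obtain ⟨c, hc, hc0⟩ := Submodule.exists_mem_ne_zero_of_ne_bot v.ne_bot
    have := (finite_quotient_adicCompletionIntegers v c hc0).1
    have hlt : Valued.v (algebraMap K (v.adicCompletion K) (algebraMap (𝓞 K) K c)) < 1 := by
      rwa [valued_algebraMap, HeightOneSpectrum.valuation_lt_one_iff_mem]
    let g : v.adicCompletionIntegers K → baseResidue (extVal v) := fun y =>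
      ⟨_, _, (extVal_le_one_iff v y).mpr y.2, rfl⟩
    refine Finite.of_surjective (fun z : v.adicCompletionIntegers K ⧸
      Ideal.span {algebraMap (𝓞 K) (v.adicCompletionIntegers K) c} => g z.out) ?_
    rintro ⟨_, y, hy, rfl⟩
    have hy' := (extVal_le_one_iff v y).mp hy
    let y' : v.adicCompletionIntegers K := ⟨y, hy'⟩
    refine ⟨Ideal.Quotient.mk _ y', Subtype.ext ?_⟩
    have hout := Ideal.Quotient.mk_out (Ideal.Quotient.mk (Ideal.span
      {algebraMap (𝓞 K) (v.adicCompletionIntegers K) c}) y')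
    rw [Ideal.Quotient.eq, Ideal.mem_span_singleton] at hout
    obtain ⟨t, ht⟩ := hout
    refine (red_eq_iff ((extVal_le_one_iff v _).mpr (Quotient.out (Ideal.Quotient.mk _ y')).2) hy).mpr ?_
    rw [← map_sub, extVal_lt_one_iff]
    have := congrArg (fun z : v.adicCompletionIntegers K => Valued.v (z : v.adicCompletion K)) ht
    refine (this.trans (map_mul _ _ _)).trans_lt (mul_lt_one_of_lt_of_le hlt t.2)

end LocalField

/-! ### Power classes in finite extensions of a local field -/

section PowerClasses

variable {k : Type u} [Field k] [CharZero k] {w : Valuation (AlgebraicClosure k) ℝ≥0}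

lemma val_norm (hw : IsLocalVal w) (F : IntermediateField k (AlgebraicClosure k))
    [FiniteDimensional k F] (x : F) :
    w (algebraMap k _ (Algebra.norm k x)) = w x ^ Module.finrank k F := by
  rw [Algebra.norm_eq_prod_embeddings k (AlgebraicClosure k) x, map_prod]
  have : ∀ σ : F →ₐ[k] AlgebraicClosure k, w (σ x) = w x := by
    intro σ
    have h0 : Polynomial.aeval (σ x) (minpoly k (x : AlgebraicClosure k)) = 0 := by
      rw [← IntermediateField.algebraMap_apply, minpoly.algebraMap_eq (algebraMap F _).injective, Polynomial.aeval_algHom_apply, minpoly.aeval, map_zero]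
    obtain ⟨τ, hτ⟩ := minpoly.exists_algEquiv_of_root' (Algebra.IsAlgebraic.isAlgebraic _) h0
    rw [← hτ, hw.map_gal]
  rw [Finset.prod_congr rfl fun σ _ => this σ, Finset.prod_const, Finset.card_univ,
    AlgHom.card]

/-- The value group of a finite extension is cyclic. -/
lemma exists_uniformizer_finite (hw : IsLocalVal w) (F : IntermediateField k (AlgebraicClosure k))
    [FiniteDimensional k F] :
    ∃ ω : F, ω ≠ 0 ∧ ∀ x : F, x ≠ 0 → ∃ n : ℤ, w x = w ω ^ n := by
  obtain ⟨ϖ, h0, h1, h2⟩ := hw.exists_uniformizer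
  set d := Module.finrank k F
  have hd : d ≠ 0 := Module.finrank_pos.ne'
  -- By `val_norm`, `θ x = w(x)^d` is the value of the norm of `x`. So `θ` has image inside the
  -- cyclic value group of `k`, and `d`-th roots of values are unique.
  let θ : Fˣ →* (ℝ≥0)ˣ := (powMonoidHom d).comp (Units.map
    ((w : AlgebraicClosure k →* ℝ≥0).comp (algebraMap F (AlgebraicClosure k) : F →* AlgebraicClosure k)))
  have hϖ : w (algebraMap k _ ϖ) ≠ 0 := by simpa using h0
  let u : (ℝ≥0)ˣ := Units.mk0 _ hϖ
  have hθ : θ.range ≤ Subgroup.zpowers u := by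
    rintro _ ⟨x, rfl⟩
    obtain ⟨n, hn⟩ := h2 (Algebra.norm k (x : F)) (Algebra.norm_ne_zero_iff.mpr x.ne_zero)
    refine ⟨n, Units.ext ?_⟩
    rw [val_norm hw] at hn
    simpa [u, θ] using hn.symm
  have hcyc : IsCyclic θ.range :=
    isCyclic_of_injective (Subgroup.inclusion hθ) (Subgroup.inclusion_injective _)
  obtain ⟨⟨_, ω, rfl⟩, hω⟩ := hcyc.exists_generator
  refine ⟨ω, ω.ne_zero, fun x hx => ?_⟩
  obtain ⟨n, hn⟩ := hω ⟨θ (Units.mk0 x hx), _, rfl⟩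
  refine ⟨n, ?_⟩
  have h4 : θ ω ^ n = θ (Units.mk0 x hx) := congrArg Subtype.val hn
  have h5 := congrArg Units.val h4
  rw [Units.val_zpow_eq_zpow_val] at h5
  have h3 : (w ω ^ n) ^ d = w x ^ d := by
    rw [← zpow_natCast, zpow_comm, zpow_natCast]
    exact h5
  exact ((pow_left_inj₀ zero_le zero_le hd).mp h3).symm

omit [CharZero k] in
-- Since `∑ ζ^i = 0`, one has `m = -∑ (ζ^i - 1)`, and every summand is an integral multiple of `ζ -
-- 1`.
lemma val_natCast_le_val_sub_one {m : ℕ} {ζ : AlgebraicClosure k} (hζ : ζ ^ m = 1) (h1 : ζ ≠ 1) :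
    w (m : AlgebraicClosure k) ≤ w (ζ - 1) := by
  have hm : m ≠ 0 ∨ m = 0 := (em _).symm
  rcases hm with hm | rfl
  swap
  · simp
  have hw1 : w ζ = 1 := val_eq_one_of_pow_eq_one hm hζ
  have hsum : ∑ i ∈ Finset.range m, ζ ^ i = 0 := by
    have := geom_sum_mul ζ m
    rw [hζ, sub_self, mul_eq_zero, sub_eq_zero] at this
    exact this.resolve_right h1
  have hm' : (m : AlgebraicClosure k) = ∑ i ∈ Finset.range m, -(ζ ^ i - 1) := by
    rw [Finset.sum_neg_distrib, Finset.sum_sub_distrib, hsum]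
    simp
  rw [hm']
  refine w.map_sum_le fun i _ => ?_
  rw [Valuation.map_neg, ← geom_sum_mul, map_mul]
  exact mul_le_of_le_one_left' (w.map_sum_le fun j _ => by simp [hw1])

/-- Elements close to `1` are `m`-th powers. -/
lemma exists_pow_eq_of_close (hw : ∀ (σ : AbsGal k) x, w (σ x) = w x)
    (F : IntermediateField k (AlgebraicClosure k)) {m : ℕ} (hm : m ≠ 0) (u : F)
    (hu : w ((u : AlgebraicClosure k) - 1) < w (m : AlgebraicClosure k) ^ m) :
    ∃ y : F, y ^ m = u := by
  -- If all `m`-th roots of `u` were at distance at least `w m` from `1`, their product `1 - u`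
  -- would have value at least `w m ^ m`.
  have hroot : ∃ β : AlgebraicClosure k, β ^ m = u ∧ w (1 - β) < w (m : AlgebraicClosure k) := by
    by_contra! hcon
    have hsp := IsAlgClosed.splits (Polynomial.X ^ m - Polynomial.C (u : AlgebraicClosure k))
    have hprod := congrArg (Polynomial.eval 1) (hsp.eq_prod_roots_of_monic
      (Polynomial.monic_X_pow_sub_C _ hm))
    have hcard := hsp.natDegree_eq_card_roots
    rw [Polynomial.natDegree_X_pow_sub_C] at hcard
    rw [Polynomial.eval_multiset_prod, Multiset.map_map] at hprod
    simp only [Polynomial.eval_sub, Polynomial.eval_pow, Polynomial.eval_X, one_pow,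
      Function.comp_def, Polynomial.eval_C] at hprod
    rw [Valuation.map_sub_swap, hprod, map_multiset_prod, Multiset.map_map] at hu
    refine hu.not_ge ?_
    have h1 : ((Polynomial.X ^ m - Polynomial.C (u : AlgebraicClosure k)).roots.map
      fun _ => w (m : AlgebraicClosure k)).prod = w (m : AlgebraicClosure k) ^ m := by
      rw [Multiset.map_const', Multiset.prod_replicate, ← hcard]
    rw [← h1]
    refine Multiset.prod_map_le_prod_map₀ _ _ (fun _ _ => zero_le) fun β hβ => ?_
    have := (Polynomial.mem_roots'.mp hβ).2
    exact hcon β (by simpa [sub_eq_zero] using this)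
  obtain ⟨β, hβ, hlt⟩ := hroot
  have hm1 : w (m : AlgebraicClosure k) ≤ 1 := val_natCast_le_one w m
  have hβ1 : w β = 1 := by
    have := w.map_sub_eq_of_lt_left (x := 1) (y := 1 - β) (by simpa using hlt.trans_le hm1)
    simpa using this
  have hβ0 : β ≠ 0 := by rintro rfl; simp at hβ1
  -- This is Krasner's argument: a conjugate of `β` over `F` is again closer to `1` than `w m`,
  -- whereas distinct `m`-th roots of `u` are at distance at least `w m`.
  have hmem : β ∈ F := by
    rw [← InfiniteGalois.fixedField_fixingSubgroup F]
    rintro ⟨σ, hσ⟩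
    change σ β = β
    by_contra hne
    have hq : (σ β / β) ^ m = 1 := by
      rw [div_pow, ← map_pow, hβ, div_eq_one_iff_eq (by rw [← hβ]; exact pow_ne_zero _ hβ0)]
      exact hσ u
    have h2 := val_natCast_le_val_sub_one (w := w) hq (by rwa [Ne, div_eq_one_iff_eq hβ0])
    rw [div_sub_one hβ0, map_div₀, hβ1, div_one] at h2
    refine h2.not_gt ?_
    rw [← sub_sub_sub_cancel_left _ _ 1]
    refine w.map_sub_lt hlt ?_
    rw [← map_one σ, ← map_sub, hw]
    exact hlt
  exact ⟨⟨β, hmem⟩, Subtype.ext hβ⟩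

/-- The pigeonhole argument reducing power classes to classes of units. -/
lemma card_le_of_units (hw : IsLocalVal w) (F : IntermediateField k (AlgebraicClosure k))
    [FiniteDimensional k F] {m B : ℕ} (hm : m ≠ 0)
    (hU : ∀ T : Finset F, (∀ x ∈ T, w x = 1) →
      (∀ x ∈ T, ∀ y ∈ T, (∃ z : F, x = y * z ^ m) → x = y) → T.card ≤ B)
    (T : Finset F) (hT : ∀ x ∈ T, x ≠ 0)
    (hTm : ∀ x ∈ T, ∀ y ∈ T, (∃ z : F, x = y * z ^ m) → x = y) : T.card ≤ m * B := by
  classical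
  obtain ⟨ω, hω0, hω⟩ := exists_uniformizer_finite hw F
  have : NeZero m := ⟨hm⟩
  choose! n hn using hω
  by_contra! hlt
  -- The elements are sorted by their exponent modulo `m`; some residue class contains more than `B`
  -- of them.
  obtain ⟨r, -, hr⟩ := Finset.exists_lt_card_fiber_of_mul_lt_card_of_maps_to
    (s := T) (t := (Finset.univ : Finset (ZMod m))) (f := fun x => (n x : ZMod m)) (n := B)
    (by simp) (by simpa using hlt)
  obtain ⟨x₀, hx₀⟩ := Finset.card_pos.mp ((Nat.zero_le _).trans_lt hr)
  rw [Finset.mem_filter] at hx₀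
  have hω0' : w ω ≠ 0 := by simpa using hω0
  have hx0 := hT x₀ hx₀.1
  let e : F → ℤ := fun x => (n x - n x₀) / m
  have he : ∀ x ∈ T.filter (fun x => (n x : ZMod m) = r), n x = n x₀ + m * e x := by
    intro x hx
    rw [Finset.mem_filter] at hx
    have : (m : ℤ) ∣ n x - n x₀ := by
      rw [← ZMod.intCast_zmod_eq_zero_iff_dvd, Int.cast_sub, hx.2, hx₀.2, sub_self]
    simp only [e]
    rw [Int.mul_ediv_cancel' this]; ring
  -- Within one residue class, division by `x₀` and by an `m`-th power of the uniformizer produces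
  -- units and preserves inequality of power classes.
  let g : F → F := fun x => x / x₀ * (ω ^ (-e x)) ^ m
  have hg : ∀ x ∈ T.filter (fun x => (n x : ZMod m) = r), ∀ y ∈ T.filter (fun x => (n x : ZMod m) = r),
      (∃ z : F, g x = g y * z ^ m) → x = y := by
    rintro x hx y hy ⟨z, hz⟩
    refine hTm x (Finset.mem_filter.mp hx).1 y (Finset.mem_filter.mp hy).1
      ⟨ω ^ (- e y) * z * ω ^ (e x), ?_⟩
    simp only [g] at hz
    have h1 : x / x₀ = y / x₀ * (ω ^ (-e y)) ^ m * z ^ m * (ω ^ (e x)) ^ m := by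
      rw [← hz, mul_assoc, ← mul_pow, ← zpow_add₀ hω0, neg_add_cancel, zpow_zero, one_pow, mul_one]
    rw [div_eq_iff hx0] at h1
    conv_lhs => rw [h1]
    rw [mul_pow, mul_pow]
    field_simp
  refine hr.not_ge ?_
  have hinj : Set.InjOn g (T.filter (fun x => (n x : ZMod m) = r)) := fun x hx y hy h =>
    hg x hx y hy ⟨1, by rw [h]; simp⟩
  rw [← Finset.card_image_of_injOn hinj]
  refine hU _ ?_ ?_
  · intro y hy
    obtain ⟨x, hx, rfl⟩ := Finset.mem_image.mp hy
    have hxT := (Finset.mem_filter.mp hx).1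
    have h1 := hn x (hT x hxT)
    rw [he x hx, zpow_add₀ hω0', ← hn x₀ hx0] at h1
    have hcoe : w ((ω ^ (-e x) : F) : AlgebraicClosure k) = w ω ^ (-e x) :=
      (congrArg w (map_zpow₀ (algebraMap F (AlgebraicClosure k)) ω (-e x))).trans (map_zpow₀ w _ _)
    simp only [g]
    push_cast
    rw [map_mul, map_div₀, h1, map_pow, hcoe, mul_div_cancel_left₀ _ (by simpa using hx0),
      ← zpow_natCast, ← zpow_mul, ← zpow_add₀ hω0']
    ring_nf
    rw [zpow_zero]
  · intro x' hx' y' hy' h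
    obtain ⟨x, hx, rfl⟩ := Finset.mem_image.mp hx'
    obtain ⟨y, hy, rfl⟩ := Finset.mem_image.mp hy'
    rw [hg x hx y hy h]

/-- Units modulo `m`-th powers, when `m` is a unit. -/
lemma card_units_le_of_val_eq_one (hw : IsLocalVal w) (F : IntermediateField k (AlgebraicClosure k))
    {m : ℕ} (hm : w (m : AlgebraicClosure k) = 1)
    (T : Finset F) (hT : ∀ x ∈ T, w x = 1)
    (hTm : ∀ x ∈ T, ∀ y ∈ T, (∃ z : F, x = y * z ^ m) → x = y) : T.card ≤ m := by
  classical
  have hm0 : m ≠ 0 := by rintro rfl; simp at hm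
  let U : Subgroup Fˣ :=
    { carrier := {x | w (x : F) = 1}
      mul_mem' := fun {a b} ha hb => by
        change w ((a * b : F) : AlgebraicClosure k) = 1
        push_cast
        rw [map_mul, show w (a : F) = 1 from ha, show w (b : F) = 1 from hb, one_mul]
      one_mem' := by simp
      inv_mem' := fun {a} ha => by
        change w ((a⁻¹ : Fˣ) : F) = 1
        rw [Units.val_inv_eq_inv_val]
        push_cast
        rw [map_inv₀, show w (a : F) = 1 from ha, inv_one] }
  have hU : ∀ x : U, w ((x : Fˣ) : F) = 1 := fun x => x.2
  let ρ : U →* (IsLocalRing.ResidueField w.valuationSubring)ˣ := MonoidHom.toHomUnits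
    { toFun := fun x => red w ((x : Fˣ) : F)
      map_one' := red_one w
      map_mul' := fun a b => red_mul (hU a).le (hU b).le }
  have hρ : ∀ x, (ρ x : IsLocalRing.ResidueField w.valuationSubring) = red w ((x : Fˣ) : F) :=
    fun _ => rfl
  have hcong : ∀ x y : U, ρ x = ρ y → ∃ z : F, ((x : Fˣ) : F) = (y : Fˣ) * z ^ m := by
    intro x y h
    have h1 := congrArg Units.val h
    rw [hρ, hρ, red_eq_iff (hU x).le (hU y).le] at h1
    obtain ⟨z, hz⟩ := exists_pow_eq_of_close hw.map_gal F hm0 (((x : Fˣ) : F) / (y : Fˣ)) (by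
      rw [hm, one_pow]
      push_cast
      have hy0 : (((y : Fˣ) : F) : AlgebraicClosure k) ≠ 0 := by simp
      rw [div_sub_one hy0, map_div₀, hU y, div_one]
      exact h1)
    exact ⟨z, by rw [hz, mul_div_cancel₀ _ (Units.ne_zero _)]⟩
  have hT0 : ∀ x ∈ T, x ≠ 0 := by
    rintro x hx rfl
    have := hT 0 hx
    simp at this
  let τ : F → U := fun x => if h : w (x : AlgebraicClosure k) = 1 then
    ⟨Units.mk0 x (by rintro rfl; simp at h), h⟩ else 1
  have hτ : ∀ x ∈ T, ((τ x : Fˣ) : F) = x := by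
    intro x hx
    simp only [τ, hT x hx, dif_pos]
    rfl
  have hfin : ∀ x : U, IsOfFinOrder (ρ x) := by
    intro x
    obtain ⟨N, ζ, hN, hζ, hlt⟩ := exists_rootOfUnity hw (hU x)
    have hN0 : N ≠ 0 := by rintro rfl; simp at hN
    refine isOfFinOrder_iff_pow_eq_one.mpr ⟨N, Nat.pos_of_ne_zero hN0, Units.ext ?_⟩
    have h1 := val_eq_one_of_pow_eq_one (w := w) hN0 hζ
    rw [Units.val_pow_eq_pow_val, hρ, (red_eq_iff (hU x).le h1.le).mpr hlt, ← red_pow h1.le, hζ,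
      red_one, Units.val_one]
  -- The image `D` of `C` in the residue field is finitely generated and torsion, hence finite, and
  -- therefore cyclic. Among more than `m` elements two have exponents congruent modulo `m`; units
  -- with equal residues differ by an `m`-th power because `m` is a unit.
  let C : Subgroup U := Subgroup.closure (T.image τ)
  let D : Subgroup (IsLocalRing.ResidueField w.valuationSubring)ˣ := C.map ρ
  have hDfin : Finite D := by
    have hfg : Group.FG D := by
      rw [Group.fg_iff_subgroup_fg]
      exact ⟨(T.image τ).image ρ, by rw [Finset.coe_image, ← MonoidHom.map_closure]⟩
    refine CommGroup.finite_of_fg_isMulTorsion D ?_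
    rintro ⟨_, x, hx, rfl⟩
    exact (Submonoid.isOfFinOrder_coe (x := (⟨ρ x, x, hx, rfl⟩ : D.toSubmonoid))).mp (hfin x)
  have hcyc : IsCyclic D := inferInstance
  obtain ⟨⟨_, g, hg, rfl⟩, hgen⟩ := hcyc.exists_generator
  by_contra! hlt
  have : NeZero m := ⟨hm0⟩
  have hexp : ∀ x ∈ T, ∃ n : ℤ, ρ g ^ n = ρ (τ x) := by
    intro x hx
    obtain ⟨n, hn⟩ := hgen ⟨ρ (τ x), τ x, Subgroup.subset_closure (Finset.mem_coe.mpr (Finset.mem_image_of_mem τ hx)), rfl⟩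
    exact ⟨n, congrArg Subtype.val hn⟩
  choose! n hn using hexp
  obtain ⟨x, hx, y, hy, hne, heq⟩ := Finset.exists_ne_map_eq_of_card_lt_of_maps_to
    (s := T) (t := (Finset.univ : Finset (ZMod m))) (f := fun x => (n x : ZMod m))
    (by simpa using hlt) (by simp)
  refine hne (hTm x hx y hy ?_)
  have hdvd : (m : ℤ) ∣ n x - n y := by
    rw [← ZMod.intCast_zmod_eq_zero_iff_dvd, Int.cast_sub, heq, sub_self]
  obtain ⟨e, he⟩ := hdvd
  obtain ⟨z, hz⟩ := hcong (τ x) (τ y * (g ^ e) ^ m) (by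
    rw [map_mul, map_pow, map_zpow, ← hn x hx, ← hn y hy, ← zpow_natCast, ← zpow_mul, ← zpow_add]
    congr 1
    linarith)
  rw [hτ x hx] at hz
  refine ⟨((g ^ e : U) : Fˣ) * z, ?_⟩
  rw [hz]
  push_cast
  rw [hτ y hy]
  ring

end PowerClasses

/-! ### A bound for power classes uniform in the place -/

section PowerClassBound

/-- Coordinates of integral elements modulo `c`. -/
lemma exists_coordinates {R k L : Type*} [CommRing R] [IsDomain R] [IsPrincipalIdealRing R] [Field k]
    [Algebra R k] [IsFractionRing R k] [Field L] [Algebra k L] [Algebra R L] [IsScalarTower R k L]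
    [FiniteDimensional k L] [Algebra.IsSeparable k L] (c : R) :
    ∃ f : L → (Fin (Module.finrank k L) → R ⧸ Ideal.span {c}), ∀ x y, IsIntegral R x →
      IsIntegral R y → f x = f y → ∃ z, IsIntegral R z ∧ x - y = algebraMap R L c * z := by
  classical
  have htf : Module.IsTorsionFree R L := by
    have : FaithfulSMul R L := by
      rw [faithfulSMul_iff_algebraMap_injective, IsScalarTower.algebraMap_eq R k L]
      exact (algebraMap k L).injective.comp (IsFractionRing.injective R k)
    infer_instance
  have hfree : Module.Free R (integralClosure R L) :=
    IsIntegralClosure.module_free R k L (integralClosure R L)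
  have hnoeth : IsNoetherian R (integralClosure R L) :=
    IsIntegralClosure.isNoetherian R k L (integralClosure R L)
  let b := Module.finBasisOfFinrankEq R (integralClosure R L)
    (IsIntegralClosure.rank R k L (integralClosure R L))
  refine ⟨fun x => if h : IsIntegral R x then
    fun i => Ideal.Quotient.mk _ (b.repr ⟨x, h⟩ i) else 0, fun x y hx hy h => ?_⟩
  simp only [dif_pos hx, dif_pos hy, funext_iff] at h
  simp only [Ideal.Quotient.eq, Ideal.mem_span_singleton] at h
  choose r hr using h
  obtain ⟨X, hX⟩ : ∃ X : integralClosure R L, X = ⟨x, hx⟩ := ⟨_, rfl⟩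
  obtain ⟨Y, hY⟩ : ∃ Y : integralClosure R L, Y = ⟨y, hy⟩ := ⟨_, rfl⟩
  rw [← hX, ← hY] at hr
  have hxy : X - Y = c • ∑ i, r i • b i := by
    conv_lhs => rw [← b.sum_repr X, ← b.sum_repr Y]
    rw [← Finset.sum_sub_distrib, Finset.smul_sum]
    refine Finset.sum_congr rfl fun i _ => ?_
    rw [← sub_smul, hr, mul_smul]
  refine ⟨_, (∑ i, r i • b i : integralClosure R L).2, ?_⟩
  have := congrArg Subtype.val hxy
  rw [hX, hY] at this
  rw [Subalgebra.coe_smul, Algebra.smul_def] at this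
  exact this

variable {K : Type u} [Field K] [NumberField K] (v : HeightOneSpectrum (𝓞 K))

attribute [local instance] charZero_adicCompletion

/-- Units modulo `m`-th powers, when `m` is not a unit. -/
lemma card_units_le_of_val_lt_one
    (F : IntermediateField (v.adicCompletion K) (AlgebraicClosure (v.adicCompletion K)))
    [FiniteDimensional (v.adicCompletion K) F] {m : ℕ} (hm0 : m ≠ 0)
    (hm : extVal v (m : AlgebraicClosure (v.adicCompletion K)) < 1)
    (T : Finset F) (hT : ∀ x ∈ T, extVal v x = 1)
    (hTm : ∀ x ∈ T, ∀ y ∈ T, (∃ z : F, x = y * z ^ m) → x = y) :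
    T.card ≤ ((m ^ (m + 1)) ^ Module.finrank ℚ K) ^ Module.finrank (v.adicCompletion K) F := by
  classical
  obtain ⟨hfin, hcard⟩ := finite_quotient_adicCompletionIntegers v ((m ^ (m + 1) : ℕ) : 𝓞 K)
    (by exact_mod_cast pow_ne_zero _ hm0)
  rw [card_quotient_natCast, map_natCast] at hcard
  rw [map_natCast] at hfin
  have hint : ∀ x : F, extVal v x ≤ 1 ↔ IsIntegral (v.adicCompletionIntegers K) x := by
    intro x
    have : IsScalarTower (v.adicCompletionIntegers K) F (AlgebraicClosure (v.adicCompletion K)) :=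
      IsScalarTower.of_algebraMap_eq fun _ => rfl
    rw [extVal_le_one_iff_isIntegral]
    exact isIntegral_algebraMap_iff (A := F) (algebraMap F (AlgebraicClosure (v.adicCompletion K))).injective
  -- The modulus is `m^(m+1)` rather than `m^m`: as `m` has value less than `1`, the extra factor
  -- gives the strict inequality required by `exists_pow_eq_of_close`.
  obtain ⟨f, hf⟩ := exists_coordinates (R := v.adicCompletionIntegers K) (k := v.adicCompletion K)
    (L := F) ((m ^ (m + 1) : ℕ) : v.adicCompletionIntegers K)
  have hf : ∀ x ∈ T, ∀ y ∈ T, f x = f y → x = y := by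
    intro x hx y hy h
    refine hTm x hx y hy ?_
    obtain ⟨z, hz, hxy⟩ := hf x y ((hint x).mp (hT x hx).le) ((hint y).mp (hT y hy).le) h
    have hxy' : (x : AlgebraicClosure (v.adicCompletion K)) - y =
        ((m : AlgebraicClosure (v.adicCompletion K)) ^ (m + 1)) * z := by
      have := congrArg (algebraMap F (AlgebraicClosure (v.adicCompletion K))) hxy
      rw [map_sub, map_mul, map_natCast, map_natCast] at this
      push_cast at this
      exact this
    have hy0 : y ≠ 0 := by
      rintro rfl
      have := hT 0 hy
      simp at this
    have hy0' : (y : AlgebraicClosure (v.adicCompletion K)) ≠ 0 := by simpa using hy0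
    have hmw : extVal v (m : AlgebraicClosure (v.adicCompletion K)) ≠ 0 := by
      simpa using hm0
    obtain ⟨z, hz⟩ := exists_pow_eq_of_close (extVal_map v) F hm0 (x / y) (by
      push_cast
      rw [div_sub_one hy0', map_div₀, hT y hy, div_one, hxy', map_mul, map_pow, pow_succ, mul_assoc]
      refine mul_lt_of_lt_one_right (pow_pos (pos_of_ne_zero hmw) _) ?_
      exact mul_lt_one_of_lt_of_le hm ((hint _).mpr hz))
    exact ⟨z, by rw [hz, mul_div_cancel₀ _ hy0]⟩
  have := Fintype.ofFinite (v.adicCompletionIntegers K ⧸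
    Ideal.span {((m ^ (m + 1) : ℕ) : v.adicCompletionIntegers K)})
  refine (Finset.card_le_card_of_injOn (t := Finset.univ) f (by simp) hf).trans ?_
  rw [Finset.card_univ, Fintype.card_fun, Fintype.card_fin, ← Nat.card_eq_fintype_card]
  exact Nat.pow_le_pow_left hcard _

/-- The number of `m`-th power classes of a finite extension of `K_v` is bounded. -/
lemma card_powerClasses_le
    (F : IntermediateField (v.adicCompletion K) (AlgebraicClosure (v.adicCompletion K)))
    [FiniteDimensional (v.adicCompletion K) F] {m : ℕ} (hm0 : m ≠ 0)
    (T : Finset F) (hT : ∀ x ∈ T, x ≠ 0)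
    (hTm : ∀ x ∈ T, ∀ y ∈ T, (∃ z : F, x = y * z ^ m) → x = y) :
    T.card ≤ m * (m * ((m ^ (m + 1)) ^ Module.finrank ℚ K) ^ Module.finrank (v.adicCompletion K) F) := by
  refine card_le_of_units (isLocalVal_extVal v) F hm0 (fun T hT hTm => ?_) T hT hTm
  have h1 : 1 ≤ m := Nat.pos_of_ne_zero hm0
  rcases (val_natCast_le_one (extVal v) m).lt_or_eq with h | h
  · exact (card_units_le_of_val_lt_one v F hm0 h T hT hTm).trans (Nat.le_mul_of_pos_left _ h1)
  · exact (card_units_le_of_val_eq_one (isLocalVal_extVal v) F h T hT hTm).trans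
      (Nat.le_mul_of_pos_right _ (by positivity))

end PowerClassBound

/-! ### Kummer theory -/

section Kummer

variable {k : Type u} [Field k] [CharZero k]

/-- This is Hilbert 90 by a Lagrange resolvent. Over the fixed field of `ker χ`, the sum of `χ(q)⁻¹
q(x)` over the classes `q` of `N / ker χ` is an eigenvector, and it is nonzero for some `x` by
linear independence of distinct embeddings. -/
lemma exists_eigenvector (N : Subgroup (AbsGal k)) (χ : N →* (AlgebraicClosure k)ˣ)
    (hopen : IsOpen ((χ.ker.map N.subtype : Subgroup (AbsGal k)) : Set (AbsGal k)))
    (hfix : ∀ σ τ : N, (σ : AbsGal k) (χ τ) = χ τ) :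
    ∃ β : AlgebraicClosure k, β ≠ 0 ∧ ∀ σ : N, (σ : AbsGal k) β = χ σ * β := by
  classical
  let M : Subgroup (AbsGal k) := χ.ker.map N.subtype
  have hker : M.subgroupOf N = χ.ker :=
    Subgroup.comap_map_eq_self_of_injective N.subtype_injective _
  let E : IntermediateField k (AlgebraicClosure k) := IntermediateField.fixedField M
  have hE : E.fixingSubgroup = M :=
    InfiniteGalois.fixingSubgroup_fixedField ⟨M, M.isClosed_of_isOpen hopen⟩
  have hfinG : Finite (AbsGal k ⧸ M) := Subgroup.quotient_finite_of_isOpen M hopen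
  have : M.FiniteIndex := Subgroup.finiteIndex_of_finite_quotient
  have hfi : χ.ker.FiniteIndex := by
    rw [← hker]; infer_instance
  have : Fintype (N ⧸ χ.ker) := Fintype.ofFinite _
  let s : N ⧸ χ.ker → (E →* AlgebraicClosure k) := fun q =>
    (((q.out : N) : AbsGal k) : AlgebraicClosure k →* AlgebraicClosure k).comp
      (algebraMap E (AlgebraicClosure k) : E →* AlgebraicClosure k)
  have hs : ∀ q (x : E), s q x = ((q.out : N) : AbsGal k) x := fun _ _ => rfl
  have hsM : ∀ σ τ : N, QuotientGroup.mk (s := χ.ker) σ = QuotientGroup.mk τ →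
      ∀ x : E, (σ : AbsGal k) x = (τ : AbsGal k) x := by
    intro σ τ h x
    rw [QuotientGroup.eq] at h
    have hmem : ((σ⁻¹ * τ : N) : AbsGal k) ∈ M := ⟨_, h, rfl⟩
    rw [← hE] at hmem
    have h2 := hmem x
    have h3 := congrArg (σ : AbsGal k) h2
    rw [← h3]
    exact AlgEquiv.apply_symm_apply (σ : AbsGal k) _
  have hinj : Function.Injective s := by
    intro q q' h
    rw [← QuotientGroup.out_eq' q, ← QuotientGroup.out_eq' q', QuotientGroup.eq]
    have hmem : ((q.out⁻¹ * q'.out : N) : AbsGal k) ∈ E.fixingSubgroup := by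
      intro x
      have := DFunLike.congr_fun h x
      rw [hs, hs] at this
      change ((q.out : N) : AbsGal k)⁻¹ (((q'.out : N) : AbsGal k) x) = x
      rw [← this]
      exact AlgEquiv.symm_apply_apply _ _
    rw [hE] at hmem
    exact hker.le hmem
  let c : N ⧸ χ.ker → AlgebraicClosure k := fun q => ((χ q.out)⁻¹ : (AlgebraicClosure k)ˣ)
  have hli := (linearIndependent_monoidHom E (AlgebraicClosure k)).comp s hinj
  obtain ⟨x, hx⟩ : ∃ x : E, ∑ q, c q * s q x ≠ 0 := by
    by_contra! hcon
    have := Fintype.linearIndependent_iff.mp hli c (by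
      funext x
      simpa using hcon x) (QuotientGroup.mk 1)
    exact (Units.ne_zero _) this
  refine ⟨_, hx, fun τ => ?_⟩
  rw [map_sum, Finset.mul_sum]
  refine Fintype.sum_equiv (MulAction.toPerm τ) _ _ fun q => ?_
  have hq : (QuotientGroup.mk (s := χ.ker) (τ * q.out)) = QuotientGroup.mk (τ • q).out := by
    rw [QuotientGroup.out_eq']
    conv_rhs => rw [← QuotientGroup.out_eq' q]
    rfl
  rw [map_mul, MulAction.toPerm_apply, hs, hs, ← hsM _ _ hq x]
  have hc : χ (τ • q).out = χ τ * χ q.out := by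
    rw [← map_mul]
    have := QuotientGroup.eq.mp hq
    rw [MonoidHom.mem_ker, map_mul, map_inv, inv_mul_eq_one] at this
    exact this.symm
  have h1 : (τ : AbsGal k) (c q) = c q := by
    simp only [c]
    rw [← map_inv]
    exact hfix τ (q.out)⁻¹
  have h2 : c q = χ τ * c (τ • q) := by
    simp only [c]
    rw [hc, mul_inv, Units.val_mul, ← mul_assoc, ← Units.val_mul, mul_inv_cancel, Units.val_one, one_mul]
  rw [h1, h2, mul_assoc]
  rfl

/-- A set of characters of order dividing `m` of a subgroup fixing the `m`-th roots of unity is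
bounded by the number of `m`-th power classes of its fixed field that occur. -/
lemma ncard_characters_le {m B : ℕ} (hm : m ≠ 0) (N : Subgroup (AbsGal k))
    (hμ : ∀ σ ∈ N, ∀ ζ : AlgebraicClosure k, ζ ^ m = 1 → σ ζ = ζ)
    (S : Set (N →* (AlgebraicClosure k)ˣ))
    (hS : ∀ χ ∈ S, (∀ σ, χ σ ^ m = 1) ∧
      IsOpen ((χ.ker.map N.subtype : Subgroup (AbsGal k)) : Set (AbsGal k)))
    (p : AlgebraicClosure k → Prop)
    (hp : ∀ χ ∈ S, ∀ β : AlgebraicClosure k, β ≠ 0 → (∀ σ : N, (σ : AbsGal k) β = χ σ * β) → p β)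
    (hB : ∀ T : Finset (IntermediateField.fixedField N : IntermediateField k (AlgebraicClosure k)),
      (∀ x ∈ T, x ≠ 0) → (∀ x ∈ T, ∃ β, p β ∧ (x : AlgebraicClosure k) = β ^ m) →
      (∀ x ∈ T, ∀ y ∈ T, (∃ z, x = y * z ^ m) → x = y) → T.card ≤ B) :
    S.Finite ∧ S.ncard ≤ B := by
  classical
  refine finite_and_ncard_le_of_finset fun T hT => ?_
  have hval : ∀ χ ∈ T, ∀ τ, ((χ τ : (AlgebraicClosure k)ˣ) : AlgebraicClosure k) ^ m = 1 := by
    intro χ hχ τ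
    rw [← Units.val_pow_eq_pow_val, (hS χ (hT hχ)).1, Units.val_one]
  have hβ : ∀ χ ∈ T, ∃ β : AlgebraicClosure k, β ≠ 0 ∧ ∀ σ : N, (σ : AbsGal k) β = χ σ * β :=
    fun χ hχ => exists_eigenvector N χ (hS χ (hT hχ)).2 fun σ τ => hμ σ σ.2 _ (hval χ hχ τ)
  choose! β hβ0 hβ using hβ
  have hb : ∀ χ ∈ T, β χ ^ m ∈ (IntermediateField.fixedField N :
      IntermediateField k (AlgebraicClosure k)) := by
    rintro χ hχ ⟨σ, hσ⟩
    change σ (β χ ^ m) = _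
    rw [map_pow, hβ χ hχ ⟨σ, hσ⟩, mul_pow, hval χ hχ, one_mul]
  let f : (N →* (AlgebraicClosure k)ˣ) →
      (IntermediateField.fixedField N : IntermediateField k (AlgebraicClosure k)) := fun χ =>
    if h : χ ∈ T then ⟨β χ ^ m, hb χ h⟩ else 0
  have hf : ∀ χ ∈ T, (f χ : AlgebraicClosure k) = β χ ^ m := by
    intro χ hχ
    simp only [f, dif_pos hχ]
  -- If the `m`-th powers of two eigenvectors define the same class, then `β χ / (β χ' z)` is an
  -- `m`-th root of unity. It is fixed by `N`, which forces `χ = χ'`.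
  have hinj : ∀ χ ∈ T, ∀ χ' ∈ T, (∃ z, f χ = f χ' * z ^ m) → χ = χ' := by
    rintro χ hχ χ' hχ' ⟨z, hz⟩
    have hz' : β χ ^ m = (β χ' * z) ^ m := by
      rw [← hf χ hχ, hz, mul_pow, ← hf χ' hχ']
      rfl
    have hz0 : β χ' * z ≠ 0 := by
      intro h
      rw [h, zero_pow hm] at hz'
      exact hβ0 χ hχ (pow_eq_zero_iff hm |>.mp hz')
    ext σ
    have h1 := hμ σ σ.2 (β χ / (β χ' * z)) (by rw [div_pow, hz', div_self (pow_ne_zero _ hz0)])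
    have hσz : (σ : AbsGal k) (z : AlgebraicClosure k) = z := z.2 ⟨σ, σ.2⟩
    rw [map_div₀, map_mul, hβ χ hχ, hβ χ' hχ', hσz] at h1
    have h2 : β χ ≠ 0 := hβ0 χ hχ
    have h3 : β χ' ≠ 0 := hβ0 χ' hχ'
    have h4 : (z : AlgebraicClosure k) ≠ 0 := right_ne_zero_of_mul hz0
    have h5 := (χ' σ).ne_zero
    field_simp at h1
    exact h1
  have hinj' : Set.InjOn f T := fun χ hχ χ' hχ' h => hinj χ hχ χ' hχ' ⟨1, by rw [h]; simp⟩
  rw [← Finset.card_image_of_injOn hinj']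
  refine hB _ ?_ ?_ ?_
  · intro x hx
    obtain ⟨χ, hχ, rfl⟩ := Finset.mem_image.mp hx
    intro h
    have := hf χ hχ
    rw [h] at this
    exact pow_ne_zero m (hβ0 χ hχ) this.symm
  · intro x hx
    obtain ⟨χ, hχ, rfl⟩ := Finset.mem_image.mp hx
    exact ⟨_, hp χ (hT hχ) _ (hβ0 χ hχ) (hβ χ hχ), hf χ hχ⟩
  · intro x' hx' y' hy' h
    obtain ⟨χ, hχ, rfl⟩ := Finset.mem_image.mp hx'
    obtain ⟨χ', hχ', rfl⟩ := Finset.mem_image.mp hy'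
    rw [hinj χ hχ χ' hχ' h]

end Kummer

/-! ### Counting cocycles -/

section CocycleBound

variable {k : Type u} [Field k] {A : Type*} [AddCommGroup A]

/-- The subgroup of elements acting trivially on `A` and on the `m`-th roots of unity. -/
def kummerSubgroup (act : AbsGal k →* AddMonoid.End A) (m : ℕ) : Subgroup (AbsGal k) where
  carrier := {g | act g = 1 ∧ ∀ ζ : AlgebraicClosure k, ζ ^ m = 1 → g ζ = ζ}
  mul_mem' := by
    rintro a b ⟨ha, ha'⟩ ⟨hb, hb'⟩
    refine ⟨by rw [map_mul, ha, hb, one_mul], fun ζ hζ => ?_⟩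
    change a (b ζ) = ζ
    rw [hb' ζ hζ, ha' ζ hζ]
  one_mem' := ⟨map_one _, fun _ _ => rfl⟩
  inv_mem' := by
    rintro a ⟨ha, ha'⟩
    refine ⟨?_, fun ζ hζ => ?_⟩
    · have := map_mul act a⁻¹ a
      rwa [inv_mul_cancel, map_one, ha, mul_one, eq_comm] at this
    · change a.symm ζ = ζ
      rw [AlgEquiv.symm_apply_eq, ha' ζ hζ]

variable (act : AbsGal k →* AddMonoid.End A)

lemma isOpen_kummerSubgroup [CharZero k] (hopen : IsOpen {g | act g = 1}) {m : ℕ} (hm : m ≠ 0) :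
    IsOpen (kummerSubgroup act m : Set (AbsGal k)) := by
  have : NeZero (m : k) := ⟨by exact_mod_cast hm⟩
  have : NeZero m := ⟨hm⟩
  obtain ⟨ζ, hζ⟩ := HasEnoughRootsOfUnity.exists_primitiveRoot (AlgebraicClosure k) m
  have : (kummerSubgroup act m : Set (AbsGal k)) = {g | act g = 1} ∩ {g | g ζ = ζ} := by
    ext g
    refine ⟨fun h => ⟨h.1, h.2 ζ hζ.pow_eq_one⟩, fun h => ⟨h.1, fun ξ hξ => ?_⟩⟩
    obtain ⟨i, -, rfl⟩ := hζ.eq_pow_of_pow_eq_one hξ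
    rw [map_pow, h.2]
  rw [this]
  exact hopen.inter (isClopen_fix ζ).2

/-- A coset is determined by the self-map of `A` that it induces and by the image of a primitive
`m`-th root of unity. -/
lemma index_kummerSubgroup_le [CharZero k] [Finite A] {m : ℕ} (hm : m ≠ 0) :
    (kummerSubgroup act m).index ≤ Nat.card A ^ Nat.card A * m := by
  classical
  have : NeZero (m : k) := ⟨by exact_mod_cast hm⟩
  have : NeZero m := ⟨hm⟩
  obtain ⟨ζ, hζ⟩ := HasEnoughRootsOfUnity.exists_primitiveRoot (AlgebraicClosure k) m
  let R := Polynomial.nthRootsFinset m (1 : AlgebraicClosure k)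
  have hmem : ∀ g : AbsGal k, g ζ ∈ R := fun g => by
    rw [Polynomial.mem_nthRootsFinset (Nat.pos_of_ne_zero hm), ← map_pow, hζ.pow_eq_one, map_one]
  let f : AbsGal k ⧸ kummerSubgroup act m → (A → A) × R := fun q =>
    (fun a => act q.out a, ⟨q.out ζ, hmem _⟩)
  have hf : Function.Injective f := by
    intro q q' h
    rw [← QuotientGroup.out_eq' q, ← QuotientGroup.out_eq' q', QuotientGroup.eq]
    have h1 := congrArg Prod.fst h
    have h2 := congrArg Subtype.val (congrArg Prod.snd h)
    have e2 : q.out ζ = q'.out ζ := h2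
    have e1 : act q.out = act q'.out := by ext a; exact congrFun h1 a
    have e3 : (q.out⁻¹ * q'.out) ζ = ζ := by
      change q.out.symm (q'.out ζ) = ζ
      rw [← e2, AlgEquiv.symm_apply_apply]
    refine ⟨?_, fun ξ hξ => ?_⟩
    · rw [map_mul, ← e1, ← map_mul, inv_mul_cancel, map_one]
    · obtain ⟨i, -, rfl⟩ := hζ.eq_pow_of_pow_eq_one hξ
      rw [map_pow, e3]
  refine (Nat.card_le_card_of_injective f hf).trans ?_
  rw [Nat.card_prod, Nat.card_fun, Nat.card_eq_fintype_card (α := R), Fintype.card_coe, hζ.card_nthRootsFinset]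

/-- A bound for the number of cocycles in a set. -/
lemma card_cocycles_le [CharZero k] [Finite A] {m B : ℕ} (hm : m ≠ 0) (hmA : ∀ a : A, m • a = 0)
    (hopen : IsOpen {g | act g = 1}) (Z : Set (AbsGal k → A)) (hZ : ∀ c ∈ Z, IsCocycle act c)
    (p : AlgebraicClosure k → Prop)
    (hp : ∀ c ∈ Z, ∀ ψ : Multiplicative A →* (AlgebraicClosure k)ˣ,
      ∀ β : AlgebraicClosure k, β ≠ 0 →
      (∀ σ ∈ kummerSubgroup act m, σ β = ψ (Multiplicative.ofAdd (c σ)) * β) → p β)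
    (hB : ∀ T : Finset (IntermediateField.fixedField (kummerSubgroup act m) :
      IntermediateField k (AlgebraicClosure k)),
      (∀ x ∈ T, x ≠ 0) → (∀ x ∈ T, ∃ β, p β ∧ (x : AlgebraicClosure k) = β ^ m) →
      (∀ x ∈ T, ∀ y ∈ T, (∃ z, x = y * z ^ m) → x = y) → T.card ≤ B) :
    Finite Z ∧ Nat.card Z ≤ Nat.card A ^ (kummerSubgroup act m).index * B ^ Nat.card A := by
  classical
  set N := kummerSubgroup act m
  have hNopen : IsOpen (N : Set (AbsGal k)) := isOpen_kummerSubgroup act hopen hm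
  -- One character is fixed for each nonzero `a`, nontrivial at `a`; these separate the elements of
  -- `A`.
  have hψ : ∀ a : A, a ≠ 0 → ∃ ψ : Multiplicative A →* (AlgebraicClosure k)ˣ,
      ψ (Multiplicative.ofAdd a) ≠ 1 := by
    intro a ha
    have : NeZero (Monoid.exponent (Multiplicative A) : k) :=
      ⟨by exact_mod_cast Monoid.exponent_ne_zero_of_finite⟩
    exact CommGroup.exists_apply_ne_one_of_hasEnoughRootsOfUnity (Multiplicative A)
      (AlgebraicClosure k) (by simpa using ha)
  choose! ψ hψ using hψ
  have hq : Finite (AbsGal k ⧸ N) := Subgroup.quotient_finite_of_isOpen N hNopen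
  have hact : ∀ σ : N, ∀ a, act σ a = a := fun σ a => by
    rw [show act σ = 1 from σ.2.1]; rfl
  let χ : Z → A → N →* (AlgebraicClosure k)ˣ := fun c a =>
    { toFun := fun σ => ψ a (Multiplicative.ofAdd (c.1 σ))
      map_one' := by
        rw [OneMemClass.coe_one, (hZ c c.2).map_one, ofAdd_zero, map_one]
      map_mul' := fun σ τ => by
        rw [MulMemClass.coe_mul, (hZ c c.2).map_mul, hact, ofAdd_add, map_mul] }
  have hχ : ∀ c a, (∀ σ, χ c a σ ^ m = 1) ∧
      IsOpen (((χ c a).ker.map N.subtype : Subgroup (AbsGal k)) : Set (AbsGal k)) := by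
    refine fun c a => ⟨fun σ => ?_, ?_⟩
    · change ψ a (Multiplicative.ofAdd (c.1 σ)) ^ m = 1
      rw [← map_pow, ← ofAdd_nsmul, hmA, ofAdd_zero, map_one]
    · have : (((χ c a).ker.map N.subtype : Subgroup (AbsGal k)) : Set (AbsGal k)) =
          (N : Set (AbsGal k)) ∩ ⋃ b ∈ {b | ψ a (Multiplicative.ofAdd b) = 1}, {g | c.1 g = b} := by
        ext g
        constructor
        · rintro ⟨σ, hσ, rfl⟩
          exact ⟨σ.2, Set.mem_biUnion (x := c.1 σ) hσ rfl⟩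
        · rintro ⟨hg, h⟩
          obtain ⟨b, hb, hgb⟩ := Set.mem_iUnion₂.mp h
          have hgb : c.1 g = b := hgb
          exact ⟨⟨g, hg⟩, by subst hgb; exact hb, rfl⟩
      rw [this]
      exact hNopen.inter (isOpen_biUnion fun b _ => (hZ c c.2).isOpen_fiber b)
  set S : Set (N →* (AlgebraicClosure k)ˣ) := {η | ∃ c a, χ c a = η}
  obtain ⟨hSfin, hScard⟩ := ncard_characters_le hm N (fun σ hσ => hσ.2) S
    (by rintro _ ⟨c, a, rfl⟩; exact hχ c a) p
    (by
      rintro _ ⟨c, a, rfl⟩ β hβ h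
      exact hp c c.2 (ψ a) β hβ fun σ hσ => h ⟨σ, hσ⟩) hB
  have hSf : Finite S := hSfin
  -- A cocycle is determined by its values at coset representatives of `N` and its restriction to
  -- `N`. The latter is a homomorphism recovered from its composites with the characters `ψ a`: if
  -- `c` and `c'` differ at `σ`, the character attached to the difference detects it.
  let Θ : Z → (AbsGal k ⧸ N → A) × (A → S) := fun c =>
    (fun q => c.1 q.out, fun a => ⟨χ c a, c, a, rfl⟩)
  have hΘ : Function.Injective Θ := by
    intro c c' h
    have h1 : ∀ q : AbsGal k ⧸ N, c.1 q.out = c'.1 q.out := congrFun (congrArg Prod.fst h)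
    have h2 : ∀ a, χ c a = χ c' a := fun a =>
      congrArg Subtype.val (congrFun (congrArg Prod.snd h) a)
    have h3 : ∀ σ : N, c.1 σ = c'.1 σ := by
      intro σ
      by_contra hne
      refine hψ _ (sub_ne_zero.mpr hne) ?_
      have h4 := DFunLike.congr_fun (h2 (c.1 σ - c'.1 σ)) σ
      rw [ofAdd_sub, map_div, div_eq_one]
      exact h4
    refine Subtype.ext (funext fun g => ?_)
    obtain ⟨n, hn⟩ := QuotientGroup.mk_out_eq_mul N g
    have hg : g = (QuotientGroup.mk g : AbsGal k ⧸ N).out * ((n⁻¹ : N) : AbsGal k) := by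
      rw [hn]; simp
    rw [hg, (hZ c c.2).map_mul, (hZ c' c'.2).map_mul, h1, h3]
  refine ⟨Finite.of_injective Θ hΘ, (Nat.card_le_card_of_injective Θ hΘ).trans ?_⟩
  rw [Nat.card_prod, Nat.card_fun, Nat.card_fun, ← Subgroup.index_eq_card]
  exact Nat.mul_le_mul_left _ (Nat.pow_le_pow_left ((Nat.card_coe_set_eq S).trans_le hScard) _)

end CocycleBound

/-! ### A bound for local cocycles uniform in the place -/

section LocalCocycleBound

variable {K : Type u} [Field K] [NumberField K] (v : HeightOneSpectrum (𝓞 K))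

attribute [local instance] charZero_adicCompletion

/-- A bound for the number of local cocycles. -/
lemma card_local_cocycles_le {A : Type*} [AddCommGroup A] [Finite A] {m a n : ℕ} (hm : m ≠ 0)
    (hmA : ∀ a : A, m • a = 0) (hcard : Nat.card A ≤ a) (hn : Module.finrank ℚ K = n)
    (act : AbsGal (v.adicCompletion K) →* AddMonoid.End A) (hopen : IsOpen {g | act g = 1}) :
    Finite {c : AbsGal (v.adicCompletion K) → A // IsCocycle act c} ∧
    Nat.card {c : AbsGal (v.adicCompletion K) → A // IsCocycle act c} ≤
      a ^ (a ^ a * m) * (m * (m * ((m ^ (m + 1)) ^ n) ^ (a ^ a * m))) ^ a := by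
  set N := kummerSubgroup act m
  have hN : IsOpen (N : Set (AbsGal (v.adicCompletion K))) := isOpen_kummerSubgroup act hopen hm
  have hfix : (IntermediateField.fixedField N : IntermediateField (v.adicCompletion K)
      (AlgebraicClosure (v.adicCompletion K))).fixingSubgroup = N :=
    InfiniteGalois.fixingSubgroup_fixedField ⟨N, N.isClosed_of_isOpen hN⟩
  -- The degree of the fixed field is the index of `N`, at most `a ^ a * m`. Thus the count of power
  -- classes depends on `a`, `m` and `n` only.
  have hrank := IntermediateField.finrank_eq_fixingSubgroup_index (AlgebraicClosure (v.adicCompletion K))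
    (IntermediateField.fixedField N : IntermediateField (v.adicCompletion K)
      (AlgebraicClosure (v.adicCompletion K)))
  rw [hfix] at hrank
  have hA : 1 ≤ Nat.card A := Nat.card_pos
  have ha : 1 ≤ a := hA.trans hcard
  have hm1 : 1 ≤ m := Nat.pos_of_ne_zero hm
  have hidx : N.index ≤ a ^ a * m := (index_kummerSubgroup_le act hm).trans
    (Nat.mul_le_mul_right _ ((Nat.pow_le_pow_left hcard _).trans (Nat.pow_le_pow_right ha hcard)))
  have hfi : Finite (AbsGal (v.adicCompletion K) ⧸ N) := Subgroup.quotient_finite_of_isOpen N hN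
  have : N.FiniteIndex := Subgroup.finiteIndex_of_finite_quotient
  have : FiniteDimensional (v.adicCompletion K) (IntermediateField.fixedField N :
      IntermediateField (v.adicCompletion K) (AlgebraicClosure (v.adicCompletion K))) :=
    FiniteDimensional.of_finrank_pos (hrank ▸ Nat.pos_of_ne_zero Subgroup.FiniteIndex.index_ne_zero)
  obtain ⟨h1, h2⟩ := card_cocycles_le act hm hmA hopen {c | IsCocycle act c} (fun _ h => h)
    (fun _ => True) (fun _ _ _ _ _ _ => trivial)
    (fun T hT _ hTm => card_powerClasses_le v _ hm T hT hTm)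
  refine ⟨h1, h2.trans ?_⟩
  rw [hrank, hn]
  have hmm : 1 ≤ (m ^ (m + 1)) ^ n := Nat.one_le_pow _ _ (Nat.one_le_pow _ _ hm1)
  have hpos : 1 ≤ m * (m * ((m ^ (m + 1)) ^ n) ^ (a ^ a * m)) :=
    Nat.mul_pos hm1 (Nat.mul_pos hm1 (Nat.one_le_pow _ _ hmm))
  refine Nat.mul_le_mul ((Nat.pow_le_pow_left hcard _).trans (Nat.pow_le_pow_right ha hidx)) ?_
  refine (Nat.pow_le_pow_left ?_ _).trans (Nat.pow_le_pow_right hpos hcard)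
  exact Nat.mul_le_mul_left _ (Nat.mul_le_mul_left _ (Nat.pow_le_pow_right hmm hidx))

end LocalCocycleBound

/-! ### Points and changes of variables -/

section VariableChange

open WeierstrassCurve WeierstrassCurve.Affine

variable {F : Type*} [Field F] (C : VariableChange F) (W : WeierstrassCurve F)

/-- The new `X`-coordinate. -/
def changeX (x : F) : F := (C.u⁻¹ : Fˣ) ^ 2 * (x - C.r)

/-- The new `Y`-coordinate. -/
def changeY (x y : F) : F := (C.u⁻¹ : Fˣ) ^ 3 * (y - C.s * (x - C.r) - C.t)

lemma changeX_injective : Function.Injective (changeX C) := by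
  intro x x' h
  simpa [changeX] using h

lemma changeY_injective (x : F) : Function.Injective (changeY C x) := by
  intro y y' h
  simpa [changeY] using h

variable {C W}

lemma equation_change {x y : F} (h : W.toAffine.Equation x y) :
    (C • W).toAffine.Equation (changeX C x) (changeY C x y) := by
  rw [equation_iff] at h ⊢
  simp only [variableChange_a₁, variableChange_a₂, variableChange_a₃, variableChange_a₄,
    variableChange_a₆, changeX, changeY]
  linear_combination ((C.u⁻¹ : Fˣ) : F) ^ 6 * h

lemma nonsingular_change [W.IsElliptic] {x y : F} (h : W.toAffine.Nonsingular x y) :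
    (C • W).toAffine.Nonsingular (changeX C x) (changeY C x y) :=
  (C • W).toAffine.equation_iff_nonsingular.mp (equation_change h.1)

lemma negY_change (x y : F) : (C • W).toAffine.negY (changeX C x) (changeY C x y) =
    changeY C x (W.toAffine.negY x y) := by
  simp only [negY, variableChange_a₁, variableChange_a₃, changeX, changeY]
  ring

variable [DecidableEq F]

/-- Slopes transform by `l ↦ u⁻¹ (l - s)`, compatibly with `addX` and `addY`; this makes the change
of coordinates additive on points. -/
lemma slope_change {x₁ x₂ y₁ y₂ : F} (h₁ : W.toAffine.Equation x₁ y₁)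
    (h₂ : W.toAffine.Equation x₂ y₂) (hxy : ¬(x₁ = x₂ ∧ y₁ = W.toAffine.negY x₂ y₂)) :
    (C • W).toAffine.slope (changeX C x₁) (changeX C x₂) (changeY C x₁ y₁) (changeY C x₂ y₂) =
      (C.u⁻¹ : Fˣ) * (W.toAffine.slope x₁ x₂ y₁ y₂ - C.s) := by
  have hu : ((C.u⁻¹ : Fˣ) : F) ≠ 0 := Units.ne_zero _
  by_cases hx : x₁ = x₂
  · subst hx
    have hy : y₁ ≠ W.toAffine.negY x₁ y₂ := fun h => hxy ⟨rfl, h⟩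
    have hyy : y₁ = y₂ := Y_eq_of_Y_ne h₁ h₂ rfl hy
    subst hyy
    rw [slope_of_Y_ne rfl hy, slope_of_Y_ne rfl (by rw [negY_change]; exact (changeY_injective C x₁).ne hy),
      negY_change]
    have hd : y₁ - W.toAffine.negY x₁ y₁ ≠ 0 := sub_ne_zero.mpr hy
    have hd' : changeY C x₁ y₁ - changeY C x₁ (W.toAffine.negY x₁ y₁) =
        ((C.u⁻¹ : Fˣ) : F) ^ 3 * (y₁ - W.toAffine.negY x₁ y₁) := by
      simp only [changeY]; ring
    rw [hd', div_eq_iff (mul_ne_zero (pow_ne_zero _ hu) hd), ← sub_eq_zero]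
    have : ∀ n : F, ((C.u⁻¹ : Fˣ) : F) * (n / (y₁ - W.toAffine.negY x₁ y₁) - C.s) *
        (((C.u⁻¹ : Fˣ) : F) ^ 3 * (y₁ - W.toAffine.negY x₁ y₁)) =
        ((C.u⁻¹ : Fˣ) : F) ^ 4 * (n - C.s * (y₁ - W.toAffine.negY x₁ y₁)) := by
      intro n
      field_simp
    rw [this]
    simp only [variableChange_a₁, variableChange_a₂, variableChange_a₄, changeX, changeY, negY]
    ring
  · rw [slope_of_X_ne hx, slope_of_X_ne ((changeX_injective C).ne hx)]
    have hd : x₁ - x₂ ≠ 0 := sub_ne_zero.mpr hx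
    have hd' : changeX C x₁ - changeX C x₂ = ((C.u⁻¹ : Fˣ) : F) ^ 2 * (x₁ - x₂) := by
      simp only [changeX]; ring
    rw [hd', div_eq_iff (mul_ne_zero (pow_ne_zero _ hu) hd)]
    simp only [changeY]
    field_simp
    ring

omit [DecidableEq F] in
lemma addX_change (x₁ x₂ l : F) :
    (C • W).toAffine.addX (changeX C x₁) (changeX C x₂) ((C.u⁻¹ : Fˣ) * (l - C.s)) =
      changeX C (W.toAffine.addX x₁ x₂ l) := by
  simp only [addX, variableChange_a₁, variableChange_a₂, changeX]
  ring

omit [DecidableEq F] in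
lemma addY_change (x₁ x₂ y₁ l : F) :
    (C • W).toAffine.addY (changeX C x₁) (changeX C x₂) (changeY C x₁ y₁) ((C.u⁻¹ : Fˣ) * (l - C.s)) =
      changeY C (W.toAffine.addX x₁ x₂ l) (W.toAffine.addY x₁ x₂ y₁ l) := by
  rw [addY, addY, ← negY_change, addX_change]
  congr 1
  simp only [negAddY, addX_change]
  simp only [addX, changeX, changeY]
  ring

variable (C W) in
/-- The map on points given by a change of variables. -/
def changePoint [W.IsElliptic] : W.toAffine.Point →+ (C • W).toAffine.Point where
  toFun P := match P with
    | .zero => 0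
    | .some _ _ h => .some _ _ (nonsingular_change h)
  map_zero' := rfl
  map_add' P Q := by
    rcases P with _ | ⟨x₁, y₁, h₁⟩
    · rw [← Point.zero_def, zero_add]
      exact (zero_add _).symm
    rcases Q with _ | ⟨x₂, y₂, h₂⟩
    · rw [← Point.zero_def, add_zero]
      exact (add_zero _).symm
    by_cases hxy : x₁ = x₂ ∧ y₁ = W.toAffine.negY x₂ y₂
    · rw [Point.add_of_Y_eq hxy.1 hxy.2]
      refine (Point.add_of_Y_eq (congrArg _ hxy.1) ?_).symm
      rw [negY_change, hxy.1, ← hxy.2]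
    · rw [Point.add_some hxy]
      have hxy' : ¬(changeX C x₁ = changeX C x₂ ∧
          changeY C x₁ y₁ = (C • W).toAffine.negY (changeX C x₂) (changeY C x₂ y₂)) := by
        rintro ⟨hx, hy⟩
        have hx := changeX_injective C hx
        subst hx
        rw [negY_change] at hy
        exact hxy ⟨rfl, changeY_injective C _ hy⟩
      refine Eq.trans ?_ (Point.add_some hxy').symm
      rw [Point.some.injEq, slope_change h₁.1 h₂.1 hxy, addX_change, addY_change]
      exact ⟨rfl, rfl⟩

lemma changePoint_some [W.IsElliptic] {x y : F} (h : W.toAffine.Nonsingular x y) :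
    changePoint C W (.some x y h) = .some _ _ (nonsingular_change h) := rfl

lemma changePoint_injective [W.IsElliptic] : Function.Injective (changePoint C W) := by
  rw [injective_iff_map_eq_zero]
  rintro (_ | ⟨x, y, h⟩) hP
  · rfl
  · exact absurd hP (Point.some_ne_zero _)

end VariableChange

/-! ### Unramified classes come from points -/

section KummerCount

variable {k : Type u} [Field k] [CharZero k] {w : Valuation (AlgebraicClosure k) ℝ≥0}
  {M : Type*} [AddCommGroup M]

lemma act_mul_apply {G : Type*} [Group G] (act : G →* AddMonoid.End M) (σ τ : G) (Q : M) :
    act (σ * τ) Q = act σ (act τ Q) := by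
  rw [map_mul]; rfl

/-- The set is empty or a left translate of the stabilizer of `Q`. -/
lemma isOpen_setOf_act_eq {G : Type*} [Group G] [TopologicalSpace G] [IsTopologicalGroup G]
    (act : G →* AddMonoid.End M) (Q : M) (hQ : IsOpen {σ | act σ Q = Q}) (R : M) :
    IsOpen {σ | act σ Q = R} := by
  by_cases h : ∃ τ, act τ Q = R
  · obtain ⟨τ, rfl⟩ := h
    have : {σ | act σ Q = act τ Q} = (fun σ => τ⁻¹ * σ) ⁻¹' {σ | act σ Q = Q} := by
      ext σ
      simp only [Set.mem_preimage, Set.mem_ofPred_eq]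
      constructor
      · intro h
        rw [act_mul_apply, h, ← act_mul_apply, inv_mul_cancel, map_one, AddMonoid.End.coe_one, id]
      · intro h
        conv_rhs => rw [← h]
        rw [← act_mul_apply, mul_inv_cancel_left]
    rw [this]
    exact hQ.preimage (continuous_const_mul _)
  · convert isOpen_empty
    ext σ
    simpa using fun h' => h ⟨σ, h'⟩

/-- The fixed points of an action. -/
def fixedPts {G : Type*} [Group G] (act : G →* AddMonoid.End M) : AddSubgroup M where
  carrier := {P | ∀ σ, act σ P = P}
  add_mem' := fun ha hb σ => by rw [map_add, ha, hb]
  zero_mem' := fun σ => map_zero _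
  neg_mem' := fun ha σ => by rw [map_neg, ha]

/-- Let `D` be the preimage of `D₀` under multiplication by `m` and `A` its kernel. Computing `[D :
E₁]` through `D₀` gives `[D : D₀] [D₀ : E₁]`. Through `E₁ + A` it gives `[D₀ : m E₁] #A = [D₀ : E₁]
[E₁ : m E₁] #A`, because `E₁ ∩ A = 0`. Hence `[D : D₀] = [E₁ : m E₁] #A`. The finiteness hypotheses
exclude the value `0` by which `relIndex` denotes an infinite index. -/
lemma relIndex_ge_card_torsion (m : ℕ) (D₀ E₁ : AddSubgroup M) (hE : E₁ ≤ D₀)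
    (hdiv : ∀ P : M, ∃ Q, m • Q = P)
    (htors : ∀ P ∈ E₁, m • P = 0 → P = 0) (hfin : E₁.relIndex D₀ ≠ 0)
    (hfinD : D₀.relIndex (D₀.comap (DistribSMul.toAddMonoidHom M m)) ≠ 0) :
    Nat.card (DistribSMul.toAddMonoidHom M m).ker ≤
      D₀.relIndex (D₀.comap (DistribSMul.toAddMonoidHom M m)) := by
  set f := DistribSMul.toAddMonoidHom M m
  have hf : ∀ P, f P = m • P := fun _ => rfl
  set D := D₀.comap f
  have hsurj : Function.Surjective f := hdiv
  have hD0D : D₀ ≤ D := fun P hP => D₀.nsmul_mem hP m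
  have hkerD : f.ker ≤ D := fun P hP => by
    rw [AddSubgroup.mem_comap, (AddMonoidHom.mem_ker).mp hP]
    exact D₀.zero_mem
  have hmE : E₁.map f ≤ E₁ := by
    rintro _ ⟨P, hP, rfl⟩
    exact E₁.nsmul_mem hP m
  have h1 := AddSubgroup.relIndex_mul_relIndex E₁ D₀ D hE hD0D
  have h2 := AddSubgroup.relIndex_mul_relIndex E₁ (E₁ ⊔ f.ker) D le_sup_left
    (sup_le (hE.trans hD0D) hkerD)
  have h3 := AddSubgroup.relIndex_mul_relIndex (E₁.map f) E₁ D₀ hmE hE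
  have h4 : (E₁ ⊔ f.ker).relIndex D = (E₁.map f).relIndex D₀ := by
    rw [← AddSubgroup.comap_map_eq, AddSubgroup.relIndex_comap,
      AddSubgroup.map_comap_eq_self_of_surjective hsurj]
  have h5 : E₁.relIndex (E₁ ⊔ f.ker) = Nat.card f.ker := by
    rw [AddSubgroup.relIndex_sup_left, ← AddSubgroup.inf_relIndex_right]
    have : E₁ ⊓ f.ker = ⊥ := by
      rw [eq_bot_iff]
      rintro P ⟨hP, hP'⟩
      exact htors P hP hP'
    rw [this, AddSubgroup.relIndex_bot_left]
  rw [h4, h5, ← h3] at h2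
  rw [← h2] at h1
  have h6 : D₀.relIndex D = Nat.card f.ker * (E₁.map f).relIndex E₁ := by
    refine Nat.eq_of_mul_eq_mul_left (Nat.pos_of_ne_zero hfin) ?_
    rw [h1]; ring
  rw [h6]
  refine Nat.le_mul_of_pos_right _ (Nat.pos_of_ne_zero fun h => hfinD ?_)
  rw [h6, h, mul_zero]

/-- If inertia moves no point within its class modulo `m`-torsion, and the fixed points have a
subgroup of finite index without `m`-torsion, every unramified `m`-torsion cocycle comes from a
point. -/
lemma exists_point_of_unramified (hw : IsLocalVal w) (act : AbsGal k →* AddMonoid.End M)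
    (hopen : ∀ Q, IsOpen {σ | act σ Q = Q}) {m : ℕ} (hdiv : ∀ P : M, ∃ Q, m • Q = P)
    (hker : Finite (DistribSMul.toAddMonoidHom M m).ker)
    (hI : ∀ σ ∈ inertiaSet w, ∀ Q, m • act σ Q = m • Q → act σ Q = Q)
    (E₁ : AddSubgroup M) (hE : E₁ ≤ fixedPts act) (htors : ∀ P ∈ E₁, m • P = 0 → P = 0)
    (hfin : E₁.relIndex (fixedPts act) ≠ 0)
    (c : AbsGal k → M) (hc : IsCocycle act c) (hcm : ∀ σ, m • c σ = 0)
    (hcI : ∀ σ ∈ inertiaSet w, c σ = 0) : ∃ Q, ∀ σ, c σ = act σ Q - Q := by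
  classical
  set f := DistribSMul.toAddMonoidHom M m
  set A := f.ker
  have hA : ∀ P, P ∈ A ↔ m • P = 0 := fun _ => Iff.rfl
  let actA : AbsGal k →* AddMonoid.End A :=
    { toFun := fun σ => ((act σ).comp A.subtype).codRestrict A fun P => by
        rw [hA]
        change m • act σ P = 0
        rw [← map_nsmul, (hA _).mp P.2, map_zero]
      map_one' := by
        ext P
        change act 1 P = P
        rw [map_one]; rfl
      map_mul' := fun σ τ => by
        ext P
        exact act_mul_apply act σ τ P }
  have hactA : ∀ σ (P : A), ((actA σ P : A) : M) = act σ P := fun _ _ => rfl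
  have hopenA : IsOpen {σ | actA σ = 1} := by
    have : {σ | actA σ = 1} = ⋂ P : A, {σ | act σ P = P} := by
      ext σ
      simp only [Set.mem_iInter, Set.mem_ofPred_eq]
      exact ⟨fun h P => by rw [← hactA, h]; rfl, fun h => by ext P; exact h P⟩
    rw [this]
    exact isOpen_iInter_of_finite fun P => hopen P
  have hIA : ∀ σ ∈ inertiaSet w, actA σ = 1 := by
    intro σ hσ
    ext P
    rw [hactA]
    refine hI σ hσ P ?_
    rw [← map_nsmul, (hA _).mp P.2, map_zero]
  obtain ⟨hSfin, hScard⟩ := ncard_unramified_le hw actA hopenA hIA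
  set S := {c : AbsGal k → A | IsCocycle actA c ∧ ∀ σ ∈ inertiaSet w, c σ = 0}
  set D₀ := fixedPts act
  set D := D₀.comap f
  -- Division by `m`: each `Q` with `m Q` fixed yields the cocycle `σ ↦ σ Q - Q`, unramified by
  -- `hI`. Two such cocycles coincide exactly when the points differ by a fixed point.
  have hsub : ∀ (Q : D) σ, act σ Q - Q ∈ A := by
    intro Q σ
    rw [hA, smul_sub, ← map_nsmul, sub_eq_zero]
    exact Q.2 σ
  let κ : D → S := fun Q => ⟨fun σ => ⟨_, hsub Q σ⟩, ⟨fun g h => Subtype.ext (by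
      change act (g * h) Q - Q = (act g Q - Q) + act g (act h Q - Q)
      rw [act_mul_apply, map_sub]; abel), fun a => by
      have : {σ | (⟨_, hsub Q σ⟩ : A) = a} = {σ | act σ (Q : M) = Q + a} := by
        ext σ
        simp only [Set.mem_ofPred_eq, Subtype.ext_iff, sub_eq_iff_eq_add']
      rw [this]
      exact isOpen_setOf_act_eq act _ (hopen _) _⟩, fun σ hσ => Subtype.ext (by
      change act σ Q - Q = 0
      rw [sub_eq_zero]
      refine hI σ hσ _ ?_
      rw [← map_nsmul]
      exact Q.2 σ)⟩
  have hκ : ∀ Q Q' : D, κ Q = κ Q' → (Q - Q' : M) ∈ D₀ := by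
    intro Q Q' h σ
    have := congrArg Subtype.val (congrFun (congrArg Subtype.val h) σ)
    change act σ Q - Q = act σ Q' - Q' at this
    rw [map_sub]
    rw [sub_eq_sub_iff_add_eq_add] at this ⊢
    rw [this]; abel
  have : Finite S := hSfin
  let κ' : D ⧸ D₀.addSubgroupOf D → S := fun q => κ q.out
  have hκ' : Function.Injective κ' := by
    intro q q' h
    rw [← QuotientAddGroup.out_eq' q, ← QuotientAddGroup.out_eq' q', QuotientAddGroup.eq]
    have := hκ _ _ h.symm
    rw [AddSubgroup.mem_addSubgroupOf, neg_add_eq_sub]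
    exact this
  have hDfin : Finite (D ⧸ D₀.addSubgroupOf D) := Finite.of_injective κ' hκ'
  have hidx : D₀.relIndex D = Nat.card (D ⧸ D₀.addSubgroupOf D) := rfl
  have hge : Nat.card A ≤ D₀.relIndex D := relIndex_ge_card_torsion m D₀ E₁ hE hdiv htors hfin
    (by rw [hidx]; exact Nat.card_pos.ne')
  -- The injection of `D / D₀` into the set of unramified cocycles is onto, since the source has at
  -- least `#A` elements and the target at most `#A`.
  have hsurj : Function.Surjective κ' := by
    have := Fintype.ofFinite S
    have := Fintype.ofFinite (D ⧸ D₀.addSubgroupOf D)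
    refine ((Fintype.bijective_iff_injective_and_card κ').mpr ⟨hκ', le_antisymm
      (Fintype.card_le_of_injective _ hκ') ?_⟩).2
    rw [← Nat.card_eq_fintype_card, ← Nat.card_eq_fintype_card]
    exact ((Nat.card_coe_set_eq S).trans_le hScard).trans (hge.trans hidx.le)
  let c' : S := ⟨fun σ => ⟨c σ, hcm σ⟩, ⟨fun g h => Subtype.ext (hc.map_mul g h), fun a => by
    have : {σ | (⟨c σ, hcm σ⟩ : A) = a} = {σ | c σ = a} := by
      ext σ
      simp only [Set.mem_ofPred_eq, Subtype.ext_iff]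
    rw [this]
    exact hc.isOpen_fiber _⟩, fun σ hσ => Subtype.ext (hcI σ hσ)⟩
  obtain ⟨q, hq⟩ := hsurj c'
  refine ⟨(q.out : D), fun σ => ?_⟩
  exact (congrArg Subtype.val (congrFun (congrArg Subtype.val hq) σ)).symm

end KummerCount

/-! ### Good models -/

section GoodModel

open WeierstrassCurve WeierstrassCurve.Affine

variable {F Γ : Type*} [Field F] [LinearOrderedCommGroupWithZero Γ]

/-- The equation `V` is integral with invertible discriminant. -/
def IsGoodModel (v : Valuation F Γ) (V : WeierstrassCurve F) : Prop :=
  ∃ W : WeierstrassCurve v.valuationSubring, W⁄F = V ∧ IsUnit W.Δ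

variable [DecidableEq F] {v : Valuation F Γ} {V : WeierstrassCurve F} (hV : IsGoodModel v V)

include hV

lemma IsGoodModel.exists_reductionKer :
    ∃ H : AddSubgroup V.toAffine.Point, ∀ P, P ∈ H ↔ ReducesToZero v P := by
  obtain ⟨W, rfl, -⟩ := hV
  exact ⟨reductionKer v W, fun _ => Iff.rfl⟩

lemma IsGoodModel.eq_zero {m : ℕ} (hm : v (m : F) = 1) {P : V.toAffine.Point}
    (hP : ReducesToZero v P) (h : m • P = 0) : P = 0 := by
  obtain ⟨W, rfl, -⟩ := hV
  exact eq_zero_of_reducesToZero_of_smul hm hP h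

lemma IsGoodModel.reducesToZero_sub {x₁ y₁ x₂ y₂ : F} (h₁ : V.toAffine.Nonsingular x₁ y₁)
    (h₂ : V.toAffine.Nonsingular x₂ y₂) (hx₁ : v x₁ ≤ 1) (hx₂ : v x₂ ≤ 1)
    (hx : v (x₁ - x₂) < 1) (hy : v (y₁ - y₂) < 1) :
    ReducesToZero v (Point.some x₁ y₁ h₁ - Point.some x₂ y₂ h₂) := by
  obtain ⟨W, rfl, hΔ⟩ := hV
  exact EllSel.reducesToZero_sub hΔ h₁ h₂ hx₁ hx₂ hx hy

omit [DecidableEq F] in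
lemma IsGoodModel.valuation_y_le_one {x y : F} (h : V.toAffine.Nonsingular x y) (hx : v x ≤ 1) :
    v y ≤ 1 := by
  obtain ⟨W, rfl, -⟩ := hV
  exact EllSel.valuation_y_le_one h hx

end GoodModel

/-! ### Galois action and good reduction -/

section GoodReduction

open scoped Classical WeierstrassCurve
open WeierstrassCurve WeierstrassCurve.Affine

variable {K k : Type u} [Field K] [Field k] [Algebra K k] (E : WeierstrassCurve K)

lemma pointsAction_some (σ : AbsGal k) {x y : AlgebraicClosure k}
    (h : (E⁄(AlgebraicClosure k)).toAffine.Nonsingular x y) :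
    ∃ h', pointsAction E k σ (.some x y h) = .some (σ x) (σ y) h' :=
  ⟨_, rfl⟩

lemma isOpen_pointsAction_stabilizer (Q : (E⁄(AlgebraicClosure k)).toAffine.Point) :
    IsOpen {σ | pointsAction E k σ Q = Q} := by
  rcases Q with _ | ⟨x, y, h⟩
  · convert isOpen_univ
    ext σ
    simp only [Set.mem_ofPred_eq, Set.mem_univ, iff_true]
    rfl
  · convert (isClopen_fix x).2.inter (isClopen_fix y).2
    ext σ
    obtain ⟨h', e⟩ := pointsAction_some E σ h
    simp only [Set.mem_ofPred_eq, Set.mem_inter_iff]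
    rw [e, Point.some.injEq]

lemma changeX_map_algEquiv (C : VariableChange k) (σ : AbsGal k) (x : AlgebraicClosure k) :
    changeX (C.map (algebraMap k (AlgebraicClosure k))) (σ x) =
      σ (changeX (C.map (algebraMap k (AlgebraicClosure k))) x) := by
  simp [changeX, VariableChange.map]

lemma changeY_map_algEquiv (C : VariableChange k) (σ : AbsGal k) (x y : AlgebraicClosure k) :
    changeY (C.map (algebraMap k (AlgebraicClosure k))) (σ x) (σ y) =
      σ (changeY (C.map (algebraMap k (AlgebraicClosure k))) x y) := by
  simp [changeY, VariableChange.map]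

lemma isElliptic_baseChange [E.IsElliptic] (L : Type*) [Field L] [Algebra K L] :
    (E⁄L).IsElliptic :=
  inferInstanceAs (E.map (algebraMap K L)).IsElliptic

attribute [local instance] isElliptic_baseChange

variable [E.IsElliptic] {w : Valuation (AlgebraicClosure k) ℝ≥0} (hw : IsLocalVal w)
  {C : VariableChange k}
  (hV : IsGoodModel w ((C.map (algebraMap k (AlgebraicClosure k))) • (E⁄(AlgebraicClosure k))))
  {m : ℕ} (hm : w (m : AlgebraicClosure k) = 1)

include hw hV hm

/-- Inertia acts trivially on residues, so `σ Q - Q` reduces to zero. It is killed by `m`, and the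
kernel of reduction has no `m`-torsion. -/
lemma pointsAction_eq_of_mem_inertiaSet {σ : AbsGal k} (hσ : σ ∈ inertiaSet w)
    {Q : (E⁄(AlgebraicClosure k)).toAffine.Point}
    (hQ : m • pointsAction E k σ Q = m • Q) : pointsAction E k σ Q = Q := by
  set ψ := changePoint (C.map (algebraMap k (AlgebraicClosure k))) (E⁄(AlgebraicClosure k))
  have hψ : Function.Injective ψ := changePoint_injective
  obtain ⟨H, hH⟩ := hV.exists_reductionKer
  refine hψ (sub_eq_zero.mp (hV.eq_zero hm ?_ ?_))
  · rcases Q with _ | ⟨x, y, h⟩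
    · rw [← Point.zero_def, map_zero, sub_self]
      exact reducesToZero_zero
    obtain ⟨h', e⟩ := pointsAction_some E σ h
    rw [e, changePoint_some, changePoint_some]
    by_cases hx : w (changeX (C.map (algebraMap k (AlgebraicClosure k))) x) ≤ 1
    · refine hV.reducesToZero_sub _ _ ?_ hx ?_ ?_
      · rwa [changeX_map_algEquiv, hw.map_gal]
      · rw [changeX_map_algEquiv]
        exact hσ _ hx
      · rw [changeY_map_algEquiv]
        exact hσ _ (hV.valuation_y_le_one (nonsingular_change h) hx)
    · rw [not_le] at hx
      rw [← hH]
      refine H.sub_mem ?_ ?_ <;> rw [hH, reducesToZero_some]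
      · rwa [changeX_map_algEquiv, hw.map_gal]
      · exact hx
  · rw [← map_sub, ← map_nsmul, smul_sub, hQ, sub_self, map_zero]

/-- The subgroup consists of the fixed points in the kernel of reduction. Its index is finite
because integral fixed points have coordinates in `k`, which reduce into a finite field, and points
with equal reductions differ by an element of the kernel. -/
lemma exists_fixedPts_subgroup [CharZero k] :
    ∃ E₁ : AddSubgroup (E⁄(AlgebraicClosure k)).toAffine.Point, E₁ ≤ fixedPts (pointsAction E k) ∧
      (∀ P ∈ E₁, m • P = 0 → P = 0) ∧ E₁.relIndex (fixedPts (pointsAction E k)) ≠ 0 := by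
  set D := fixedPts (pointsAction E k)
  set C' := C.map (algebraMap k (AlgebraicClosure k))
  set ψ := changePoint C' (E⁄(AlgebraicClosure k))
  have hψ : Function.Injective ψ := changePoint_injective
  obtain ⟨H, hH⟩ := hV.exists_reductionKer
  refine ⟨D ⊓ H.comap ψ, inf_le_left, ?_, ?_⟩
  · rintro P ⟨-, hP⟩ h0
    refine hψ ?_
    rw [map_zero]
    exact hV.eq_zero hm ((hH _).mp hP) (by rw [← map_nsmul, h0, map_zero])
  rw [AddSubgroup.inf_relIndex_left]
  have := hw.finite_residue
  have hfix : ∀ z : AlgebraicClosure k, (∀ σ : AbsGal k, σ z = z) → w z ≤ 1 →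
      red w z ∈ baseResidue w := by
    intro z hz h1
    obtain ⟨y, rfl⟩ := (InfiniteGalois.mem_range_algebraMap_iff_fixed z).mpr hz
    exact ⟨y, h1, rfl⟩
  have hxy : ∀ x y h, Point.some x y h ∈ D → ∀ σ : AbsGal k,
      σ (changeX C' x) = changeX C' x ∧ σ (changeY C' x y) = changeY C' x y := by
    intro x y h hP σ
    obtain ⟨h', e⟩ := pointsAction_some E σ h
    have := hP σ
    rw [e, Point.some.injEq] at this
    rw [← changeX_map_algEquiv, ← changeY_map_algEquiv, this.1, this.2]
    exact ⟨rfl, rfl⟩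
  -- The reduction of a point in the coordinates of the good model, with `none` for the point at
  -- infinity.
  let r : (E⁄(AlgebraicClosure k)).toAffine.Point → Option
      (IsLocalRing.ResidueField w.valuationSubring × IsLocalRing.ResidueField w.valuationSubring) :=
    fun P => match P with
    | .zero => none
    | .some x y _ => if w (changeX C' x) ≤ 1 then
        some (red w (changeX C' x), red w (changeY C' x y)) else none
  have hr : ∀ P : D, r P ∈ insert none (Option.some ''
      ((baseResidue w : Set (IsLocalRing.ResidueField w.valuationSubring)) ×ˢ
        (baseResidue w : Set (IsLocalRing.ResidueField w.valuationSubring)))) := by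
    rintro ⟨_ | ⟨x, y, h⟩, hP⟩
    · exact Or.inl rfl
    by_cases hx : w (changeX C' x) ≤ 1
    · right
      refine ⟨(red w (changeX C' x), red w (changeY C' x y)), ⟨?_, ?_⟩, (if_pos hx).symm⟩
      · exact hfix _ (fun σ => (hxy x y h hP σ).1) hx
      · exact hfix _ (fun σ => (hxy x y h hP σ).2)
          (hV.valuation_y_le_one (nonsingular_change h) hx)
    · exact Or.inl (if_neg hx)
  have hnone : ∀ P, r P = none → ψ P ∈ H := by
    rintro (_ | ⟨x, y, h⟩) hP
    · exact H.zero_mem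
    · rw [hH, changePoint_some, reducesToZero_some]
      by_contra hx
      rw [not_lt] at hx
      have : some (red w (changeX C' x), red w (changeY C' x y)) = none :=
        (if_pos hx).symm.trans hP
      exact Option.some_ne_none _ this
  have hsub : ∀ P P', r P = r P' → ψ (P - P') ∈ H := by
    intro P P' h
    rw [map_sub]
    rcases hP : r P with _ | z
    · exact H.sub_mem (hnone _ hP) (hnone _ (h ▸ hP))
    · rw [hP] at h
      rcases P with _ | ⟨x, y, hxy⟩
      · exact absurd hP (Option.some_ne_none _).symm
      rcases P' with _ | ⟨x', y', hxy'⟩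
      · exact absurd h (Option.some_ne_none _)
      have aux : ∀ x y, (if w (changeX C' x) ≤ 1 then
          some (red w (changeX C' x), red w (changeY C' x y)) else none) = some z →
          w (changeX C' x) ≤ 1 ∧ red w (changeX C' x) = z.1 ∧ red w (changeY C' x y) = z.2 := by
        intro x y h
        split_ifs at h with h1
        rw [Option.some.injEq] at h
        subst h
        exact ⟨h1, rfl, rfl⟩
      obtain ⟨h1, h2, h3⟩ := aux _ _ hP
      obtain ⟨h1', h2', h3'⟩ := aux _ _ h.symm
      rw [hH, changePoint_some, changePoint_some]
      exact hV.reducesToZero_sub _ _ h1 h1' ((red_eq_iff h1 h1').mp (h2.trans h2'.symm))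
        ((red_eq_iff (hV.valuation_y_le_one (nonsingular_change hxy) h1)
          (hV.valuation_y_le_one (nonsingular_change hxy') h1')).mp (h3.trans h3'.symm))
  have hfin : Finite (insert none (Option.some ''
      ((baseResidue w : Set (IsLocalRing.ResidueField w.valuationSubring)) ×ˢ
        (baseResidue w : Set (IsLocalRing.ResidueField w.valuationSubring)))) : Set _) := by
    have : (baseResidue w : Set (IsLocalRing.ResidueField w.valuationSubring)).Finite :=
      Set.toFinite _
    exact (((this.prod this).image _).insert _).to_subtype
  have : Finite (D ⧸ (H.comap ψ).addSubgroupOf D) := by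
    refine Finite.of_injective (β := (insert none (Option.some ''
      ((baseResidue w : Set (IsLocalRing.ResidueField w.valuationSubring)) ×ˢ
        (baseResidue w : Set (IsLocalRing.ResidueField w.valuationSubring)))) : Set _))
      (fun q => ⟨r q.out, hr _⟩) fun q q' h => ?_
    rw [← QuotientAddGroup.out_eq' q, ← QuotientAddGroup.out_eq' q', QuotientAddGroup.eq,
      AddSubgroup.mem_addSubgroupOf, neg_add_eq_sub]
    exact hsub _ _ (congrArg Subtype.val h).symm
  exact AddSubgroup.index_ne_zero_of_finite

end GoodReduction

/-! ### Places of good reduction -/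

section GoodPlaces

open scoped Classical WeierstrassCurve
open WeierstrassCurve WeierstrassCurve.Affine

variable {K : Type u} [Field K] [NumberField K] (E : WeierstrassCurve K)
  {v : HeightOneSpectrum (𝓞 K)}

lemma extVal_natCast_eq_one {m : ℕ} (h : (m : 𝓞 K) ∉ v.asIdeal) :
    extVal v (m : AlgebraicClosure (v.adicCompletion K)) = 1 := by
  have h1 : v.valuation K (algebraMap (𝓞 K) K m) = 1 := by
    refine le_antisymm (v.valuation_le_one _) (not_lt.mp fun h' => h ?_)
    exact (v.valuation_lt_one_iff_mem _).mp h'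
  rw [map_natCast] at h1
  have h2 : Valued.v (algebraMap K (v.adicCompletion K) m) = 1 := by
    rw [valued_algebraMap, h1]
  rw [map_natCast] at h2
  have := (extVal_eq_iff v (m : v.adicCompletion K) 1).mpr (by rw [h2, map_one])
  rwa [map_one, map_one, map_natCast] at this

lemma exists_isGoodModel {m : ℕ} (hv : v ∉ badPlaces E m) :
    ∃ C : VariableChange (v.adicCompletion K), IsGoodModel (extVal v)
      ((C.map (algebraMap _ (AlgebraicClosure (v.adicCompletion K)))) •
        (E⁄(AlgebraicClosure (v.adicCompletion K)))) := by
  have hΔ : ¬ Valued.v ((E⁄(v.adicCompletion K)).minimal (v.adicCompletionIntegers K)).Δ < 1 :=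
    fun h => hv (Or.inr h)
  obtain ⟨C, hC⟩ : ∃ C : VariableChange (v.adicCompletion K),
      (E⁄(v.adicCompletion K)).minimal (v.adicCompletionIntegers K) = C • (E⁄(v.adicCompletion K)) :=
    ⟨_, rfl⟩
  set V := (E⁄(v.adicCompletion K)).minimal (v.adicCompletionIntegers K)
  set W₀ := integralModel (v.adicCompletionIntegers K) V
  let f : v.adicCompletionIntegers K →+* (extVal v).valuationSubring :=
    { toFun := fun x => ⟨algebraMap _ _ (x : v.adicCompletion K), (extVal_le_one_iff v _).mpr x.2⟩
      map_one' := Subtype.ext (by simp)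
      map_mul' := fun x y => Subtype.ext (by simp)
      map_zero' := Subtype.ext (by simp)
      map_add' := fun x y => Subtype.ext (by simp) }
  refine ⟨C, W₀.map f, ?_, ?_⟩
  · have h1 : C.map (algebraMap _ (AlgebraicClosure (v.adicCompletion K))) •
        (E⁄(AlgebraicClosure (v.adicCompletion K))) =
        V.map (algebraMap _ (AlgebraicClosure (v.adicCompletion K))) := by
      rw [hC, ← map_variableChange]
      congr 1
    rw [h1, ← baseChange_integralModel_eq (v.adicCompletionIntegers K) V]
    simp only [WeierstrassCurve.baseChange, WeierstrassCurve.map_map]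
    rfl
  · rw [map_Δ]
    refine IsUnit.map f ?_
    have h1 : Valued.v (W₀.Δ : v.adicCompletion K) = 1 := by
      refine le_antisymm W₀.Δ.2 (not_lt.mp ?_)
      have := integralModel_Δ_eq (v.adicCompletionIntegers K) V
      rw [← this] at hΔ
      exact hΔ
    exact (Valuation.valuationSubring.integers _).isUnit_iff_valuation_eq_one.mpr h1

lemma mem_inertia_iff_mem_inertiaSet (σ : AbsGal (v.adicCompletion K)) :
    σ ∈ inertia v ↔ σ ∈ inertiaSet (extVal v) := mem_inertia_iff v σ

end GoodPlaces

/-! ### Elements of a number field with valuations divisible by `m` -/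

section PowerClasses

open scoped nonZeroDivisors

variable {L : Type*} [Field L] [NumberField L]

/-- The multiplicity of every prime in the principal ideal is divisible by `m`. -/
lemma exists_span_eq_pow {m : ℕ} {r : 𝓞 L} (hr : r ≠ 0)
    (h : ∀ P : HeightOneSpectrum (𝓞 L), ∃ y : L, P.valuation L (algebraMap (𝓞 L) L r) =
      P.valuation L y ^ m) : ∃ J : Ideal (𝓞 L), Ideal.span {r} = J ^ m := by
  have hr' : Associates.mk (Ideal.span {r}) ≠ 0 := by
    rw [Ne, Associates.mk_eq_zero]
    simpa using hr
  obtain ⟨J, hJ⟩ := Associates.is_pow_of_dvd_count hr' (k := m) (by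
    intro p hp
    obtain ⟨p, rfl⟩ := Associates.mk_surjective p
    rw [Associates.irreducible_mk] at hp
    have hprime := hp.prime
    let P : HeightOneSpectrum (𝓞 L) := HeightOneSpectrum.ofPrime hprime
    obtain ⟨y, hy⟩ := h P
    rw [HeightOneSpectrum.valuation_of_algebraMap, HeightOneSpectrum.intValuation_if_neg _ hr] at hy
    have hy0 : P.valuation L y ≠ 0 ∨ m = 0 := by
      by_contra! hcon
      rw [hcon.1, zero_pow hcon.2] at hy
      exact WithZero.exp_ne_zero hy
    rcases hy0 with hy0 | rfl
    · rw [← WithZero.exp_log hy0, ← WithZero.exp_nsmul, WithZero.exp_inj] at hy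
      have h2 : (m : ℤ) ∣ ((Associates.mk P.asIdeal).count (Associates.mk (Ideal.span {r})).factors : ℤ) := by
        refine ⟨-(WithZero.log (P.valuation L y)), ?_⟩
        rw [nsmul_eq_mul] at hy
        linarith
      exact_mod_cast h2
    · rw [pow_zero, ← WithZero.exp_zero, WithZero.exp_inj, neg_eq_zero] at hy
      have h2 : (Associates.mk P.asIdeal).count (Associates.mk (Ideal.span {r})).factors = 0 := by
        exact_mod_cast hy
      exact Nat.zero_dvd.mpr h2)
  obtain ⟨J, rfl⟩ := Associates.mk_surjective J
  rw [← Associates.mk_pow, Associates.mk_eq_mk_iff_associated, associated_iff_eq] at hJ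
  exact ⟨J, hJ⟩

/-- There are finitely many `m`-th power classes with all valuations divisible by `m`. -/
lemma exists_bound_powerClasses (L : Type*) [Field L] [NumberField L] {m : ℕ} (hm : m ≠ 0) :
    ∃ B : ℕ, ∀ T : Finset L, (∀ x ∈ T, x ≠ 0) →
      (∀ x ∈ T, ∀ P : HeightOneSpectrum (𝓞 L), ∃ y : L, P.valuation L x = P.valuation L y ^ m) →
      (∀ x ∈ T, ∀ y ∈ T, (∃ z, x = y * z ^ m) → x = y) → T.card ≤ B := by
  classical
  have hU : Finite ((𝓞 L)ˣ ⧸ (powMonoidHom (α := (𝓞 L)ˣ) m).range) := by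
    have : Group.FG (𝓞 L)ˣ := Group.fg_iff_monoid_fg.mpr inferInstance
    exact Subgroup.finiteIndex_iff_finite_quotient.mp
      (Subgroup.finiteIndex_range_powMonoidHom_of_fg _ hm)
  refine ⟨Nat.card (ClassGroup (𝓞 L) × ((𝓞 L)ˣ ⧸ (powMonoidHom (α := (𝓞 L)ˣ) m).range)), ?_⟩
  intro T hT hval hTm
  -- Multiplication by an `m`-th power makes `x` integral; the ideal it then generates is an `m`-th
  -- power `J ^ m`.
  have h1 : ∀ x ∈ T, ∃ (z : L) (r : 𝓞 L) (J : (Ideal (𝓞 L))⁰), z ≠ 0 ∧ r ≠ 0 ∧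
      x * z ^ m = algebraMap (𝓞 L) L r ∧ Ideal.span {r} = (J : Ideal (𝓞 L)) ^ m := by
    intro x hx
    obtain ⟨a, b, hb, rfl⟩ := IsFractionRing.div_surjective (A := 𝓞 L) x
    have hb0 : algebraMap (𝓞 L) L b ≠ 0 := by
      rw [Ne, FaithfulSMul.algebraMap_eq_zero_iff]
      exact nonZeroDivisors.ne_zero hb
    have ha0 : a ≠ 0 := by
      rintro rfl
      exact hT _ hx (by simp)
    have hr0 : a * b ^ (m - 1) ≠ 0 := mul_ne_zero ha0 (pow_ne_zero _ (nonZeroDivisors.ne_zero hb))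
    have he : algebraMap (𝓞 L) L a / algebraMap (𝓞 L) L b * algebraMap (𝓞 L) L b ^ m =
        algebraMap (𝓞 L) L (a * b ^ (m - 1)) := by
      conv_lhs => rw [← Nat.succ_pred_eq_of_ne_zero hm]
      rw [pow_succ', map_mul, map_pow, Nat.pred_eq_sub_one]
      field_simp
    obtain ⟨J, hJ⟩ := exists_span_eq_pow (m := m) hr0 (by
      intro P
      obtain ⟨y, hy⟩ := hval _ hx P
      exact ⟨y * algebraMap (𝓞 L) L b, by rw [← he, map_mul, hy, map_pow, map_mul, mul_pow]⟩)
    refine ⟨algebraMap (𝓞 L) L b, _, ⟨J, mem_nonZeroDivisors_of_ne_zero ?_⟩, hb0, hr0, he, hJ⟩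
    rintro rfl
    rw [zero_pow hm, Submodule.zero_eq_bot, Ideal.span_singleton_eq_bot] at hJ
    exact hr0 hJ
  choose! z r J hz hr hxz hJ using h1
  have h2 : ∀ x ∈ T, ∀ y ∈ T, ClassGroup.mk0 (J x) = ClassGroup.mk0 (J y) →
      ∃ (ε : (𝓞 L)ˣ) (t : L), x = y * t ^ m * algebraMap (𝓞 L) L ε := by
    intro x hx y hy h
    obtain ⟨a, b, ha, hb, hab⟩ := ClassGroup.mk0_eq_mk0_iff.mp h
    have h3 : Ideal.span {a ^ m * r x} = Ideal.span {b ^ m * r y} := by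
      rw [← Ideal.span_singleton_mul_span_singleton, ← Ideal.span_singleton_mul_span_singleton,
        ← Ideal.span_singleton_pow, ← Ideal.span_singleton_pow, hJ x hx, hJ y hy, ← mul_pow,
        ← mul_pow, hab]
    obtain ⟨ε, hε⟩ := (Ideal.span_singleton_eq_span_singleton.mp h3).symm
    have ha' : algebraMap (𝓞 L) L a ≠ 0 := by simpa using ha
    refine ⟨ε, algebraMap (𝓞 L) L b * z y / (algebraMap (𝓞 L) L a * z x), ?_⟩
    have h4 := congrArg (algebraMap (𝓞 L) L) hε
    simp only [map_mul, map_pow] at h4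
    rw [← hxz x hx, ← hxz y hy] at h4
    have hzx := hz x hx
    rw [div_pow, mul_pow, mul_pow]
    field_simp
    linear_combination -h4
  -- One element of `T` is chosen for each ideal class that occurs. Elements of `T` with the same
  -- class of `J` differ by a unit times an `m`-th power, so the ideal class, together with the
  -- class of that unit modulo `m`-th powers, determines an element of `T`.
  let rep : ClassGroup (𝓞 L) → L := fun κ =>
    if h : ∃ x ∈ T, ClassGroup.mk0 (J x) = κ then h.choose else 0
  have hrep : ∀ x ∈ T, rep (ClassGroup.mk0 (J x)) ∈ T ∧
      ClassGroup.mk0 (J x) = ClassGroup.mk0 (J (rep (ClassGroup.mk0 (J x)))) := by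
    intro x hx
    have h : ∃ y ∈ T, ClassGroup.mk0 (J y) = ClassGroup.mk0 (J x) := ⟨x, hx, rfl⟩
    have : rep (ClassGroup.mk0 (J x)) = h.choose := dif_pos h
    rw [this]
    exact ⟨h.choose_spec.1, h.choose_spec.2.symm⟩
  have h3 : ∀ x ∈ T, ∃ (ε : (𝓞 L)ˣ) (t : L),
      x = rep (ClassGroup.mk0 (J x)) * t ^ m * algebraMap (𝓞 L) L ε :=
    fun x hx => h2 x hx _ (hrep x hx).1 (hrep x hx).2
  choose! ε t hεt using h3
  let f : T → ClassGroup (𝓞 L) × ((𝓞 L)ˣ ⧸ (powMonoidHom (α := (𝓞 L)ˣ) m).range) := fun x =>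
    (ClassGroup.mk0 (J x), QuotientGroup.mk (ε x))
  have hf : Function.Injective f := by
    rintro ⟨x, hx⟩ ⟨y, hy⟩ h
    refine Subtype.ext (hTm x hx y hy ?_)
    have e1 : ClassGroup.mk0 (J x) = ClassGroup.mk0 (J y) := congrArg Prod.fst h
    obtain ⟨η, hη⟩ := QuotientGroup.eq.mp (congrArg Prod.snd h).symm
    have e2 : ε x = ε y * η ^ m := by
      rw [eq_comm, ← eq_inv_mul_iff_mul_eq]
      exact hη
    have e3 : x = rep (ClassGroup.mk0 (J x)) * t x ^ m * algebraMap (𝓞 L) L (ε x) := hεt x hx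
    have e4 : y = rep (ClassGroup.mk0 (J x)) * t y ^ m * algebraMap (𝓞 L) L (ε y) := by
      rw [e1]; exact hεt y hy
    have ht : t y ≠ 0 := by
      intro h0
      rw [h0, zero_pow hm] at e4
      exact hT y hy (by rw [e4]; simp)
    refine ⟨t x / t y * algebraMap (𝓞 L) L (η : (𝓞 L)ˣ), ?_⟩
    have e5 : algebraMap (𝓞 L) L (ε x) =
        algebraMap (𝓞 L) L (ε y) * algebraMap (𝓞 L) L (η : (𝓞 L)ˣ) ^ m := by
      rw [e2, Units.val_mul, Units.val_pow_eq_pow_val, map_mul, map_pow]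
    rw [e5] at e3
    calc x = _ := e3
      _ = (rep (ClassGroup.mk0 (J x)) * t y ^ m * algebraMap (𝓞 L) L (ε y)) *
          (t x / t y * algebraMap (𝓞 L) L (η : (𝓞 L)ˣ)) ^ m := by
        rw [mul_pow, div_pow]
        field_simp
      _ = _ := by rw [← e4]
  have := Nat.card_le_card_of_injective f hf
  rwa [Nat.card_eq_fintype_card, Fintype.card_coe] at this

end PowerClasses

/-! ### Finiteness of the locally trivial cocycles -/

section LocalValues

variable {K : Type u} [Field K] [NumberField K] (v : HeightOneSpectrum (𝓞 K))

attribute [local instance] charZero_adicCompletion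

/-- The valuation of `K̄` given by a place `v` and the embedding `K̄ → K̄_v`. -/
def globVal : Valuation (AlgebraicClosure K) ℝ≥0 :=
  (extVal v).comap (closureEmb K (v.adicCompletion K)).toRingHom

lemma globVal_apply (x : AlgebraicClosure K) :
    globVal v x = extVal v (closureEmb K (v.adicCompletion K) x) := rfl

variable {v} in
/-- A nonzero element of `K_v` has the value of an element of `K`. -/
lemma exists_valued_eq (a : v.adicCompletion K) :
    ∃ y : K, extVal v (algebraMap _ _ a) = globVal v (algebraMap K _ y) := by
  have h : ∃ y : K, Valued.v a = Valued.v (algebraMap K (v.adicCompletion K) y) := by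
    by_cases ha : a = 0
    · exact ⟨0, by rw [ha, map_zero, map_zero, map_zero]⟩
    · obtain ⟨y, hy⟩ := exists_valued_sub_lt v a a ha
      exact ⟨y, (Valuation.map_eq_of_sub_lt _ (by rwa [Valuation.map_sub_swap])).symm⟩
  obtain ⟨y, hy⟩ := h
  refine ⟨y, ?_⟩
  rw [globVal_apply, AlgHom.commutes, IsScalarTower.algebraMap_apply K (v.adicCompletion K)]
  exact (extVal_eq_iff v _ _).mpr hy

variable {v} in
lemma exists_globVal_eq_of_fixed_inertia {x : AlgebraicClosure (v.adicCompletion K)}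
    (hx : ∀ σ ∈ inertia v, σ x = x) :
    ∃ y : K, extVal v x = globVal v (algebraMap K _ y) := by
  obtain ⟨a, ha⟩ := exists_val_eq_of_fixed (isLocalVal_extVal v) (x := x)
    (fun σ hσ => hx σ ((mem_inertia_iff_mem_inertiaSet σ).mpr hσ))
  rw [ha]
  exact exists_valued_eq a

variable {v} in
-- `L` is dense in the `K_v`-algebra it generates. Approximation to every precision is needed for
-- the induction over products.
lemma exists_sub_lt_of_mem_adjoin (L : IntermediateField K (AlgebraicClosure K))
    {x : AlgebraicClosure (v.adicCompletion K)}
    (hx : x ∈ Algebra.adjoin (v.adicCompletion K)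
      (closureEmb K (v.adicCompletion K) '' (L : Set (AlgebraicClosure K)))) :
    ∀ c : AlgebraicClosure (v.adicCompletion K), c ≠ 0 → ∃ y ∈ L,
      extVal v (x - closureEmb K (v.adicCompletion K) y) < extVal v c := by
  induction hx using Algebra.adjoin_induction with
  | mem x hx =>
    obtain ⟨y, hy, rfl⟩ := hx
    intro c hc
    refine ⟨y, hy, ?_⟩
    rw [sub_self, map_zero, zero_lt_iff]
    exact (extVal v).ne_zero_iff.mpr hc
  | algebraMap a =>
    intro c hc
    obtain ⟨ϖ, hϖ0, hϖ, -⟩ := (isLocalVal_extVal v).exists_uniformizer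
    obtain ⟨n, hn⟩ := exists_pow_lt_of_lt_one (zero_lt_iff.mpr ((extVal v).ne_zero_iff.mpr hc)) hϖ
    obtain ⟨y, hy⟩ := exists_valued_sub_lt v a (ϖ ^ n) (pow_ne_zero _ hϖ0)
    refine ⟨algebraMap K _ y, L.algebraMap_mem y, lt_trans ?_ hn⟩
    rw [AlgHom.commutes, IsScalarTower.algebraMap_apply K (v.adicCompletion K), ← map_sub,
      ← map_pow, ← map_pow]
    exact (extVal_lt_iff v _ _).mpr hy
  | add x x' _ _ h h' =>
    intro c hc
    obtain ⟨y, hy, h⟩ := h c hc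
    obtain ⟨y', hy', h'⟩ := h' c hc
    refine ⟨y + y', add_mem hy hy', ?_⟩
    rw [map_add, add_sub_add_comm]
    exact (extVal v).map_add_lt h h'
  | mul x x' _ _ h h' =>
    intro c hc
    obtain ⟨y, hy, h1⟩ : ∃ y ∈ L, extVal v ((x - closureEmb K (v.adicCompletion K) y) * x') <
        extVal v c := by
      by_cases hx' : x' = 0
      · refine ⟨0, zero_mem L, ?_⟩
        rw [hx', mul_zero, map_zero, zero_lt_iff]
        exact (extVal v).ne_zero_iff.mpr hc
      · obtain ⟨y, hy, h1⟩ := h (c / x') (div_ne_zero hc hx')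
        refine ⟨y, hy, ?_⟩
        rw [map_mul]
        rwa [map_div₀, lt_div_iff₀ (zero_lt_iff.mpr ((extVal v).ne_zero_iff.mpr hx'))] at h1
    obtain ⟨y', hy', h2⟩ : ∃ y' ∈ L, extVal v (closureEmb K (v.adicCompletion K) y *
        (x' - closureEmb K (v.adicCompletion K) y')) < extVal v c := by
      by_cases hy0 : closureEmb K (v.adicCompletion K) y = 0
      · refine ⟨0, zero_mem L, ?_⟩
        rw [hy0, zero_mul, map_zero, zero_lt_iff]
        exact (extVal v).ne_zero_iff.mpr hc
      · obtain ⟨y', hy', h1⟩ := h' (c / closureEmb K (v.adicCompletion K) y) (div_ne_zero hc hy0)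
        refine ⟨y', hy', ?_⟩
        rw [map_mul, mul_comm]
        rwa [map_div₀, lt_div_iff₀ (zero_lt_iff.mpr ((extVal v).ne_zero_iff.mpr hy0))] at h1
    refine ⟨y * y', mul_mem hy hy', ?_⟩
    rw [map_mul]
    have := (extVal v).map_add_lt h1 h2
    convert this using 2
    ring

variable {v} in
-- By Galois theory `x` lies in the compositum of `K_v` and `L`, where `L` is dense; an element of
-- `L` closer to `x` than the size of `x` has the same value.
lemma exists_globVal_eq_of_fixed (N : Subgroup (AbsGal K)) (hN : IsOpen (N : Set (AbsGal K)))
    {x : AlgebraicClosure (v.adicCompletion K)}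
    (hx : ∀ σ, galRes K (v.adicCompletion K) σ ∈ N → σ x = x) :
    ∃ y ∈ (IntermediateField.fixedField N : IntermediateField K (AlgebraicClosure K)),
      extVal v x = globVal v y := by
  set L : IntermediateField K (AlgebraicClosure K) := IntermediateField.fixedField N
  have hL : L.fixingSubgroup = N :=
    InfiniteGalois.fixingSubgroup_fixedField ⟨N, N.isClosed_of_isOpen hN⟩
  by_cases hx0 : x = 0
  · exact ⟨0, zero_mem L, by rw [hx0, map_zero, map_zero]⟩
  let S := closureEmb K (v.adicCompletion K) '' (L : Set (AlgebraicClosure K))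
  have hmem : x ∈ IntermediateField.adjoin (v.adicCompletion K) S := by
    rw [← InfiniteGalois.fixedField_fixingSubgroup (IntermediateField.adjoin _ S)]
    rintro ⟨σ, hσ⟩
    refine hx σ ?_
    rw [← hL]
    rintro ⟨y, hy⟩
    refine (closureEmb K (v.adicCompletion K)).injective ?_
    exact (closureEmb_galResHom K (v.adicCompletion K) σ y).trans
      (hσ ⟨_, IntermediateField.subset_adjoin _ S ⟨y, hy, rfl⟩⟩)
  have hmem' : x ∈ Algebra.adjoin (v.adicCompletion K) S := by
    rw [← IntermediateField.adjoin_toSubalgebra_of_isAlgebraic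
      (fun y _ => Algebra.IsAlgebraic.isAlgebraic y)]
    exact hmem
  obtain ⟨y, hy, h⟩ := exists_sub_lt_of_mem_adjoin L hmem' x hx0
  exact ⟨y, hy, (Valuation.map_eq_of_sub_lt _ (by rwa [Valuation.map_sub_swap])).symm⟩

end LocalValues

/-! ### Primes of a Galois extension and embeddings into completions -/

section Transitivity

variable {R F Γ : Type*} [CommRing R] [IsDedekindDomain R] [Field F] [Algebra R F]
  [IsFractionRing R F] [LinearOrderedCommGroupWithZero Γ]

/-- If `t` is `P`-integral, write `t = n / d` with `d` outside `P`. From `w t = 1` it follows that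
`n` is outside `P` as well, so `t` is a `P`-adic unit. Otherwise the same applies to `t⁻¹`. -/
lemma valuation_eq_one_of_eq_one (P : HeightOneSpectrum R) (w : Valuation F Γ)
    (h1 : ∀ r : R, w (algebraMap R F r) ≤ 1) (h2 : ∀ r : R, w (algebraMap R F r) < 1 ↔ r ∈ P.asIdeal)
    {t : F} (ht : w t = 1) : P.valuation F t = 1 := by
  have key : ∀ t : F, w t = 1 → P.valuation F t ≤ 1 → P.valuation F t = 1 := by
    intro t ht hle
    obtain ⟨n, ⟨d, hd⟩, hnd⟩ := P.exists_primeCompl_mul_eq_of_integer t hle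
    have hd1 : w (algebraMap R F d) = 1 :=
      le_antisymm (h1 d) (not_lt.mp fun h => hd ((h2 d).mp h))
    have hn : n ∉ P.asIdeal := by
      rw [← h2, ← hnd, map_mul, ht, one_mul]
      exact hd1.not_lt
    have hv : ∀ r : R, r ∉ P.asIdeal → P.valuation F (algebraMap R F r) = 1 := fun r hr =>
      le_antisymm (P.valuation_le_one _) (not_lt.mp fun h => hr ((P.valuation_lt_one_iff_mem _).mp h))
    have := congrArg (P.valuation F) hnd
    rwa [map_mul, hv n hn, hv d hd, mul_one] at this
  by_cases hle : P.valuation F t ≤ 1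
  · exact key t ht hle
  · have := key t⁻¹ (by rw [map_inv₀, ht, inv_one]) (by
      rw [map_inv₀]
      exact inv_le_one_of_one_le₀ (not_le.mp hle).le)
    rwa [map_inv₀, inv_eq_one] at this

variable {K : Type u} [Field K] [NumberField K]

lemma globVal_le_one_of_isIntegral (v : HeightOneSpectrum (𝓞 K)) {x : AlgebraicClosure K}
    (hx : IsIntegral ℤ x) : globVal v x ≤ 1 := by
  rw [globVal_apply, extVal_le_one_iff_isIntegral]
  obtain ⟨p, hp, h0⟩ := hx
  refine ⟨p.map (Int.castRingHom _), hp.map _, ?_⟩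
  rw [Polynomial.eval₂_map, Subsingleton.elim (RingHom.comp _ _)
    ((closureEmb K (v.adicCompletion K)).toRingHom.comp (algebraMap ℤ (AlgebraicClosure K)))]
  exact (Polynomial.hom_eval₂ p _ _ x).symm.trans (by rw [h0, map_zero])

/-- Every prime of a Galois extension is a conjugate of one given by an embedding in `K̄_v`. -/
lemma exists_galois_conj (L : IntermediateField K (AlgebraicClosure K)) [FiniteDimensional K L]
    [IsGalois K L] [NumberField L] (P : HeightOneSpectrum (𝓞 L)) :
    ∃ (v : HeightOneSpectrum (𝓞 K)) (τ : AbsGal K),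
      ∀ r : 𝓞 L, globVal v (τ (algebraMap L _ (algebraMap (𝓞 L) L r))) < 1 ↔ r ∈ P.asIdeal := by
  let v := P.under (𝓞 K)
  let u : Valuation L ℝ≥0 := (globVal v).comap (algebraMap L (AlgebraicClosure K))
  have hu : ∀ r : 𝓞 L, u (algebraMap (𝓞 L) L r) ≤ 1 := fun r =>
    globVal_le_one_of_isIntegral v (r.isIntegral_coe.map (algebraMap L (AlgebraicClosure K)).toIntAlgHom)
  -- `Q` is the prime of `L` cut out by the embedding into `K̄_v`. It lies above `v`, as `P` does,
  -- and the Galois group permutes these primes transitively.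
  let Q : Ideal (𝓞 L) :=
    { carrier := {r | u (algebraMap (𝓞 L) L r) < 1}
      add_mem' := fun {a b} ha hb => by
        simp only [Set.mem_ofPred_eq] at ha hb ⊢
        rw [map_add]
        exact u.map_add_lt ha hb
      zero_mem' := by simp
      smul_mem' := fun c x hx => by
        simp only [Set.mem_ofPred_eq, smul_eq_mul] at hx ⊢
        rw [map_mul, map_mul]
        exact (mul_le_of_le_one_left' (hu c)).trans_lt hx }
  have hmemQ : ∀ r, r ∈ Q ↔ u (algebraMap (𝓞 L) L r) < 1 := fun _ => Iff.rfl
  have hQ : Q.IsPrime := by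
    refine ⟨fun h => ?_, fun {a b} hab => ?_⟩
    · have : (1 : 𝓞 L) ∈ Q := h ▸ Submodule.mem_top
      rw [hmemQ, map_one, map_one] at this
      exact lt_irrefl _ this
    · by_contra! hcon
      rw [hmemQ, hmemQ, not_lt, not_lt] at hcon
      rw [hmemQ, map_mul, map_mul] at hab
      exact hab.not_ge (one_le_mul hcon.1 hcon.2)
  have hunder : P.asIdeal.under (𝓞 K) = Q.under (𝓞 K) := by
    ext r
    rw [Ideal.under_def, Ideal.under_def, Ideal.mem_comap, Ideal.mem_comap, hmemQ]
    have h1 : u (algebraMap (𝓞 L) L (algebraMap (𝓞 K) (𝓞 L) r)) =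
        extVal v (algebraMap (v.adicCompletion K) _ (algebraMap K _ (algebraMap (𝓞 K) K r))) := by
      rw [← IsScalarTower.algebraMap_apply (𝓞 K) (𝓞 L) L, IsScalarTower.algebraMap_apply (𝓞 K) K L]
      change globVal v (algebraMap L _ (algebraMap K L (algebraMap (𝓞 K) K r))) = _
      rw [← IsScalarTower.algebraMap_apply K L, globVal_apply, AlgHom.commutes,
        IsScalarTower.algebraMap_apply K (v.adicCompletion K)]
    rw [h1, extVal_lt_one_iff, valued_algebraMap, HeightOneSpectrum.valuation_lt_one_iff_mem]
    rfl
  obtain ⟨g, hg⟩ := Algebra.IsInvariant.exists_smul_of_under_eq (𝓞 K) (𝓞 L) Gal(L/K) Q P.asIdeal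
    hunder.symm
  refine ⟨v, (g⁻¹ : Gal(L/K)).liftNormal (AlgebraicClosure K), fun r => ?_⟩
  rw [AlgEquiv.liftNormal_commutes, hg, Ideal.mem_pointwise_smul_iff_inv_smul_mem, hmemQ]
  rfl

end Transitivity

/-! ### Cocycles satisfying the local conditions everywhere -/

section FiniteLocallyTrivial

variable {K : Type u} [Field K] [NumberField K] {A : Type*} [AddCommGroup A]
  (act : AbsGal K →* AddMonoid.End A)

/-- The cocycle `c` is trivial at `v`, or unramified at `v` with `A` unramified and `v ∤ m`. -/
def IsLocallySmall (m : ℕ) (c : AbsGal K → A) (v : HeightOneSpectrum (𝓞 K)) : Prop :=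
  ((m : 𝓞 K) ∉ v.asIdeal ∧ ∀ σ ∈ inertia v, act (galRes K (v.adicCompletion K) σ) = 1 ∧
    c (galRes K (v.adicCompletion K) σ) = 0) ∨
  ∃ a, ∀ σ, c (galRes K (v.adicCompletion K) σ) = act (galRes K (v.adicCompletion K) σ) a - a

variable {act}

omit [NumberField K] in
lemma conj_mem_kummerSubgroup {m : ℕ} {ρ : AbsGal K} (hρ : ρ ∈ kummerSubgroup act m)
    (τ : AbsGal K) : τ⁻¹ * ρ * τ ∈ kummerSubgroup act m := by
  refine ⟨?_, fun ζ hζ => ?_⟩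
  · rw [map_mul, map_mul, hρ.1, mul_one, ← map_mul, inv_mul_cancel, map_one]
  · change τ.symm (ρ (τ ζ)) = ζ
    rw [hρ.2 (τ ζ) (by rw [← map_pow, hζ, map_one]), AlgEquiv.symm_apply_apply]

omit [NumberField K] in
-- On the Kummer subgroup a cocycle is an equivariant homomorphism. Vanishing is therefore stable
-- under conjugation, which allows passing from `β` to its conjugates.
lemma IsCocycle.conj {m : ℕ} {c : AbsGal K → A} (hc : IsCocycle act c) {ρ : AbsGal K}
    (hρ : ρ ∈ kummerSubgroup act m) (τ : AbsGal K) : c (τ⁻¹ * ρ * τ) = act τ⁻¹ (c ρ) := by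
  have h1 : c τ⁻¹ + act τ⁻¹ (c τ) = 0 := by
    rw [← hc.map_mul, inv_mul_cancel, hc.map_one]
  have h2 : act (τ⁻¹ * ρ) (c τ) = act τ⁻¹ (c τ) := by
    rw [act_mul_apply, hρ.1]; rfl
  rw [hc.map_mul, hc.map_mul, h2, add_right_comm, h1, zero_add]

/-- The local condition makes the value of a Kummer generator that of an element of the field. -/
lemma exists_globVal_eq_of_isLocallySmall {m : ℕ} (hm : m ≠ 0) (hopen : IsOpen {g | act g = 1})
    {c : AbsGal K → A} (hc : IsCocycle act c) {v : HeightOneSpectrum (𝓞 K)}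
    (hv : IsLocallySmall act m c v) (ψ : Multiplicative A →* (AlgebraicClosure K)ˣ)
    {β : AlgebraicClosure K}
    (hβ : ∀ σ ∈ kummerSubgroup act m, σ β = ψ (Multiplicative.ofAdd (c σ)) * β) (τ : AbsGal K) :
    ∃ y ∈ (IntermediateField.fixedField (kummerSubgroup act m) :
      IntermediateField K (AlgebraicClosure K)), globVal v (τ β) = globVal v y := by
  have hfix : ∀ σ : AbsGal (v.adicCompletion K),
      galRes K (v.adicCompletion K) σ ∈ kummerSubgroup act m →
      c (galRes K (v.adicCompletion K) σ) = 0 →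
      σ (closureEmb K (v.adicCompletion K) (τ β)) = closureEmb K (v.adicCompletion K) (τ β) := by
    intro σ hσ h0
    rw [← closureEmb_galResHom]
    congr 1
    set ρ := galRes K (v.adicCompletion K) σ
    have h1 := hβ _ (conj_mem_kummerSubgroup hσ τ)
    rw [hc.conj hσ, h0, map_zero, ofAdd_zero, map_one, Units.val_one, one_mul] at h1
    have h2 : τ.symm (ρ (τ β)) = β := h1
    rw [AlgEquiv.symm_apply_eq] at h2
    exact h2
  rcases hv with ⟨hvm, h⟩ | ⟨a, ha⟩
  -- Inertia at a place not dividing `m` fixes the `m`-th roots of unity, since these have distinct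
  -- residues; so it lies in the Kummer subgroup.
  · have hmem : ∀ σ ∈ inertia v, galRes K (v.adicCompletion K) σ ∈ kummerSubgroup act m := by
      refine fun σ hσ => ⟨(h σ hσ).1, fun ζ hζ => ?_⟩
      refine (closureEmb K (v.adicCompletion K)).injective ?_
      refine (closureEmb_galResHom K (v.adicCompletion K) σ ζ).trans ?_
      have hζ' : closureEmb K (v.adicCompletion K) ζ ^ m = 1 := by rw [← map_pow, hζ, map_one]
      refine eq_of_pow_eq_one (extVal_natCast_eq_one hvm) (by rw [← map_pow, hζ', map_one]) hζ' ?_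
      exact (mem_inertia_iff v σ).mp hσ _ (val_eq_one_of_pow_eq_one hm hζ').le
    obtain ⟨y, hy⟩ := exists_globVal_eq_of_fixed_inertia (v := v)
      (x := closureEmb K (v.adicCompletion K) (τ β))
      fun σ hσ => hfix σ (hmem σ hσ) (h σ hσ).2
    exact ⟨_, IntermediateField.algebraMap_mem _ y, hy⟩
  -- A coboundary vanishes on the elements acting trivially on `A`.
  · refine exists_globVal_eq_of_fixed _ (isOpen_kummerSubgroup act hopen hm) fun σ hσ => hfix σ hσ ?_
    rw [ha, hσ.1]
    exact sub_self a

/-- There are finitely many locally trivial cocycles. -/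
lemma finite_isLocallySmall [Finite A] {m : ℕ} (hm : m ≠ 0) (hmA : ∀ a : A, m • a = 0)
    (hopen : IsOpen {g | act g = 1}) :
    Finite {c | IsCocycle act c ∧ ∀ v, IsLocallySmall act m c v} := by
  set N := kummerSubgroup act m
  set L : IntermediateField K (AlgebraicClosure K) := IntermediateField.fixedField N
  have hN : IsOpen (N : Set (AbsGal K)) := isOpen_kummerSubgroup act hopen hm
  have hL : L.fixingSubgroup = N :=
    InfiniteGalois.fixingSubgroup_fixedField ⟨N, N.isClosed_of_isOpen hN⟩
  have hNn : N.Normal := ⟨fun ρ hρ τ => by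
    simpa using conj_mem_kummerSubgroup hρ τ⁻¹⟩
  have hrank := IntermediateField.finrank_eq_fixingSubgroup_index (AlgebraicClosure K) L
  rw [hL] at hrank
  have hfi : Finite (AbsGal K ⧸ N) := Subgroup.quotient_finite_of_isOpen N hN
  have : N.FiniteIndex := Subgroup.finiteIndex_of_finite_quotient
  have : FiniteDimensional K L :=
    FiniteDimensional.of_finrank_pos (hrank ▸ Nat.pos_of_ne_zero Subgroup.FiniteIndex.index_ne_zero)
  have hnorm : Normal K L := by
    have : L.fixingSubgroup.Normal := hL ▸ hNn
    exact (InfiniteGalois.normal_iff_isGalois L).mp this |>.to_normal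
  have : IsGalois K L := ⟨⟩
  have : NumberField L := NumberField.of_module_finite K L
  obtain ⟨B, hB⟩ := exists_bound_powerClasses L hm
  -- The property imposed on a Kummer generator `β` is that all its conjugates have, at every place,
  -- the value of an element of `L`. It makes the valuations of `β ^ m` in `L` divisible by `m`.
  refine (card_cocycles_le act hm hmA hopen _ (fun c hc => hc.1)
    (fun β => ∀ v (τ : AbsGal K), ∃ y ∈ L, globVal v (τ β) = globVal v y) ?_ (B := B) ?_).1
  · intro c hc ψ β hβ h v τ
    exact exists_globVal_eq_of_isLocallySmall hm hopen hc.1 (hc.2 v) ψ h τ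
  intro T hT hp hTm
  refine hB T hT (fun x hx P => ?_) hTm
  obtain ⟨β, hβ, hxβ⟩ := hp x hx
  obtain ⟨v, τ, h⟩ := exists_galois_conj L P
  obtain ⟨y, hy, hyv⟩ := hβ v τ
  have hy' : τ⁻¹ y ∈ L := by
    rintro ⟨ρ, hρ⟩
    have h1 := hNn.conj_mem ρ hρ τ
    have h2 : τ (ρ (τ⁻¹ y)) = y := hy ⟨_, h1⟩
    change ρ (τ⁻¹ y) = τ.symm y
    rw [AlgEquiv.eq_symm_apply]
    exact h2
  have hx0 : x ≠ 0 := hT x hx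
  have hβ0 : β ≠ 0 := by
    rintro rfl
    rw [zero_pow hm] at hxβ
    exact hx0 (by exact_mod_cast hxβ)
  have hτy : τ (τ⁻¹ y) = y := τ.apply_symm_apply y
  have hy0 : globVal v y ≠ 0 := by
    rw [← hyv, (globVal v).ne_zero_iff]
    simpa using hβ0
  refine ⟨⟨τ⁻¹ y, hy'⟩, ?_⟩
  have hne : (⟨τ⁻¹ y, hy'⟩ : L) ^ m ≠ 0 := by
    refine pow_ne_zero _ fun h0 => hy0 ?_
    have : τ⁻¹ y = 0 := congrArg Subtype.val h0
    rw [← hτy, this, map_zero, map_zero]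
  let w : Valuation L ℝ≥0 :=
    (globVal v).comap ((τ : AlgebraicClosure K →+* AlgebraicClosure K).comp
      (algebraMap L (AlgebraicClosure K)))
  have hw : ∀ z : L, w z = globVal v (τ z) := fun _ => rfl
  -- The valuation `w` has centre `P`, and `x = β ^ m` has the same value under it as the `m`-th
  -- power of `τ⁻¹ y`. So the quotient is a `P`-adic unit.
  have h1 := valuation_eq_one_of_eq_one P w (fun r => ?_) h
    (t := x / (⟨τ⁻¹ y, hy'⟩ : L) ^ m) ?_
  · rw [map_div₀, map_pow, div_eq_one_iff_eq] at h1
    · exact h1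
    · rw [← map_pow]
      exact (P.valuation L).ne_zero_iff.mpr hne
  · refine globVal_le_one_of_isIntegral v ?_
    exact r.isIntegral_coe.map ((τ : AlgebraicClosure K →+* AlgebraicClosure K).comp
      (algebraMap L (AlgebraicClosure K))).toIntAlgHom
  · rw [map_div₀, map_pow, hw, hw, hxβ, map_pow, map_pow, hyv]
    change _ / globVal v (τ (τ⁻¹ y)) ^ m = 1
    rw [hτy]
    exact div_self (pow_ne_zero _ hy0)

end FiniteLocallyTrivial

/-! ### The bad places -/

section BadPlaces

open scoped Classical WeierstrassCurve
open WeierstrassCurve WeierstrassCurve.Affine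

variable {K : Type u} [Field K] [NumberField K] (E : WeierstrassCurve K)

/-- The given equation is already integral at `v` with unit discriminant. A minimal equation
maximizes the multiplicative valuation of the discriminant among integral ones, so it attains `1`
too. -/
lemma valued_minimal_Δ_eq_one {v : HeightOneSpectrum (𝓞 K)}
    (h₁ : v.valuation K E.a₁ ≤ 1) (h₂ : v.valuation K E.a₂ ≤ 1) (h₃ : v.valuation K E.a₃ ≤ 1)
    (h₄ : v.valuation K E.a₄ ≤ 1) (h₆ : v.valuation K E.a₆ ≤ 1) (hΔ : v.valuation K E.Δ = 1) :
    Valued.v ((E⁄(v.adicCompletion K)).minimal (v.adicCompletionIntegers K)).Δ = 1 := by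
  obtain ⟨C, hC⟩ : ∃ C : VariableChange (v.adicCompletion K),
      (E⁄(v.adicCompletion K)).minimal (v.adicCompletionIntegers K) = C • (E⁄(v.adicCompletion K)) :=
    ⟨_, rfl⟩
  have hmin : IsMinimal (v.adicCompletionIntegers K)
    ((E⁄(v.adicCompletion K)).minimal (v.adicCompletionIntegers K)) := inferInstance
  set V := (E⁄(v.adicCompletion K)).minimal (v.adicCompletionIntegers K)
  have hlift : ∀ x : K, v.valuation K x ≤ 1 → ∃ r : v.adicCompletionIntegers K,
      algebraMap _ (v.adicCompletion K) r = algebraMap K _ x := fun x hx =>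
    ⟨⟨algebraMap K _ x, by
      change Valued.v (algebraMap K (v.adicCompletion K) x) ≤ 1
      rwa [valued_algebraMap]⟩, rfl⟩
  have hE : WeierstrassCurve.IsIntegral (v.adicCompletionIntegers K) (E⁄(v.adicCompletion K)) :=
    isIntegral_of_exists_lift _ (hlift _ h₁) (hlift _ h₂) (hlift _ h₃) (hlift _ h₄) (hlift _ h₆)
  have hunit : ∀ r : v.adicCompletionIntegers K, Valued.v (r : v.adicCompletion K) = 1 ↔
      (IsDiscreteValuationRing.maximalIdeal (v.adicCompletionIntegers K)).valuation
        (v.adicCompletion K) (algebraMap _ _ r) = 1 := by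
    intro r
    have h1 : IsUnit r ↔ Valued.v (r : v.adicCompletion K) = 1 :=
      (Valuation.valuationSubring.integers _).isUnit_iff_valuation_eq_one
    rw [← h1, ← not_iff_not]
    refine Iff.trans ?_ ((HeightOneSpectrum.valuation_lt_one_iff_mem _ r).symm.trans
      (HeightOneSpectrum.valuation_le_one _ r).lt_iff_ne)
    exact (IsLocalRing.mem_maximalIdeal r).symm
  have hEV : C⁻¹ • V = E⁄(v.adicCompletion K) := by rw [hC, inv_smul_smul]
  have hval : (valuation_Δ_aux (v.adicCompletionIntegers K) (C⁻¹ • V)).1 = 1 := by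
    rw [hEV, valuation_Δ_aux_eq_of_isIntegral, ← integralModel_Δ_eq (v.adicCompletionIntegers K),
      ← hunit]
    have h := integralModel_Δ_eq (v.adicCompletionIntegers K) (E⁄(v.adicCompletion K))
    refine (congrArg Valued.v h).trans ?_
    change Valued.v (E.map (algebraMap K (v.adicCompletion K))).Δ = 1
    rw [map_Δ, valued_algebraMap, hΔ]
  have hmax := hmin.val_Δ_maximal.2 (j := C⁻¹)
    (show WeierstrassCurve.IsIntegral _ (C⁻¹ • V) by rw [hEV]; exact hE)
    (Subtype.coe_le_coe.mp ((valuation_Δ_aux (v.adicCompletionIntegers K)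
      ((1 : VariableChange (v.adicCompletion K)) • V)).2.trans_eq hval.symm))
  have hV : (valuation_Δ_aux (v.adicCompletionIntegers K) V).1 = 1 := by
    refine le_antisymm (valuation_Δ_aux _ V).2 ?_
    have := Subtype.coe_le_coe.mpr hmax
    dsimp only at this
    rw [one_smul] at this
    exact hval.symm.le.trans this
  rw [valuation_Δ_aux_eq_of_isIntegral, ← integralModel_Δ_eq (v.adicCompletionIntegers K),
    ← hunit] at hV
  exact (congrArg Valued.v (integralModel_Δ_eq (v.adicCompletionIntegers K) V)).symm.trans hV

lemma finite_setOf_valuation_ne_one {x : K} (hx : x ≠ 0) :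
    {v : HeightOneSpectrum (𝓞 K) | v.valuation K x ≠ 1}.Finite := by
  refine ((HeightOneSpectrum.Support.finite (𝓞 K) x).union
    (HeightOneSpectrum.Support.finite (𝓞 K) x⁻¹)).subset fun v hv => ?_
  rcases lt_or_gt_of_ne hv with h | h
  · right
    change 1 < v.valuation K x⁻¹
    rw [map_inv₀, one_lt_inv₀ (zero_lt_iff.mpr ((v.valuation K).ne_zero_iff.mpr hx))]
    exact h
  · exact Or.inl h

lemma finite_badPlaces [E.IsElliptic] {m : ℕ} (hm : m ≠ 0) : (badPlaces E m).Finite := by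
  have h1 : ∀ x : K, {v : HeightOneSpectrum (𝓞 K) | ¬ v.valuation K x ≤ 1}.Finite := fun x =>
    (HeightOneSpectrum.Support.finite (𝓞 K) x).subset fun v hv => not_le.mp hv
  refine ((((((h1 E.a₁).union (h1 E.a₂)).union (h1 E.a₃)).union (h1 E.a₄)).union (h1 E.a₆)).union
    ((finite_setOf_valuation_ne_one (x := (m : K)) (by exact_mod_cast hm)).union
    (finite_setOf_valuation_ne_one E.isUnit_Δ.ne_zero))).subset fun v hv => ?_
  by_contra hcon
  simp only [Set.mem_union, Set.mem_ofPred_eq, not_or, not_not] at hcon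
  obtain ⟨⟨⟨⟨⟨h₁, h₂⟩, h₃⟩, h₄⟩, h₆⟩, hmv, hΔ⟩ := hcon
  rcases hv with hv | hv
  · have := (v.valuation_lt_one_iff_mem (K := K) _).mpr hv
    have hmv' : v.valuation K (algebraMap (𝓞 K) K m) = 1 := by rw [map_natCast, hmv]
    exact this.ne hmv'
  · rw [valued_minimal_Δ_eq_one E h₁ h₂ h₃ h₄ h₆ hΔ] at hv
    exact lt_irrefl _ hv

/-- As `1 / m` is not an algebraic integer, `m` lies in some prime. This gives `s ≥ 1`, which lets
the contribution of the infinite places be absorbed into a multiple of `s`. -/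
lemma nonempty_badPlaces {m : ℕ} (hm : 1 < m) : (badPlaces E m).Nonempty := by
  have hne : Ideal.span {(m : 𝓞 K)} ≠ ⊤ := by
    rw [Ne, Ideal.span_singleton_eq_top]
    intro h
    have h1 : IsIntegral ℤ ((m : ℚ)⁻¹) := by
      have h2 : IsIntegral ℤ (algebraMap ℚ K (m : ℚ)⁻¹) := by
        obtain ⟨a, ha⟩ := h.exists_right_inv
        have h3 : (m : K) * (a : K) = 1 := by
          have := congrArg (algebraMap (𝓞 K) K) ha
          simpa using this
        have : algebraMap ℚ K (m : ℚ)⁻¹ = a := by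
          rw [map_inv₀, map_natCast]
          exact inv_eq_of_mul_eq_one_right h3
        rw [this]
        exact a.isIntegral_coe
      exact (isIntegral_algebraMap_iff (algebraMap ℚ K).injective).mp h2
    obtain ⟨z, hz⟩ := IsIntegrallyClosed.isIntegral_iff.mp h1
    have h4 : (m : ℤ) * z = 1 := by
      have hm0 : (m : ℚ) ≠ 0 := by positivity
      have : (m : ℚ) * (z : ℚ) = 1 := by
        have hz' : (z : ℚ) = (m : ℚ)⁻¹ := hz
        rw [hz', mul_inv_cancel₀ hm0]
      exact_mod_cast this
    have := Int.eq_one_or_neg_one_of_mul_eq_one h4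
    omega
  obtain ⟨M, hM, hle⟩ := Ideal.exists_le_maximal _ hne
  have hmM : (m : 𝓞 K) ∈ M := hle (Ideal.mem_span_singleton_self _)
  refine ⟨⟨M, hM.isPrime, fun h => ?_⟩, Or.inl hmM⟩
  rw [h, Ideal.mem_bot] at hmM
  have : m = 0 := by exact_mod_cast hmM
  omega

end BadPlaces

/-! ### Infinite places -/

section InfinitePlaces

variable {K : Type u} [Field K] [NumberField K]

lemma card_absGal_le_of_ringHom {F : Type u} [Field F] (i : F →+* ℂ) (n : ℕ)
    (hn : letI := i.toAlgebra; 0 < Module.finrank F ℂ ∧ Module.finrank F ℂ ≤ n) :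
    Finite (AbsGal F) ∧ Nat.card (AbsGal F) ≤ n := by
  let _ := i.toAlgebra
  have hf : FiniteDimensional F ℂ := FiniteDimensional.of_finrank_pos hn.1
  have : IsAlgClosure F ℂ := ⟨inferInstance, inferInstance⟩
  let e : AlgebraicClosure F ≃ₐ[F] ℂ := IsAlgClosure.equiv F (AlgebraicClosure F) ℂ
  have : FiniteDimensional F (AlgebraicClosure F) :=
    Module.Finite.equiv e.symm.toLinearEquiv
  have hfin : Finite (AbsGal F) := inferInstance
  refine ⟨hfin, ?_⟩
  rw [Nat.card_eq_fintype_card (α := AbsGal F)]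
  exact (AlgEquiv.card_le).trans (e.toLinearEquiv.finrank_eq.trans_le hn.2)

omit [NumberField K] in
lemma card_absGal_completion_le (w : InfinitePlace K) :
    Finite (AbsGal w.Completion) ∧ Nat.card (AbsGal w.Completion) ≤ 2 := by
  rcases w.isReal_or_isComplex with hw | hw
  · let e := InfinitePlace.Completion.ringEquivRealOfIsReal hw
    refine card_absGal_le_of_ringHom ((algebraMap ℝ ℂ).comp e.toRingHom) 2 ?_
    let _ := ((algebraMap ℝ ℂ).comp e.toRingHom).toAlgebra
    have : Module.finrank w.Completion ℂ = 2 := by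
      rw [Algebra.finrank_eq_of_equiv_equiv e (RingEquiv.refl ℂ) rfl, Complex.finrank_real_complex]
    exact ⟨by omega, by omega⟩
  · let e := InfinitePlace.Completion.ringEquivComplexOfIsComplex hw
    refine card_absGal_le_of_ringHom e.toRingHom 2 ?_
    let _ := e.toRingHom.toAlgebra
    have : Module.finrank w.Completion ℂ = 1 := by
      rw [Algebra.finrank_eq_of_equiv_equiv e (RingEquiv.refl ℂ) rfl, Module.finrank_self]
    exact ⟨by omega, by omega⟩

lemma card_infinitePlace_le : Nat.card (InfinitePlace K) ≤ Module.finrank ℚ K := by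
  rw [Nat.card_eq_fintype_card, InfinitePlace.card_eq_nrRealPlaces_add_nrComplexPlaces,
    ← InfinitePlace.card_add_two_mul_card_eq_rank K]
  omega

end InfinitePlaces

/-! ### Cohomology classes and cocycles -/

section Dictionary

variable {G : Type u} [Group G] [TopologicalSpace G] [IsTopologicalGroup G]

lemma finite_H1_of_cocycles {X : TopRep.{u} ℤ G} (S : Set (G → X)) (hS : Finite S)
    (h : ∀ (z : H1 X) (c : G → X), Represents z c → c ∈ S) :
    Finite (H1 X) ∧ Nat.card (H1 X) ≤ Nat.card S := by
  choose c hc using fun z : H1 X => exists_represents z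
  let f : H1 X → S := fun z => ⟨c z, h z _ (hc z)⟩
  have hf : Function.Injective f := fun z z' e => by
    refine (hc z).eq ?_
    rw [show c z = c z' from congrArg Subtype.val e]
    exact hc z'
  exact ⟨Finite.of_injective f hf, Nat.card_le_card_of_injective f hf⟩

variable {A : Type u} [AddCommGroup A]

lemma Represents.isCocycle {H : Type u} [Group H] {ρ : H →* AddMonoid.End A} {φ : G →* H}
    {z : H1 (TopRep.res φ (discreteRep ρ))} {c : G → A}
    (h : Represents (X := TopRep.res φ (discreteRep ρ)) z c) : IsCocycle (ρ.comp φ) c := by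
  refine ⟨fun g k => h.map_mul g k, fun a => ?_⟩
  have h1 := h.continuous
  exact (@continuous_def _ _ _ ⊥ _).mp h1 {a} trivial

end Dictionary

/-- Subtracting from `x` a chosen element of `X` with the same image leaves an element of the
kernel, hence of `T`; this element and `f x` determine `x`. -/
lemma card_le_card_mul {H Y : Type*} [AddCommGroup H] [AddCommGroup Y] (f : H →+ Y) [Finite Y]
    {X T : AddSubgroup H} (hT : T ≤ X) [Finite T] (h : ∀ x ∈ X, f x = 0 → x ∈ T) :
    Finite X ∧ Nat.card T ≤ Nat.card X ∧ Nat.card X ≤ Nat.card T * Nat.card Y := by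
  classical
  let s : Y → X := fun y => if h : ∃ x : X, f x = y then h.choose else 0
  have hs : ∀ x : X, f (s (f x)) = f x := fun x => by
    have hx : ∃ x' : X, f x' = f x := ⟨x, rfl⟩
    simp only [s, dif_pos hx]
    exact hx.choose_spec
  let g : X → T × Y := fun x => (⟨x - s (f x), h _ (X.sub_mem x.2 (s (f x)).2) (by
    rw [map_sub, hs, sub_self])⟩, f x)
  have hg : Function.Injective g := by
    intro x x' e
    have e2 : f x = f x' := congrArg Prod.snd e
    have e1 : (x : H) - s (f x) = x' - s (f x') := congrArg Subtype.val (congrArg Prod.fst e)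
    rw [e2] at e1
    exact Subtype.ext (sub_left_inj.mp e1)
  have hX : Finite X := Finite.of_injective g hg
  refine ⟨hX, Nat.card_le_card_of_injective _ (AddSubgroup.inclusion_injective hT), ?_⟩
  rw [← Nat.card_prod]
  exact Nat.card_le_card_of_injective g hg

/-! ### The torsion module -/

section Torsion

open scoped Classical WeierstrassCurve
open WeierstrassCurve WeierstrassCurve.Affine

variable {K : Type u} [Field K] [CharZero K] (E : WeierstrassCurve K)

/-- The `m`-torsion points over the algebraic closure. -/
abbrev Tors (m : ℕ) : Type u :=
  Submodule.torsionBy ℤ (E⁄(AlgebraicClosure K)).toAffine.Point (m : ℤ)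

omit [CharZero K] in
lemma nsmul_tors {m : ℕ} (a : Tors E m) : m • a = 0 := by
  refine Subtype.ext ?_
  have := (Submodule.mem_torsionBy_iff _ _).mp a.2
  rwa [natCast_zsmul] at this

variable [E.IsElliptic]

attribute [local instance] isElliptic_baseChange

omit [E.IsElliptic] in
lemma finite_tors {m : ℕ} (hm : m ≠ 0) : Finite (Tors E m) ∧ Nat.card (Tors E m) ≤ 2 * m ^ 2 := by
  obtain ⟨h1, h2⟩ := finite_torsion (W := E⁄(AlgebraicClosure K)) (m := m) (by exact_mod_cast hm)
  have e : ((Submodule.torsionBy ℤ (E⁄(AlgebraicClosure K)).toAffine.Point (m : ℤ) : Submodule ℤ _) :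
      Set (E⁄(AlgebraicClosure K)).toAffine.Point) = {P | m • P = 0} := by
    ext P
    rw [SetLike.mem_coe, Submodule.mem_torsionBy_iff, natCast_zsmul]
    rfl
  rw [← e] at h1 h2
  exact ⟨h1.to_subtype, h2⟩

omit [E.IsElliptic] in
lemma isOpen_torsionAction {m : ℕ} (hm : m ≠ 0) : IsOpen {g | torsionAction E m g = 1} := by
  have := (finite_tors E hm).1
  have : {g | torsionAction E m g = 1} =
      ⋂ a : Tors E m, {g | pointsAction E K g (a : (E⁄(AlgebraicClosure K)).toAffine.Point) = a} := by
    ext g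
    simp only [Set.mem_iInter, Set.mem_ofPred_eq]
    refine ⟨fun h a => congrArg Subtype.val (DFunLike.congr_fun h a), fun h => ?_⟩
    ext a : 2
    exact h a
  rw [this]
  exact isOpen_iInter_of_finite fun a => isOpen_pointsAction_stabilizer E _

variable (L : Type u) [Field L] [Algebra K L]

/-- The map `E[m] → E(L̄)`. -/
def torsMap (m : ℕ) : Tors E m →+ (E⁄(AlgebraicClosure L)).toAffine.Point :=
  (Affine.Point.map (W' := E) (closureEmb K L)).comp
    (Submodule.subtype (Submodule.torsionBy ℤ _ (m : ℤ))).toAddMonoidHom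

variable {m : ℕ}

omit [CharZero K] [E.IsElliptic] in
lemma torsMap_injective : Function.Injective (torsMap E L m) :=
  (Affine.Point.map_injective (W' := E) (closureEmb K L)).comp Subtype.val_injective

omit [CharZero K] [E.IsElliptic] in
lemma torsMap_torsionAction (σ : AbsGal L) (a : Tors E m) :
    torsMap E L m (torsionAction E m (galRes K L σ) a) = pointsAction E L σ (torsMap E L m a) := by
  obtain ⟨P, hP⟩ := a
  change Affine.Point.map (W' := E) (closureEmb K L)
      (Affine.Point.map (W' := E) ((galResHom K L σ : AbsGal K) : _ →ₐ[K] _) P) =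
    Affine.Point.map (W' := E) (σ : _ →ₐ[L] _) (Affine.Point.map (W' := E) (closureEmb K L) P)
  rcases P with _ | ⟨x, y, h⟩
  · rfl
  · simp only [Affine.Point.map_some, AlgEquiv.coe_toAlgHom, closureEmb_galResHom]

omit [CharZero K] [E.IsElliptic] in
lemma nsmul_torsMap (a : Tors E m) : m • torsMap E L m a = 0 := by
  rw [← map_nsmul, nsmul_tors, map_zero]

omit [CharZero K] [E.IsElliptic] in
lemma H1loc_eq_zero_iff {z : H1 (torsionRep E m)} {c : AbsGal K → Tors E m}
    (h : Represents (X := torsionRep E m) z c) : H1loc E m L z = 0 ↔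
      ∃ Q, ∀ σ, torsMap E L m (c (galRes K L σ)) = pointsAction E L σ Q - Q :=
  (h.map (galRes K L) (torsionToPoints E m L)).eq_zero_iff

omit [CharZero K] [E.IsElliptic] in
lemma H1res_eq_zero_iff {z : H1 (torsionRep E m)} {c : AbsGal K → Tors E m}
    (h : Represents (X := torsionRep E m) z c) : H1res (galRes K L) (torsionRep E m) z = 0 ↔
      ∃ a, ∀ σ, c (galRes K L σ) = torsionAction E m (galRes K L σ) a - a :=
  (h.res (galRes K L)).eq_zero_iff

end Torsion

/-! ### The local conditions at good places -/

section LocalConditions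

open scoped Classical WeierstrassCurve
open WeierstrassCurve WeierstrassCurve.Affine

variable {K : Type u} [Field K] [NumberField K] (E : WeierstrassCurve K) [E.IsElliptic] {m : ℕ}
  {v : HeightOneSpectrum (𝓞 K)}

attribute [local instance] charZero_adicCompletion isElliptic_baseChange

variable {E}

lemma pointsAction_eq_of_mem_inertia (hv : v ∉ badPlaces E m)
    {σ : AbsGal (v.adicCompletion K)} (hσ : σ ∈ inertia v)
    {Q : (E⁄(AlgebraicClosure (v.adicCompletion K))).toAffine.Point}
    (hQ : m • pointsAction E _ σ Q = m • Q) : pointsAction E _ σ Q = Q := by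
  obtain ⟨C, hV⟩ := exists_isGoodModel E hv
  exact pointsAction_eq_of_mem_inertiaSet E (isLocalVal_extVal v) hV
    (extVal_natCast_eq_one fun h => hv (Or.inl h)) ((mem_inertia_iff_mem_inertiaSet σ).mp hσ) hQ

lemma torsionAction_eq_one_of_mem_inertia (hv : v ∉ badPlaces E m)
    {σ : AbsGal (v.adicCompletion K)} (hσ : σ ∈ inertia v) :
    torsionAction E m (galRes K (v.adicCompletion K) σ) = 1 := by
  refine DFunLike.ext _ _ fun a => torsMap_injective E (v.adicCompletion K) ?_
  rw [torsMap_torsionAction]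
  refine pointsAction_eq_of_mem_inertia hv hσ ?_
  rw [← map_nsmul, nsmul_torsMap, map_zero]

lemma eq_zero_of_coboundary_point (hv : v ∉ badPlaces E m) {c : AbsGal K → Tors E m}
    {Q : (E⁄(AlgebraicClosure (v.adicCompletion K))).toAffine.Point}
    (hQ : ∀ σ, torsMap E _ m (c (galRes K (v.adicCompletion K) σ)) = pointsAction E _ σ Q - Q)
    {σ : AbsGal (v.adicCompletion K)} (hσ : σ ∈ inertia v) :
    c (galRes K (v.adicCompletion K) σ) = 0 := by
  refine torsMap_injective E (v.adicCompletion K) ?_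
  rw [hQ, map_zero, sub_eq_zero]
  refine pointsAction_eq_of_mem_inertia hv hσ ?_
  rw [← sub_eq_zero, ← nsmul_sub, ← hQ, nsmul_torsMap]

/-- This is the converse of `eq_zero_of_coboundary_point`: at a good place the unramified classes
are exactly those that satisfy the Selmer condition. -/
lemma exists_point_of_eq_zero (hm : m ≠ 0) (hv : v ∉ badPlaces E m) {c : AbsGal K → Tors E m}
    (hc : IsCocycle (torsionAction E m) c)
    (hcI : ∀ σ ∈ inertia v, c (galRes K (v.adicCompletion K) σ) = 0) :
    ∃ Q, ∀ σ, torsMap E _ m (c (galRes K (v.adicCompletion K) σ)) = pointsAction E _ σ Q - Q := by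
  obtain ⟨C, hV⟩ := exists_isGoodModel E hv
  have hvm := extVal_natCast_eq_one fun h => hv (Or.inl h)
  have hw := isLocalVal_extVal v
  obtain ⟨E₁, hE, htors, hfin⟩ := exists_fixedPts_subgroup E hw hV hvm
  have hker : Finite (DistribSMul.toAddMonoidHom
      (E⁄(AlgebraicClosure (v.adicCompletion K))).toAffine.Point m).ker :=
    (finite_torsion (W := E⁄(AlgebraicClosure (v.adicCompletion K))) (m := m)
      (by exact_mod_cast hm)).1.to_subtype
  refine exists_point_of_unramified hw (pointsAction E (v.adicCompletion K))
    (isOpen_pointsAction_stabilizer E) (m := m) (exists_smul_eq hm) hker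
    (fun σ hσ Q hQ => pointsAction_eq_of_mem_inertia hv
      ((mem_inertia_iff_mem_inertiaSet σ).mpr hσ) hQ) E₁ hE htors hfin
    (fun σ => torsMap E _ m (c (galRes K (v.adicCompletion K) σ))) ⟨?_, ?_⟩
    (fun σ => nsmul_torsMap E _ _) ?_
  · intro g h
    rw [map_mul, hc.map_mul, map_add, torsMap_torsionAction]
  · intro P
    by_cases hP : ∃ a, torsMap E (v.adicCompletion K) m a = P
    · obtain ⟨a, rfl⟩ := hP
      have := (hc.isOpen_fiber a).preimage (galRes K (v.adicCompletion K)).continuous_toFun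
      convert this using 1
      ext σ
      exact (torsMap_injective E (v.adicCompletion K)).eq_iff
    · convert isOpen_empty
      ext σ
      simp only [Set.mem_ofPred_eq, Set.mem_empty_iff_false, iff_false]
      exact fun h => hP ⟨_, h⟩
  · intro σ hσ
    rw [hcI σ ((mem_inertia_iff_mem_inertiaSet σ).mpr hσ), map_zero]

omit [E.IsElliptic] in
lemma mem_H1ur_iff {z : H1 (torsionRep E m)} {c : AbsGal K → Tors E m}
    (h : Represents (X := torsionRep E m) z c) (v : HeightOneSpectrum (𝓞 K)) :
    z ∈ (H1ur v (TopRep.res (galRes K (v.adicCompletion K) :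
      AbsGal (v.adicCompletion K) →* AbsGal K) (torsionRep E m))).comap
      (H1res (galRes K (v.adicCompletion K)) (torsionRep E m)).toLinearMap ↔
    ∃ a, ∀ σ : inertia v, c (galRes K (v.adicCompletion K) σ) =
      torsionAction E m (galRes K (v.adicCompletion K) σ) a - a :=
  ((h.res (galRes K (v.adicCompletion K))).res (inertiaIncl v)).eq_zero_iff

end LocalConditions

/-! ### Comparison of the Selmer group and the class group -/

section Comparison

open scoped Classical WeierstrassCurve
open WeierstrassCurve WeierstrassCurve.Affine

variable {K : Type u} [Field K] [NumberField K] (E : WeierstrassCurve K) (m : ℕ)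

/-- The classes unramified at all good places. -/
def goodClasses : Submodule ℤ (H1 (torsionRep E m)) :=
  ⨅ (v : HeightOneSpectrum (𝓞 K)) (_ : v ∉ badPlaces E m),
    (H1ur v (TopRep.res (galRes K (v.adicCompletion K) :
      AbsGal (v.adicCompletion K) →* AbsGal K) (torsionRep E m))).comap
      (H1res (galRes K (v.adicCompletion K)) (torsionRep E m)).toLinearMap

/-- The group `H¹(L, E[m])`. -/
def LocalH1 (L : Type u) [Field L] [Algebra K L] : Type u :=
  H1 (TopRep.res (galRes K L : AbsGal L →* AbsGal K) (torsionRep E m))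

instance (L : Type u) [Field L] [Algebra K L] : AddCommGroup (LocalH1 E m L) :=
  inferInstanceAs (AddCommGroup (H1 (TopRep.res (galRes K L : AbsGal L →* AbsGal K)
    (torsionRep E m))))

/-- The restriction map `H¹(K, E[m]) → H¹(L, E[m])`. -/
def localRes (L : Type u) [Field L] [Algebra K L] : H1 (torsionRep E m) →+ LocalH1 E m L :=
  (H1res (galRes K L) (torsionRep E m)).toLinearMap.toAddMonoidHom

/-- The localization map at the bad and at the infinite places. -/
def localize : H1 (torsionRep E m) →+ (∀ v : badPlaces E m, LocalH1 E m (v.1.adicCompletion K)) ×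
    (∀ w : InfinitePlace K, LocalH1 E m w.Completion) where
  toFun z := (fun v => localRes E m (v.1.adicCompletion K) z, fun w => localRes E m w.Completion z)
  map_zero' := Prod.ext (funext fun _ => map_zero _) (funext fun _ => map_zero _)
  map_add' _ _ := Prod.ext (funext fun _ => map_add _ _ _) (funext fun _ => map_add _ _ _)

/-- The classes unramified at good places and trivial at all others. -/
def trivialClasses : AddSubgroup (H1 (torsionRep E m)) :=
  (goodClasses E m).toAddSubgroup ⊓ (localize E m).ker

variable {E m} {z : H1 (torsionRep E m)} {c : AbsGal K → Tors E m}
    (h : Represents (X := torsionRep E m) z c)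

include h

lemma mem_ker_localize_iff : z ∈ (localize E m).ker ↔
    (∀ v ∈ badPlaces E m, ∃ a, ∀ σ, c (galRes K (v.adicCompletion K) σ) =
      torsionAction E m (galRes K (v.adicCompletion K) σ) a - a) ∧
    (∀ w : InfinitePlace K, ∃ a, ∀ σ, c (galRes K w.Completion σ) =
      torsionAction E m (galRes K w.Completion σ) a - a) := by
  rw [AddMonoidHom.mem_ker]
  constructor
  · intro h0
    exact ⟨fun v hv => (H1res_eq_zero_iff E _ h).mp (congrFun (congrArg Prod.fst h0) ⟨v, hv⟩),
      fun w => (H1res_eq_zero_iff E _ h).mp (congrFun (congrArg Prod.snd h0) w)⟩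
  · rintro ⟨h1, h2⟩
    exact Prod.ext (funext fun v => (H1res_eq_zero_iff E _ h).mpr (h1 v v.2))
      (funext fun w => (H1res_eq_zero_iff E _ h).mpr (h2 w))

lemma mem_Sel_iff : z ∈ Sel E m ↔
    (∀ v : HeightOneSpectrum (𝓞 K), ∃ Q, ∀ σ,
      torsMap E _ m (c (galRes K (v.adicCompletion K) σ)) = pointsAction E _ σ Q - Q) ∧
    (∀ w : InfinitePlace K, ∃ Q, ∀ σ,
      torsMap E _ m (c (galRes K w.Completion σ)) = pointsAction E _ σ Q - Q) := by
  rw [Sel, Submodule.mem_inf, Submodule.mem_iInf, Submodule.mem_iInf]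
  exact and_congr (forall_congr' fun v => H1loc_eq_zero_iff E _ h)
    (forall_congr' fun w => H1loc_eq_zero_iff E _ h)

variable [E.IsElliptic]

lemma mem_goodClasses_iff : z ∈ goodClasses E m ↔ ∀ v, v ∉ badPlaces E m → ∀ σ ∈ inertia v,
    c (galRes K (v.adicCompletion K) σ) = 0 := by
  rw [goodClasses, Submodule.mem_iInf]
  refine forall_congr' fun v => ?_
  rw [Submodule.mem_iInf]
  refine forall_congr' fun hv => ?_
  rw [mem_H1ur_iff h]
  constructor
  · rintro ⟨a, ha⟩ σ hσ
    rw [ha ⟨σ, hσ⟩, torsionAction_eq_one_of_mem_inertia hv hσ]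
    exact sub_self a
  · intro h0
    refine ⟨0, fun σ => ?_⟩
    rw [h0 σ σ.2, map_zero, sub_zero]

omit h in
lemma Sel_le_goodClasses : Sel E m ≤ goodClasses E m := by
  intro z hz
  obtain ⟨c, h⟩ := exists_represents z
  rw [mem_goodClasses_iff h]
  intro v hv σ hσ
  obtain ⟨Q, hQ⟩ := ((mem_Sel_iff h).mp hz).1 v
  exact eq_zero_of_coboundary_point hv hQ hσ

omit h in
-- `E[m]` is unramified at every good place, so the conditions defining `goodClasses` are among
-- those defining `Cl`.
lemma Cl_le_goodClasses : Cl (torsionRep E m) ≤ goodClasses E m :=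
  iInf_mono fun v => iInf_mono' fun hv => ⟨fun σ hσ a => by
    refine DFunLike.congr_fun (torsionAction_eq_one_of_mem_inertia hv hσ) a, le_rfl⟩

omit h in
lemma trivialClasses_le_Sel (hm : m ≠ 0) : trivialClasses E m ≤ (Sel E m).toAddSubgroup := by
  intro z hz
  obtain ⟨c, h⟩ := exists_represents z
  obtain ⟨h1, h2⟩ := (mem_ker_localize_iff h).mp hz.2
  have h3 := (mem_goodClasses_iff h).mp hz.1
  have key : ∀ (L : Type u) [Field L] [Algebra K L], (∃ a, ∀ σ, c (galRes K L σ) =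
      torsionAction E m (galRes K L σ) a - a) →
      ∃ Q, ∀ σ, torsMap E L m (c (galRes K L σ)) = pointsAction E L σ Q - Q := by
    rintro L _ _ ⟨a, ha⟩
    exact ⟨torsMap E L m a, fun σ => by rw [ha, map_sub, torsMap_torsionAction]⟩
  refine (mem_Sel_iff h).mpr ?_
  refine ⟨fun v => ?_, fun w => key _ (h2 w)⟩
  by_cases hv : v ∈ badPlaces E m
  · exact key _ (h1 v hv)
  · exact exists_point_of_eq_zero hm hv
      (h.isCocycle (φ := MonoidHom.id _)) (h3 v hv)

omit h [E.IsElliptic] in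
-- `E[m]` may also be unramified at a bad place; the condition imposed by `Cl` holds there because
-- the class is locally trivial.
lemma trivialClasses_le_Cl : trivialClasses E m ≤ (Cl (torsionRep E m)).toAddSubgroup := by
  intro z hz
  obtain ⟨c, h⟩ := exists_represents z
  obtain ⟨h1, -⟩ := (mem_ker_localize_iff h).mp hz.2
  rw [Submodule.mem_toAddSubgroup, Cl, Submodule.mem_iInf]
  intro v
  rw [Submodule.mem_iInf]
  intro hv
  by_cases hb : v ∈ badPlaces E m
  · obtain ⟨a, ha⟩ := h1 v hb
    exact (mem_H1ur_iff h v).mpr ⟨a, fun σ => ha σ⟩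
  · have : z ∈ goodClasses E m := hz.1
    rw [goodClasses, Submodule.mem_iInf] at this
    have := this v
    rw [Submodule.mem_iInf] at this
    exact this hb

omit h in
lemma finite_trivialClasses (hm : m ≠ 0) : Finite (trivialClasses E m) := by
  have := (finite_tors E hm).1
  have hZ := finite_isLocallySmall (act := torsionAction E m) hm (nsmul_tors E)
    (isOpen_torsionAction E hm)
  choose c hc using fun z : H1 (torsionRep E m) => exists_represents z
  refine Finite.of_injective (β := {c | IsCocycle (torsionAction E m) c ∧
    ∀ v, IsLocallySmall (torsionAction E m) m c v}) (fun z => ⟨c z, (hc z).isCocycle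
      (φ := MonoidHom.id _), fun v => ?_⟩) ?_
  · by_cases hv : v ∈ badPlaces E m
    · exact Or.inr (((mem_ker_localize_iff (hc z)).mp z.2.2).1 v hv)
    · exact Or.inl ⟨fun h' => hv (Or.inl h'), fun σ hσ =>
        ⟨torsionAction_eq_one_of_mem_inertia hv hσ, (mem_goodClasses_iff (hc z)).mp z.2.1 v hv σ hσ⟩⟩
  · intro z z' e
    have e' : c z = c z' := congrArg Subtype.val e
    refine Subtype.ext ((hc z).eq ?_)
    rw [e']
    exact hc z'

end Comparison

/-! ### The bound -/

section Bound

variable {K : Type u} [Field K] [NumberField K] (E : WeierstrassCurve K) {m n : ℕ}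

attribute [local instance] charZero_adicCompletion

/-- A bound for the local cohomology groups of the `m`-torsion over number fields of degree `n`. -/
def localBound (m n : ℕ) : ℕ :=
  -- The first summand is the bound of `card_local_cocycles_le` with `a = 2 m²`, which bounds
  -- `#E[m]`. The second counts all maps to `E[m]` from a group of order at most two, for the
  -- infinite places.
  (2 * m ^ 2) ^ ((2 * m ^ 2) ^ (2 * m ^ 2) * m) *
    (m * (m * ((m ^ (m + 1)) ^ n) ^ ((2 * m ^ 2) ^ (2 * m ^ 2) * m))) ^ (2 * m ^ 2) +
  (2 * m ^ 2) ^ 2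

lemma card_localH1_adicCompletion_le (hm : m ≠ 0) (hn : Module.finrank ℚ K = n)
    (v : HeightOneSpectrum (𝓞 K)) : Finite (LocalH1 E m (v.adicCompletion K)) ∧
      Nat.card (LocalH1 E m (v.adicCompletion K)) ≤ localBound m n := by
  obtain ⟨hfin, hcard⟩ := finite_tors E hm
  have hopen := (isOpen_torsionAction E hm).preimage (galRes K (v.adicCompletion K)).continuous_toFun
  obtain ⟨h1, h2⟩ := card_local_cocycles_le v hm (nsmul_tors E) hcard hn
    ((torsionAction E m).comp (galRes K (v.adicCompletion K) :
      AbsGal (v.adicCompletion K) →* AbsGal K)) hopen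
  obtain ⟨h3, h4⟩ := finite_H1_of_cocycles (X := TopRep.res (galRes K (v.adicCompletion K) :
      AbsGal (v.adicCompletion K) →* AbsGal K) (torsionRep E m))
    {c : AbsGal (v.adicCompletion K) → Tors E m | IsCocycle ((torsionAction E m).comp
      (galRes K (v.adicCompletion K) : AbsGal (v.adicCompletion K) →* AbsGal K)) c} h1
    fun z c h => h.isCocycle
  exact ⟨h3, h4.trans (h2.trans (Nat.le_add_right _ _))⟩

lemma card_localH1_completion_le (hm : m ≠ 0) (n : ℕ) (w : InfinitePlace K) :
    Finite (LocalH1 E m w.Completion) ∧ Nat.card (LocalH1 E m w.Completion) ≤ localBound m n := by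
  obtain ⟨hfin, hcard⟩ := finite_tors E hm
  obtain ⟨h1, h2⟩ := card_absGal_completion_le w
  have hS : Finite (Set.univ : Set (AbsGal w.Completion → Tors E m)) := Set.finite_univ.to_subtype
  obtain ⟨h3, h4⟩ := finite_H1_of_cocycles (X := TopRep.res (galRes K w.Completion :
      AbsGal w.Completion →* AbsGal K) (torsionRep E m))
    (Set.univ : Set (AbsGal w.Completion → Tors E m)) hS
    fun z c h => trivial
  refine ⟨h3, h4.trans ?_⟩
  change Nat.card (Set.univ : Set (AbsGal w.Completion → Tors E m)) ≤ _
  rw [Nat.card_congr (Equiv.Set.univ _), Nat.card_fun]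
  refine ((Nat.pow_le_pow_left hcard _).trans (Nat.pow_le_pow_right ?_ h2)).trans
    (Nat.le_add_left _ _)
  positivity

variable [E.IsElliptic]

lemma card_localClasses_le (hm : m ≠ 0) (hn : Module.finrank ℚ K = n) :
    Finite ((∀ v : badPlaces E m, LocalH1 E m (v.1.adicCompletion K)) ×
      (∀ w : InfinitePlace K, LocalH1 E m w.Completion)) ∧
    Nat.card ((∀ v : badPlaces E m, LocalH1 E m (v.1.adicCompletion K)) ×
      (∀ w : InfinitePlace K, LocalH1 E m w.Completion)) ≤
      localBound m n ^ ((badPlaces E m).ncard + n) := by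
  have hfin : Finite (badPlaces E m) := finite_badPlaces E hm
  have := Fintype.ofFinite (badPlaces E m)
  have h1 := fun v : badPlaces E m => card_localH1_adicCompletion_le E hm hn v.1
  have h2 := fun w => card_localH1_completion_le E hm n w
  have := fun v => (h1 v).1
  have := fun w => (h2 w).1
  have hpos : 1 ≤ localBound m n := by
    have : 0 < m := Nat.pos_of_ne_zero hm
    change 0 < localBound m n
    unfold localBound
    positivity
  refine ⟨inferInstance, ?_⟩
  rw [Nat.card_prod, Nat.card_pi, Nat.card_pi, pow_add]
  refine Nat.mul_le_mul ?_ ?_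
  · refine (Finset.prod_le_pow_card _ _ _ fun v _ => (h1 v).2).trans ?_
    rw [Finset.card_univ, ← Nat.card_eq_fintype_card, Nat.card_coe_set_eq]
  · refine (Finset.prod_le_pow_card _ _ _ fun w _ => (h2 w).2).trans
      (Nat.pow_le_pow_right hpos ?_)
    rw [Finset.card_univ, ← Nat.card_eq_fintype_card]
    exact card_infinitePlace_le.trans_eq hn

lemma card_between_le (hm : m ≠ 0) (hn : Module.finrank ℚ K = n)
    {X : Submodule ℤ (H1 (torsionRep E m))} (hX : trivialClasses E m ≤ X.toAddSubgroup)
    (hX' : X ≤ goodClasses E m) :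
    Finite X ∧ Nat.card (trivialClasses E m) ≤ Nat.card X ∧
      Nat.card X ≤ Nat.card (trivialClasses E m) * localBound m n ^ ((badPlaces E m).ncard + n) := by
  obtain ⟨h1, h2⟩ := card_localClasses_le E hm hn
  have := finite_trivialClasses (E := E) hm
  obtain ⟨h3, h4, h5⟩ := card_le_card_mul (localize E m) hX fun z hz h0 => ⟨hX' hz, h0⟩
  exact ⟨h3, h4, h5.trans (Nat.mul_le_mul_left _ h2)⟩

end Bound

lemma abs_log_div_le {x y t B : ℝ} (ht : 0 < t) (hx : t ≤ x) (hx' : x ≤ t * B) (hy : t ≤ y)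
    (hy' : y ≤ t * B) : |Real.log (x / y)| ≤ Real.log B := by
  have hx0 := ht.trans_le hx
  have hy0 := ht.trans_le hy
  have hB : 0 < B := pos_of_mul_pos_right (hx0.trans_le hx') ht.le
  have h1 := Real.log_le_log ht hx
  have h2 := Real.log_le_log ht hy
  have h3 := Real.log_le_log hx0 hx'
  have h4 := Real.log_le_log hy0 hy'
  rw [Real.log_mul ht.ne' hB.ne'] at h3 h4
  rw [Real.log_div hx0.ne' hy0.ne', abs_le]
  constructor <;> linarith

end EllSel

end

/-! ### Comparison of the orders of the two groups -/

theorem mainTheorem5 (m n : ℕ) (hm : 1 < m) :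
    ∃ C : ℝ, ∀ (K : Type u) [Field K] [NumberField K] (E : WeierstrassCurve K) [E.IsElliptic],
      Module.finrank ℚ K = n →
        Finite (EllSel.Sel E m) ∧ Finite (EllSel.Cl (EllSel.torsionRep E m)) ∧
        |Real.log ((Nat.card (EllSel.Sel E m) : ℝ) /
            (Nat.card (EllSel.Cl (EllSel.torsionRep E m)) : ℝ))| ≤
          C * ((EllSel.badPlaces E m).ncard : ℝ) := by
  have hm0 : m ≠ 0 := by omega
  refine ⟨(1 + n) * Real.log (EllSel.localBound m n), fun K _ _ E _ hn => ?_⟩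
  obtain ⟨h1, h2, h3⟩ := EllSel.card_between_le E hm0 hn (EllSel.trivialClasses_le_Sel hm0)
    EllSel.Sel_le_goodClasses
  obtain ⟨h4, h5, h6⟩ := EllSel.card_between_le E hm0 hn EllSel.trivialClasses_le_Cl
    EllSel.Cl_le_goodClasses
  refine ⟨h1, h4, ?_⟩
  have hT : Finite (EllSel.trivialClasses E m) := EllSel.finite_trivialClasses hm0
  have ht : (0 : ℝ) < Nat.card (EllSel.trivialClasses E m) := by
    exact_mod_cast Nat.card_pos
  refine (EllSel.abs_log_div_le ht (by exact_mod_cast h2)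
    (B := (EllSel.localBound m n : ℝ) ^ ((EllSel.badPlaces E m).ncard + n))
    (by exact_mod_cast h3) (by exact_mod_cast h5) (by exact_mod_cast h6)).trans ?_
  rw [Real.log_pow]
  have hs : (1 : ℝ) ≤ (EllSel.badPlaces E m).ncard := by
    exact_mod_cast (Set.ncard_pos (EllSel.finite_badPlaces E hm0)).mpr
      (EllSel.nonempty_badPlaces E hm)
  have hlog : 0 ≤ Real.log (EllSel.localBound m n) := Real.log_natCast_nonneg _
  have hn0 : (0 : ℝ) ≤ n := Nat.cast_nonneg n
  push_cast
  -- With `B = localBound m n`, the inequality `(s + n) log B ≤ (1 + n) s log B` amounts to `n log B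
  -- (s - 1) ≥ 0`.
  nlinarith [mul_nonneg (mul_nonneg hn0 hlog) (sub_nonneg.mpr hs)]
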